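/- **Setting.** A periodic MDP with known period $N\ge 2$ has a finite state space $\mathcal S$ ($|\mathcal S|=S$), a finite action space $\mathcal A$ ($|\mathcal A|=A$) and, for each period index $n\in\{1,\dots,N\}$, transition probabilities $p_n(\cdot\mid s,a)$ and mean rewards $r_n(s,a)\in[0,1]$. At step $t=1,2,\dots$ the period index is $n_t=((t-1)\bmod N)+1$; after action $a_t$ in state $s_t$ a reward $r_t\in[0,1]$ with conditional mean $r_{n_t}(s_t,a_t)$ given the past is observed, and the next state has conditional law $p_{n_t}(\cdot\mid s_t,a_t)$. The augmented MDP is the stationary MDP on $\mathcal S\times\{1,\dots,N\}$ which moves from $(s,n)$ under $a$ to $(s',n')$ with probability $p_n(s'\mid s,a)$ if $n'$ is the cyclic successor of $n$ and $0$ otherwise, with mean reward $r_n(s,a)$. Let $\rho^*$ be its optimal average reward (the largest Cesàro limit of expected rewards over stationary policies $\pi:\mathcal S\times\{1,\dots,N\}\to\mathcal A$ and starting states), and let $$D_{aug}=\max_{s\in\mathcal S}\ \max_{(s',n')\ne(s,1)}\ \min_{\pi}\ \mathbb E_\pi\big[\text{first hitting time of }(s',n')\text{ from }(s,1)\big].$$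 **PUCRL2** (confidence parameter $\delta\in(0,1)$, transformation coefficient $\tau\in(0,1)$, reference augmented state $x^*$). It proceeds in phases; let phase $k$ start at step $t_k$ ($t_1=1$). For an augmented state $x=(s,n)$ and an action $a$ let $n_k(x,a)$ be the maximum of $1$ and the number of earlier visits to $(x,a)$, let $\hat p_k(s'\mid x,a)$ be the number of earlier visits to $(x,a)$ followed by $s'$, divided by $n_k(x,a)$, and let $\hat r_k(x,a)$ be the sum of the rewards observed at these visits, divided by $n_k(x,a)$. Let $\mathcal P_k(x,a)$ be the set of probability vectors $q$ on $\mathcal S$ with $\|q-\hat p_k(\cdot\mid x,a)\|_1\le\sqrt{14SN\log(2At_k/\delta)/n_k(x,a)}$, and $\mathcal R_k(x,a)$ the set of $v\in[0,1]$ with $|v-\hat r_k(x,a)|\le\sqrt{7\log(2SAt_k/\delta)/(2n_k(x,a))}$. Modified extended value iteration starts with $u_0=0$ and computes $$\bar u_{i+1}(s,n)=\max_{a}\Big\{\max_{v\in\mathcal R_k((s,n),a)}v+\tau\max_{q\in\mathcal P_k((s,n),a)}\sum_{s'}q(s')\,u_i(s',n+1)\Big\}+(1-\tau)u_i(s,n),\qquad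 u_{i+1}=\bar u_{i+1}-\bar u_{i+1}(x^*)$$ (with $n+1$ read cyclically), up to the first $i$ with $\max(u_{i+1}-u_i)-\min(u_{i+1}-u_i)\le 1/\sqrt{t_k}$; the policy $\tilde\pi_k$ then picks actions that attain the maximum over $a$ for this $i$ (ties broken arbitrarily). PUCRL2 follows $\tilde\pi_k$ until it is in an augmented state $x$ such that $(x,\tilde\pi_k(x))$ has already been visited $n_k(x,\tilde\pi_k(x))$ times within the phase; then phase $k+1$ starts. **Theorem 1.** Suppose $D_{aug}<\infty$. For every initial state, with probability at least $1-\delta$, the regret of PUCRL2 satisfies, simultaneously for all $T\ge 2$, $$\sum_{t=1}^{T}(\rho^*-r_t)\ \le\ 34\,D_{aug}\,S\,N\,\sqrt{A\,T\log(T/\delta)} .$$ -/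

import Mathlib

open MeasureTheory ProbabilityTheory Filter Topology Finset

noncomputable section

/-- A stationary MDP with finite state space `X`: transition probabilities and mean rewards
in `[0, 1]`. -/
structure MDP (X A : Type*) [Fintype X] where
  p : X → A → X → ℝ
  p_nonneg : ∀ x a y, 0 ≤ p x a y
  p_sum : ∀ x a, ∑ y, p x a y = 1
  r : X → A → ℝ
  r_mem : ∀ x a, r x a ∈ Set.Icc (0 : ℝ) 1

namespace MDP

variable {X A : Type*} [Fintype X] (M : MDP X A)

/-- Expected reward collected at step `t` (counted from `0`) by the stationary policy `π`
started in `x`, i.e. `(P_π ^ t r_π) x`. -/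
def expReward (π : X → A) : ℕ → X → ℝ
  | 0, x => M.r x (π x)
  | t + 1, x => ∑ y, M.p x (π x) y * expReward π t y

/-- `g` is the gain (long-run average expected reward, a Cesàro limit) of the stationary policy
`π` started in `x`. -/
def IsGain (π : X → A) (x : X) (g : ℝ) : Prop :=
  Tendsto (fun T : ℕ => (∑ t ∈ range T, M.expReward π t x) / T) atTop (𝓝 g)

/-- The optimal average reward `ρ*`: the largest gain over stationary policies (and over starting
states; it does not depend on the starting state when every state can be reached from every
other one). -/
def optGain : ℝ := sSup {g | ∃ π x, M.IsGain π x g}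

/-- `survival π z t x` is the probability that the chain of `π` started in `x` avoids `z` at all
of the times `0, …, t`, that is, that the first hitting time of `z` exceeds `t`. -/
def survival [DecidableEq X] (π : X → A) (z : X) : ℕ → X → ℝ
  | 0, x => if x = z then 0 else 1
  | t + 1, x => if x = z then 0 else ∑ y, M.p x (π x) y * survival π z t y

/-- Expected first hitting time of `z` from `x` under `π`, as `𝔼[H] = ∑ t, Pr(H > t)`. -/
def hittingTime [DecidableEq X] (π : X → A) (z x : X) : ENNReal :=
  ∑' t, ENNReal.ofReal (M.survival π z t x)

end MDP

/-- A periodic MDP with period `N`. The period index `1, …, N` is written as an element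
`0, …, N - 1` of `ZMod N`, so that `n + 1` is the cyclically next index. -/
structure PeriodicMDP (S A : Type*) [Fintype S] (N : ℕ) where
  p : ZMod N → S → A → S → ℝ
  p_nonneg : ∀ n s a s', 0 ≤ p n s a s'
  p_sum : ∀ n s a, ∑ s', p n s a s' = 1
  r : ZMod N → S → A → ℝ
  r_mem : ∀ n s a, r n s a ∈ Set.Icc (0 : ℝ) 1

namespace PeriodicMDP

variable {S A : Type*} [Fintype S] {N : ℕ} [NeZero N]

/-- The stationary MDP on the augmented state space. -/
def aug (M : PeriodicMDP S A N) : MDP (S × ZMod N) A where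
  p x a y := if y.2 = x.2 + 1 then M.p x.2 x.1 a y.1 else 0
  p_nonneg x a y := by
    split_ifs
    · exact M.p_nonneg _ _ _ _
    · exact le_rfl
  p_sum x a := by
    rw [Fintype.sum_prod_type]
    simp [M.p_sum]
  r x a := M.r x.2 x.1 a
  r_mem x a := M.r_mem _ _ _

/-- The diameter `D_aug`: the maximum, over starting states `(s, first period index)` and
augmented states `z` different from it, of the least expected hitting time of `z` over the
stationary policies. -/
def augDiameter [DecidableEq S] (M : PeriodicMDP S A N) : ENNReal :=
  ⨆ (s : S) (z : S × ZMod N) (_ : z ≠ (s, 0)),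
    ⨅ π : S × ZMod N → A, M.aug.hittingTime π z (s, 0)

end PeriodicMDP

namespace PUCRL2

variable {S A : Type*} [Fintype S] [Fintype A] [DecidableEq S] [DecidableEq A]
  {N : ℕ} [NeZero N]

/-! Statistics of a trajectory. Time is counted from `0`: `s t`, `a t`, `r t` are the state, the
action and the observed reward at the `(t + 1)`-st step, whose period index is `(t : ZMod N)`. -/

/-- Number of visits to the augmented state-action pair `(x, b)` at the times `k ≤ i < t`. -/
def visits (s : ℕ → S) (a : ℕ → A) (k t : ℕ) (x : S × ZMod N) (b : A) : ℕ :=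
  #{i ∈ Ico k t | (s i, (i : ZMod N)) = x ∧ a i = b}

/-- Number of visits to `(x, b)` before time `t` which were followed by the state `s'`. -/
def transitions (s : ℕ → S) (a : ℕ → A) (t : ℕ) (x : S × ZMod N) (b : A) (s' : S) : ℕ :=
  #{i ∈ range t | (s i, (i : ZMod N)) = x ∧ a i = b ∧ s (i + 1) = s'}

/-- `n_k(x, b) = max {1, number of visits before time t}`. -/
def visitCount (s : ℕ → S) (a : ℕ → A) (t : ℕ) (x : S × ZMod N) (b : A) : ℕ :=
  max 1 (visits s a 0 t x b)

/-- Empirical transition probabilities to the states of the next period index. -/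
def pHat (s : ℕ → S) (a : ℕ → A) (t : ℕ) (x : S × ZMod N) (b : A) (s' : S) : ℝ :=
  transitions s a t x b s' / visitCount s a t x b

/-- Empirical mean reward. -/
def rHat (s : ℕ → S) (a : ℕ → A) (r : ℕ → ℝ) (t : ℕ) (x : S × ZMod N) (b : A) : ℝ :=
  (∑ i ∈ range t with (s i, (i : ZMod N)) = x ∧ a i = b, r i) / visitCount s a t x b

/-- Confidence set for the transition probabilities, for a phase that starts at time `t`
(which is the `(t + 1)`-st step). -/
def confP (δ : ℝ) (s : ℕ → S) (a : ℕ → A) (t : ℕ) (x : S × ZMod N) (b : A) : Set (S → ℝ) :=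
  {q | (∀ s', 0 ≤ q s') ∧ ∑ s', q s' = 1 ∧
    ∑ s', |q s' - pHat s a t x b s'| ≤
      √(14 * Fintype.card S * N * Real.log (2 * Fintype.card A * (t + 1) / δ) /
        visitCount s a t x b)}

/-- Confidence set for the mean reward, for a phase that starts at time `t`. -/
def confR (δ : ℝ) (s : ℕ → S) (a : ℕ → A) (r : ℕ → ℝ) (t : ℕ) (x : S × ZMod N) (b : A) :
    Set ℝ :=
  {v | v ∈ Set.Icc (0 : ℝ) 1 ∧
    |v - rHat s a r t x b| ≤
      √(7 * Real.log (2 * Fintype.card S * Fintype.card A * (t + 1) / δ) /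
        (2 * visitCount s a t x b))}

/-! Modified extended value iteration, for confidence sets `R`, `P`, the coefficient `τ` of the
aperiodicity transformation, and the reference state `xstar`. -/

/-- The quantity maximized over the actions `b`; the suprema over the (compact) confidence sets
are maxima. -/
def eviQ (R : S × ZMod N → A → Set ℝ) (P : S × ZMod N → A → Set (S → ℝ)) (τ : ℝ)
    (u : S × ZMod N → ℝ) (x : S × ZMod N) (b : A) : ℝ :=
  sSup (R x b) + τ * sSup ((fun q : S → ℝ => ∑ s', u (s', x.2 + 1) * q s') '' P x b)
    + (1 - τ) * u x

/-- The iterates `u_i`. -/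
def evi (R : S × ZMod N → A → Set ℝ) (P : S × ZMod N → A → Set (S → ℝ)) (τ : ℝ)
    (xstar : S × ZMod N) : ℕ → S × ZMod N → ℝ
  | 0, _ => 0
  | i + 1, x =>
      (⨆ b, eviQ R P τ (evi R P τ xstar i) x b) -
        ⨆ b, eviQ R P τ (evi R P τ xstar i) xstar b

/-- The stopping criterion, checked in iteration `i`. -/
def EviStops (R : S × ZMod N → A → Set ℝ) (P : S × ZMod N → A → Set (S → ℝ)) (τ : ℝ)
    (xstar : S × ZMod N) (ε : ℝ) (i : ℕ) : Prop :=
  (⨆ x, (evi R P τ xstar (i + 1) x - evi R P τ xstar i x)) -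
    (⨅ x, (evi R P τ xstar (i + 1) x - evi R P τ xstar i x)) ≤ ε

/-- `π` is a policy returned by modified extended value iteration with accuracy `ε`: in the first
iteration in which the stopping criterion holds, `π` picks maximizing actions (ties are broken
arbitrarily). -/
def IsEviOutput (R : S × ZMod N → A → Set ℝ) (P : S × ZMod N → A → Set (S → ℝ)) (τ : ℝ)
    (xstar : S × ZMod N) (ε : ℝ) (π : S × ZMod N → A) : Prop :=
  ∃ i, EviStops R P τ xstar ε i ∧ (∀ j < i, ¬ EviStops R P τ xstar ε j) ∧
    ∀ x b, eviQ R P τ (evi R P τ xstar i) x b ≤ eviQ R P τ (evi R P τ xstar i) x (π x)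

/-- The action at time `t` when `π t` is the policy in force at time `t`. -/
def action (s : ℕ → S) (π : ℕ → S × ZMod N → A) (t : ℕ) : A := π t (s t, (t : ZMod N))

/-- Starting time of the phase that contains time `t`. The phase that started at `k` goes on at
time `t + 1` as long as the pair `(x, b)`, of the current augmented state and the action that the
current policy prescribes there, was visited in the phase less than `n_k(x, b)` times. -/
def phaseStart (s : ℕ → S) (π : ℕ → S × ZMod N → A) : ℕ → ℕ
  | 0 => 0
  | t + 1 =>
      let k := phaseStart s π t
      let x : S × ZMod N := (s (t + 1), ((t + 1 : ℕ) : ZMod N))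
      let b := π t x
      if visits s (action s π) k (t + 1) x b < visitCount s (action s π) k x b then k else t + 1

/-- The policies `π t` along a trajectory are those of PUCRL2: at the start of a phase a new
policy is computed from the past observations, and within a phase the policy is kept. -/
structure IsRun (δ τ : ℝ) (xstar : S × ZMod N) (s : ℕ → S) (π : ℕ → S × ZMod N → A)
    (r : ℕ → ℝ) : Prop where
  plan : ∀ t, phaseStart s π t = t →
    IsEviOutput (confR δ s (action s π) r t) (confP δ s (action s π) t) τ xstar
      (1 / √((t : ℝ) + 1)) (π t)
  keep : ∀ t, phaseStart s π (t + 1) ≠ t + 1 → π (t + 1) = π t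

/-- The random states `s t`, policies `π t` and observed rewards `r t` arise when PUCRL2 interacts
with the periodic MDP `M`, starting in the first period index; `ℱ t` is the information available
when the action at time `t` has been chosen. -/
structure IsProcess (M : PeriodicMDP S A N) (δ τ : ℝ) (xstar : S × ZMod N)
    {Ω : Type*} [mΩ : MeasurableSpace Ω] (μ : Measure Ω) (ℱ : Filtration ℕ mΩ)
    (s : ℕ → Ω → S) (π : ℕ → Ω → S × ZMod N → A) (r : ℕ → Ω → ℝ) : Prop where
  measurable_s : ∀ t y, MeasurableSet[ℱ t] {ω | s t ω = y}
  measurable_π : ∀ t f, MeasurableSet[ℱ t] {ω | π t ω = f}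
  measurable_r : ∀ t, Measurable[ℱ (t + 1)] (r t)
  /-- Observed rewards lie in `[0, 1]`. -/
  r_mem : ∀ t ω, r t ω ∈ Set.Icc (0 : ℝ) 1
  /-- The next state is drawn from `p_n(· | s, a)`. -/
  next_state : ∀ t y, μ⟦{ω | s (t + 1) ω = y} | ℱ t⟧ =ᵐ[μ] fun ω =>
    M.p (t : ZMod N) (s t ω) (action (fun i => s i ω) (fun i => π i ω) t) y
  /-- The observed reward has mean `r_n(s, a)`. -/
  mean_reward : ∀ t, μ[r t | ℱ t] =ᵐ[μ] fun ω =>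
    M.r (t : ZMod N) (s t ω) (action (fun i => s i ω) (fun i => π i ω) t)
  /-- Actions are chosen by PUCRL2. -/
  run : ∀ ω, IsRun δ τ xstar (fun t => s t ω) (fun t => π t ω) (fun t => r t ω)

end PUCRL2

/-- Regret after `T` steps, for observed rewards `r`, against the optimal average reward of the
augmented MDP. -/
def regret {S A : Type*} [Fintype S] {N : ℕ} [NeZero N] (M : PeriodicMDP S A N)
    (r : ℕ → ℝ) (T : ℕ) : ℝ :=
  ∑ t ∈ range T, (M.aug.optGain - r t)

end

/-! The proof is an optimism argument. As long as the confidence sets contain the true rewards and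
transitions, the extended Bellman operator dominates the one of the augmented MDP. For any function
`u`, the maximum of `r + τ (P u - u)` over state-action pairs bounds every gain (`MDP.optGain_le`).
At the stopping iteration the increment of `u` under the extended operator is constant up to `ε`, so
it is at least `ρ* - ε` at every state (`Plausible.optGain_sub_le`). For the greedy action this
bounds `ρ*` by an optimistic reward plus the optimistic one-step drift of `w = τ (u - min u)`.
Passing to the true parameters costs the widths of the confidence sets, the transition width being
multiplied by the span of `w` (`Plausible.optGain_sub_le_of_greedy`).

The span is controlled by hitting times. One backup raises an iterate by at most `1`, so `τ (u z - u
x)` is at most a truncated expected hitting time of `z` from `x`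
(`Plausible.evi_sub_le_sum_survival`). This gives `D_aug` when `x` has the first period index, and
at most `N - 1` more otherwise, the time until that index returns. Hence the span is at most `d =
D_aug + N - 1`. Since reaching the last index already takes `N - 1` steps, `d ≤ 2 D_aug`.

Summed over time, the widths are of order `1 / √n_k` and add up to order `√(S N A T)` by the
doubling rule for phases and Cauchy-Schwarz. The drift of `w` is a sum of martingale differences
plus a telescoping sum that is interrupted only at the `O(S N A log T)` changes of phase. A
Hoeffding supermartingale for predictably selected steps (`Selection.integral_exp_le`) handles both
this martingale and the confidence sets. The failure probabilities are at most `δ (1/t - 1/(t+1))`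
and sum to at most `δ`.

If `T < (34 D_aug S N)² A log (T/δ)`, the trivial bound `T` on the regret suffices. Otherwise all
lower-order terms fit into the constant `34`, whose main part is `2 √28 (√2 + 1) < 25.56`. -/

set_option linter.unusedSectionVars false

/-! ### Certificates for the gain, and hitting times -/

namespace MDP

variable {X A : Type*} [Fintype X] (M : MDP X A)

lemma expReward_mem (π : X → A) (t : ℕ) (x : X) : M.expReward π t x ∈ Set.Icc (0 : ℝ) 1 := by
  induction t generalizing x with
  | zero => exact M.r_mem _ _
  | succ t ih =>
    refine ⟨Finset.sum_nonneg fun y _ => mul_nonneg (M.p_nonneg _ _ _) (ih y).1, ?_⟩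
    calc ∑ y, M.p x (π x) y * M.expReward π t y
        ≤ ∑ y, M.p x (π x) y * 1 :=
          Finset.sum_le_sum fun y _ => mul_le_mul_of_nonneg_left (ih y).2 (M.p_nonneg _ _ _)
      _ = 1 := by simp [M.p_sum]

lemma optGain_le_one : M.optGain ≤ 1 := by
  refine Real.sSup_le ?_ zero_le_one
  rintro g ⟨π, x, h⟩
  refine le_of_tendsto h (Eventually.of_forall fun T => ?_)
  refine div_le_one_of_le₀ ?_ (Nat.cast_nonneg _)
  calc ∑ t ∈ range T, M.expReward π t x ≤ ∑ t ∈ range T, (1 : ℝ) :=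
        Finset.sum_le_sum fun t _ => (M.expReward_mem π t x).2
    _ = T := by simp

/-- The function `u` after `t` steps of the policy `π`, in expectation. -/
noncomputable def expValue (π : X → A) (u : X → ℝ) : ℕ → X → ℝ
  | 0, x => u x
  | t + 1, x => ∑ y, M.p x (π x) y * expValue π u t y

lemma abs_expValue_le (π : X → A) (u : X → ℝ) {C : ℝ} (hu : ∀ x, |u x| ≤ C) (t : ℕ) (x : X) :
    |M.expValue π u t x| ≤ C := by
  induction t generalizing x with
  | zero => exact hu x
  | succ t ih =>
    calc |∑ y, M.p x (π x) y * M.expValue π u t y|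
        ≤ ∑ y, |M.p x (π x) y * M.expValue π u t y| := Finset.abs_sum_le_sum_abs _ _
      _ ≤ ∑ y, M.p x (π x) y * C := by
          refine Finset.sum_le_sum fun y _ => ?_
          rw [abs_mul, abs_of_nonneg (M.p_nonneg _ _ _)]
          exact mul_le_mul_of_nonneg_left (ih y) (M.p_nonneg _ _ _)
      _ = C := by rw [← Finset.sum_mul, M.p_sum, one_mul]

/-- Apply the operator `P_π ^ t` to the inequality `r_π ≤ g + τ (u - P_π u)`. The right-hand side
becomes a difference of consecutive values, which telescopes over `t`. -/
lemma expReward_le (π : X → A) (u : X → ℝ) (g τ : ℝ)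
    (h : ∀ x b, M.r x b + τ * (∑ y, M.p x b y * u y - u x) ≤ g) (t : ℕ) (x : X) :
    M.expReward π t x ≤ g + τ * (M.expValue π u t x - M.expValue π u (t + 1) x) := by
  induction t generalizing x with
  | zero =>
    have := h x (π x)
    simp only [expReward, expValue]
    linarith
  | succ t ih =>
    calc ∑ y, M.p x (π x) y * M.expReward π t y
        ≤ ∑ y, M.p x (π x) y *
            (g + τ * (M.expValue π u t y - M.expValue π u (t + 1) y)) :=
          Finset.sum_le_sum fun y _ => mul_le_mul_of_nonneg_left (ih y) (M.p_nonneg _ _ _)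
      _ = (∑ y, M.p x (π x) y) * g + τ * (∑ y, M.p x (π x) y * M.expValue π u t y -
            ∑ y, M.p x (π x) y * M.expValue π u (t + 1) y) := by
          rw [Finset.sum_mul, ← Finset.sum_sub_distrib, Finset.mul_sum, ← Finset.sum_add_distrib]
          exact Finset.sum_congr rfl fun y _ => by ring
      _ = _ := by rw [M.p_sum, one_mul]; rfl

/-- The gain is bounded by `g` if some function `u` certifies it. -/
lemma optGain_le [Nonempty X] [Nonempty A] (u : X → ℝ) (g τ : ℝ)
    (h : ∀ x b, M.r x b + τ * (∑ y, M.p x b y * u y - u x) ≤ g) : M.optGain ≤ g := by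
  obtain ⟨C, hC⟩ : ∃ C, ∀ x, |u x| ≤ C :=
    ⟨∑ x, |u x|, fun x => Finset.single_le_sum (f := fun x => |u x|)
      (fun _ _ => abs_nonneg _) (Finset.mem_univ x)⟩
  -- The factor `T / T` keeps the bound valid at `T = 0`, where all the quotients are `0`.
  have key (π : X → A) (x : X) (T : ℕ) :
      (∑ t ∈ range T, M.expReward π t x) / T ≤ g * (T / T) + |τ| * (2 * C) / T := by
    rw [mul_div_assoc', ← add_div]
    refine div_le_div_of_nonneg_right ?_ (Nat.cast_nonneg _)
    calc ∑ t ∈ range T, M.expReward π t x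
        ≤ ∑ t ∈ range T, (g + τ * (M.expValue π u t x - M.expValue π u (t + 1) x)) :=
          Finset.sum_le_sum fun t _ => M.expReward_le π u g τ h t x
      _ = g * T + τ * (M.expValue π u 0 x - M.expValue π u T x) := by
          rw [Finset.sum_add_distrib, ← Finset.mul_sum, Finset.sum_range_sub']
          simp [mul_comm]
      _ ≤ g * T + |τ| * (2 * C) := by
          have h1 : τ * (M.expValue π u 0 x - M.expValue π u T x) ≤
              |τ| * |M.expValue π u 0 x - M.expValue π u T x| := by
            rw [← abs_mul]; exact le_abs_self _
          have h2 : |M.expValue π u 0 x - M.expValue π u T x| ≤ 2 * C := by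
            have := M.abs_expValue_le π u hC 0 x
            have := M.abs_expValue_le π u hC T x
            linarith [abs_sub (M.expValue π u 0 x) (M.expValue π u T x)]
          have := mul_le_mul_of_nonneg_left h2 (abs_nonneg τ)
          linarith
  have lim : Tendsto (fun T : ℕ => g * ((T : ℝ) / T) + |τ| * (2 * C) / T) atTop (𝓝 g) := by
    have h1 : Tendsto (fun T : ℕ => (T : ℝ) / T) atTop (𝓝 1) :=
      tendsto_const_nhds.congr' (by
        filter_upwards [eventually_gt_atTop 0] with T hT
        rw [div_self]; positivity)
    simpa using (h1.const_mul g).add (tendsto_const_div_atTop_nhds_zero_nat (|τ| * (2 * C)))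
  refine Real.sSup_le ?_ ?_
  · rintro g' ⟨π, x, hg⟩
    exact le_of_tendsto_of_tendsto' hg lim (key π x)
  -- `Real.sSup_le` also asks for `0 ≤ g`, because the supremum of the empty set is `0`. The average
  -- rewards are nonnegative and are bounded by a sequence tending to `g`.
  · obtain ⟨x⟩ := ‹Nonempty X›
    obtain ⟨b⟩ := ‹Nonempty A›
    refine le_of_tendsto_of_tendsto' tendsto_const_nhds lim fun T => le_trans ?_ (key (fun _ => b) x T)
    exact div_nonneg (Finset.sum_nonneg fun t _ => (M.expReward_mem _ t x).1) (Nat.cast_nonneg _)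

section Hitting

variable [DecidableEq X]

lemma survival_nonneg (π : X → A) (z : X) (t : ℕ) (x : X) : 0 ≤ M.survival π z t x := by
  induction t generalizing x with
  | zero => simp only [survival]; split_ifs <;> norm_num
  | succ t ih =>
    simp only [survival]
    split_ifs
    · exact le_rfl
    · exact Finset.sum_nonneg fun y _ => mul_nonneg (M.p_nonneg _ _ _) (ih y)

lemma sum_survival_le (π : X → A) (z x : X) (h : M.hittingTime π z x ≠ ⊤) (n : ℕ) :
    ∑ t ∈ range n, M.survival π z t x ≤ (M.hittingTime π z x).toReal := by
  rw [← ENNReal.ofReal_le_iff_le_toReal h,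
    ENNReal.ofReal_sum_of_nonneg fun t _ => M.survival_nonneg π z t x]
  exact ENNReal.sum_le_tsum _

end Hitting

end MDP

/-! ### Optimism of extended value iteration, and its differences bounded by survival probabilities
-/

namespace PUCRL2

variable {S A : Type*} [Fintype S] [Fintype A] [DecidableEq S] [DecidableEq A]
  {N : ℕ} [NeZero N]

/-- The confidence sets contain the MDP `M`, and consist of rewards in `[0, 1]` and of
probability vectors. -/
structure Plausible (M : PeriodicMDP S A N) (R : S × ZMod N → A → Set ℝ)
    (P : S × ZMod N → A → Set (S → ℝ)) : Prop where
  r_subset : ∀ x b, R x b ⊆ Set.Icc 0 1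
  p_nonneg : ∀ x b, ∀ q ∈ P x b, ∀ s', 0 ≤ q s'
  p_sum : ∀ x b, ∀ q ∈ P x b, ∑ s', q s' = 1
  r_mem : ∀ x b, M.r x.2 x.1 b ∈ R x b
  p_mem : ∀ x b, M.p x.2 x.1 b ∈ P x b

lemma bddAbove_image_sum {P : Set (S → ℝ)} (h0 : ∀ q ∈ P, ∀ s', 0 ≤ q s')
    (h1 : ∀ q ∈ P, ∑ s', q s' = 1) (u : S → ℝ) :
    BddAbove ((fun q : S → ℝ => ∑ s', u s' * q s') '' P) := by
  refine ⟨∑ s', |u s'|, ?_⟩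
  rintro _ ⟨q, hq, rfl⟩
  refine Finset.sum_le_sum fun s' _ => ?_
  have hle : q s' ≤ 1 := by
    rw [← h1 q hq]
    exact Finset.single_le_sum (fun i _ => h0 q hq i) (Finset.mem_univ s')
  calc u s' * q s' ≤ |u s'| * q s' := mul_le_mul_of_nonneg_right (le_abs_self _) (h0 q hq s')
    _ ≤ |u s'| * 1 := mul_le_mul_of_nonneg_left hle (abs_nonneg _)
    _ = |u s'| := mul_one _

/-- Averaging against a probability vector is monotone and commutes with adding constants, and both
properties survive the supremum. This is the source of the nonexpansiveness of the extended
operator. -/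
lemma sSup_image_sum_le_add {P : Set (S → ℝ)} (h0 : ∀ q ∈ P, ∀ s', 0 ≤ q s')
    (h1 : ∀ q ∈ P, ∑ s', q s' = 1) (hP : P.Nonempty) {u u' : S → ℝ} {c : ℝ}
    (h : ∀ x, u x ≤ u' x + c) :
    sSup ((fun q : S → ℝ => ∑ s', u s' * q s') '' P) ≤
      sSup ((fun q : S → ℝ => ∑ s', u' s' * q s') '' P) + c := by
  refine csSup_le (hP.image _) ?_
  rintro _ ⟨q, hq, rfl⟩
  have h2 : ∑ s', u' s' * q s' ≤ sSup ((fun q : S → ℝ => ∑ s', u' s' * q s') '' P) :=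
    le_csSup (bddAbove_image_sum h0 h1 u') ⟨q, hq, rfl⟩
  calc ∑ s', u s' * q s' ≤ ∑ s', (u' s' + c) * q s' :=
        Finset.sum_le_sum fun s' _ => mul_le_mul_of_nonneg_right (h s') (h0 q hq s')
    _ = ∑ s', u' s' * q s' + c := by
        simp only [add_mul, Finset.sum_add_distrib]
        rw [← Finset.mul_sum, h1 q hq, mul_one]
    _ ≤ _ := by linarith

namespace Plausible

variable {M : PeriodicMDP S A N} {R : S × ZMod N → A → Set ℝ}
  {P : S × ZMod N → A → Set (S → ℝ)} (h : Plausible M R P)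

include h

lemma r_le_sSup (x : S × ZMod N) (b : A) : M.r x.2 x.1 b ≤ sSup (R x b) :=
  le_csSup ⟨1, fun _ hv => (h.r_subset x b hv).2⟩ (h.r_mem x b)

lemma sSup_le_one (x : S × ZMod N) (b : A) : sSup (R x b) ≤ 1 :=
  csSup_le ⟨_, h.r_mem x b⟩ fun _ hv => (h.r_subset x b hv).2

lemma sum_le_sSup (x : S × ZMod N) (b : A) (u : S → ℝ) :
    ∑ s', u s' * M.p x.2 x.1 b s' ≤
      sSup ((fun q : S → ℝ => ∑ s', u s' * q s') '' P x b) :=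
  le_csSup (bddAbove_image_sum (h.p_nonneg x b) (h.p_sum x b) u) ⟨_, h.p_mem x b, rfl⟩

lemma eviQ_le_add {τ : ℝ} (hτ : τ ∈ Set.Ioo (0 : ℝ) 1) {u u' : S × ZMod N → ℝ} {c : ℝ}
    (hu : ∀ x, u x ≤ u' x + c) (x : S × ZMod N) (b : A) :
    eviQ R P τ u x b ≤ eviQ R P τ u' x b + c := by
  have h1 := sSup_image_sum_le_add (h.p_nonneg x b) (h.p_sum x b) ⟨_, h.p_mem x b⟩
    (u := fun s' => u (s', x.2 + 1)) (u' := fun s' => u' (s', x.2 + 1)) (c := c)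
    (fun s' => hu _)
  have h2 := mul_le_mul_of_nonneg_left h1 hτ.1.le
  have h3 := mul_le_mul_of_nonneg_left (hu x) (sub_nonneg.2 hτ.2.le)
  simp only [eviQ]
  linarith

/-- Optimism: the true reward and transition vector compete in the two suprema. -/
lemma le_eviQ {τ : ℝ} (hτ : τ ∈ Set.Ioo (0 : ℝ) 1) (u : S × ZMod N → ℝ) (x : S × ZMod N)
    (b : A) :
    M.r x.2 x.1 b + τ * ∑ s', M.p x.2 x.1 b s' * u (s', x.2 + 1) + (1 - τ) * u x ≤
      eviQ R P τ u x b := by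
  have h1 := h.r_le_sSup x b
  have h2 := mul_le_mul_of_nonneg_left (h.sum_le_sSup x b fun s' => u (s', x.2 + 1)) hτ.1.le
  simp only [eviQ, mul_comm (M.p _ _ _ _)]
  linarith

end Plausible

lemma eviQ_le_iSup (R : S × ZMod N → A → Set ℝ) (P : S × ZMod N → A → Set (S → ℝ)) (τ : ℝ)
    (u : S × ZMod N → ℝ) (x : S × ZMod N) (b : A) :
    eviQ R P τ u x b ≤ ⨆ b, eviQ R P τ u x b :=
  le_ciSup (Set.finite_range _).bddAbove b

namespace Plausible

variable {M : PeriodicMDP S A N} {R : S × ZMod N → A → Set ℝ}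
  {P : S × ZMod N → A → Set (S → ℝ)} (h : Plausible M R P)

include h

lemma iSup_eviQ_le_add [Nonempty A] {τ : ℝ} (hτ : τ ∈ Set.Ioo (0 : ℝ) 1) {u u' : S × ZMod N → ℝ}
    {c : ℝ} (hu : ∀ x, u x ≤ u' x + c) (x : S × ZMod N) :
    ⨆ b, eviQ R P τ u x b ≤ (⨆ b, eviQ R P τ u' x b) + c :=
  ciSup_le fun b => (h.eviQ_le_add hτ hu x b).trans
    (by have := eviQ_le_iSup R P τ u' x b; linarith)

/-- The increment of value iteration does not exceed its first value, which is at most `1` because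
rewards are. The normalization at `xstar` subtracts a constant, which the operator passes through
unchanged. -/
lemma iSup_eviQ_evi_le [Nonempty A] {τ : ℝ} (hτ : τ ∈ Set.Ioo (0 : ℝ) 1) (xstar : S × ZMod N)
    (i : ℕ) (x : S × ZMod N) :
    ⨆ b, eviQ R P τ (evi R P τ xstar i) x b ≤ evi R P τ xstar i x + 1 := by
  induction i generalizing x with
  | zero =>
    refine ciSup_le fun b => ?_
    have h1 := h.sSup_le_one x b
    have h2 : sSup ((fun q : S → ℝ => ∑ s', (0 : ℝ) * q s') '' P x b) = 0 := by
      have : (fun q : S → ℝ => ∑ s', (0 : ℝ) * q s') = fun _ => 0 := by simp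
      rw [this, Set.Nonempty.image_const ⟨_, h.p_mem x b⟩, csSup_singleton]
    simp only [eviQ, evi, h2]
    linarith
  | succ i ih =>
    set c := ⨆ b, eviQ R P τ (evi R P τ xstar i) xstar b with hc
    have h1 : ∀ y, evi R P τ xstar (i + 1) y ≤ evi R P τ xstar i y + (1 - c) := fun y => by
      have := ih y
      simp only [evi, ← hc]
      linarith
    have h2 := h.iSup_eviQ_le_add hτ h1 x
    have h3 : evi R P τ xstar (i + 1) x = (⨆ b, eviQ R P τ (evi R P τ xstar i) x b) - c := by
      simp only [evi, ← hc]
    linarith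

/-- The difference of two values is controlled by the time it takes to get from one state to the
other one. -/
lemma evi_sub_le_sum_survival [Nonempty A] {τ : ℝ} (hτ : τ ∈ Set.Ioo (0 : ℝ) 1)
    (xstar : S × ZMod N) (π : S × ZMod N → A) (z : S × ZMod N) (i : ℕ) (x : S × ZMod N) :
    τ * (evi R P τ xstar i z - evi R P τ xstar i x) ≤
      ∑ t ∈ range i, M.aug.survival π z t x := by
  induction i generalizing x with
  | zero => simp [evi]
  | succ i ih =>
    have hτ0 := hτ.1
    by_cases hxz : x = z
    · subst hxz
      simp only [sub_self, mul_zero]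
      exact Finset.sum_nonneg fun t _ => M.aug.survival_nonneg π _ t _
    set u := evi R P τ xstar i with hu
    have e1 : evi R P τ xstar (i + 1) z - evi R P τ xstar (i + 1) x =
        (⨆ b, eviQ R P τ u z b) - ⨆ b, eviQ R P τ u x b := by
      simp only [evi]; ring
    have e2 : (⨆ b, eviQ R P τ u z b) ≤ u z + 1 := h.iSup_eviQ_evi_le hτ xstar i z
    have e3 := (h.le_eviQ hτ u x (π x)).trans (eviQ_le_iSup R P τ u x (π x))
    have hr := (M.r_mem x.2 x.1 (π x)).1
    have e4 : ∑ t ∈ range i, M.aug.survival π z (t + 1) x =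
        ∑ s', M.p x.2 x.1 (π x) s' * ∑ t ∈ range i, M.aug.survival π z t (s', x.2 + 1) := by
      simp only [MDP.survival, if_neg hxz, Finset.mul_sum]
      rw [Finset.sum_comm]
      rw [Fintype.sum_prod_type]
      refine Finset.sum_congr rfl fun s' _ => ?_
      rw [Finset.sum_eq_single (x.2 + 1)]
      · simp [PeriodicMDP.aug]
      · intro n _ hn
        refine Finset.sum_eq_zero fun t _ => ?_
        simp [PeriodicMDP.aug, hn]
      · simp
    have e5 : τ * u z - τ * ∑ s', M.p x.2 x.1 (π x) s' * u (s', x.2 + 1) ≤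
        ∑ t ∈ range i, M.aug.survival π z (t + 1) x := by
      rw [e4]
      calc τ * u z - τ * ∑ s', M.p x.2 x.1 (π x) s' * u (s', x.2 + 1)
          = ∑ s', M.p x.2 x.1 (π x) s' * (τ * (u z - u (s', x.2 + 1))) := by
            have : u z = ∑ s', M.p x.2 x.1 (π x) s' * u z := by
              rw [← Finset.sum_mul, M.p_sum, one_mul]
            rw [this, ← mul_sub, ← Finset.sum_sub_distrib, Finset.mul_sum, ← this]
            exact Finset.sum_congr rfl fun _ _ => by ring
        _ ≤ _ := Finset.sum_le_sum fun s' _ =>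
            mul_le_mul_of_nonneg_left (ih _) (M.p_nonneg _ _ _ _)
    have e6 : ∑ t ∈ range (i + 1), M.aug.survival π z t x =
        ∑ t ∈ range i, M.aug.survival π z (t + 1) x + 1 := by
      rw [Finset.sum_range_succ']
      simp [MDP.survival, hxz]
    have e7 : ∑ t ∈ range i, M.aug.survival π z t x ≤
        ∑ t ∈ range (i + 1), M.aug.survival π z t x := by
      rw [Finset.sum_range_succ]
      linarith [M.aug.survival_nonneg π z i x]
    -- The backup is a mixture. With weight `τ` the chain moves, which is `e5`, the extra `1` from
    -- `e2` being the survival at time `0` in `e6`. With weight `1 - τ` it stays at `x`, where the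
    -- induction hypothesis is used with one more summand.
    have e8 := mul_le_mul_of_nonneg_left ((ih x).trans e7) (sub_nonneg.2 hτ.2.le)
    rw [e1]
    nlinarith [mul_le_mul_of_nonneg_left e2 hτ0.le, mul_le_mul_of_nonneg_left e3 hτ0.le,
      mul_le_mul_of_nonneg_left e5 hτ0.le, mul_nonneg hτ0.le hr]

end Plausible

end PUCRL2

/-! ### Lower bounds on the diameter in terms of the period -/

namespace PeriodicMDP

variable {S A : Type*} [Fintype S] [DecidableEq S] {N : ℕ} [NeZero N] (M : PeriodicMDP S A N)

lemma exists_hittingTime_le [Finite A] [Nonempty A] (hD : M.augDiameter ≠ ⊤) (s : S) (z : S × ZMod N)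
    (hz : z ≠ (s, 0)) : ∃ π : S × ZMod N → A, M.aug.hittingTime π z (s, 0) ≠ ⊤ ∧
      (M.aug.hittingTime π z (s, 0)).toReal ≤ M.augDiameter.toReal := by
  obtain ⟨π, hπ⟩ := exists_eq_ciInf_of_finite
    (f := fun π : S × ZMod N → A => M.aug.hittingTime π z (s, 0))
  have hle : M.aug.hittingTime π z (s, 0) ≤ M.augDiameter := by
    rw [hπ]
    exact le_iSup_of_le s (le_iSup_of_le z (le_iSup_of_le hz le_rfl))
  exact ⟨π, ne_top_of_le_ne_top hD hle, ENNReal.toReal_mono hD hle⟩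

/-- The period index advances deterministically, so `z` cannot be hit before its index comes up. -/
lemma survival_eq_one (π : S × ZMod N → A) (z : S × ZMod N) (t : ℕ) (x : S × ZMod N)
    (hxz : x ≠ z) (h : ∀ j ∈ Finset.Icc 1 t, x.2 + (j : ZMod N) ≠ z.2) :
    M.aug.survival π z t x = 1 := by
  induction t generalizing x with
  | zero => simp [MDP.survival, hxz]
  | succ t ih =>
    simp only [MDP.survival, if_neg hxz]
    rw [← M.aug.p_sum x (π x)]
    refine Finset.sum_congr rfl fun y _ => ?_
    by_cases hy : y.2 = x.2 + 1
    · rw [ih y, mul_one]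
      · rintro rfl
        exact h 1 (by simp) (by simpa using hy.symm)
      · intro j hj hj'
        rw [Finset.mem_Icc] at hj
        refine h (j + 1) (by simp; omega) ?_
        rw [← hj', hy]
        push_cast
        ring
    · simp [aug, hy]

lemma le_augDiameter [Finite A] [Nonempty A] (hD : M.augDiameter ≠ ⊤) (s : S) (z : S × ZMod N)
    (hz : z ≠ (s, 0)) (n : ℕ) (h : ∀ j : ℕ, 1 ≤ j → j < n → (j : ZMod N) ≠ z.2) :
    (n : ℝ) ≤ M.augDiameter.toReal := by
  obtain ⟨π, h1, h2⟩ := M.exists_hittingTime_le hD s z hz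
  refine le_trans ?_ ((M.aug.sum_survival_le π z (s, 0) h1 n).trans h2)
  rw [Finset.sum_congr rfl fun t ht => M.survival_eq_one π z t (s, 0) hz.symm ?_]
  · simp
  · intro j hj
    rw [Finset.mem_Icc] at hj
    rw [Finset.mem_range] at ht
    simpa using h j hj.1 (by omega)

lemma natCast_ne_zero_of_lt {j : ℕ} (h1 : 1 ≤ j) (h2 : j < N) : (j : ZMod N) ≠ 0 := by
  rw [Ne, ZMod.natCast_eq_zero_iff]
  exact fun h => absurd (Nat.le_of_dvd h1 h) (by omega)

/-- The target is a state with the last period index, which comes up only after `N - 1` steps. This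
is what turns `d = D_aug + N - 1` into `d ≤ 2 D_aug`. -/
lemma sub_one_le_augDiameter [Finite A] [Nonempty A] [Nonempty S] (hN : 2 ≤ N)
    (hD : M.augDiameter ≠ ⊤) : (N : ℝ) - 1 ≤ M.augDiameter.toReal := by
  obtain ⟨s⟩ := ‹Nonempty S›
  have h1 : ((N - 1 : ℕ) : ZMod N) ≠ 0 := natCast_ne_zero_of_lt (by omega) (by omega)
  have := M.le_augDiameter hD s (s, ((N - 1 : ℕ) : ZMod N)) (by simpa using h1) (N - 1) ?_
  · rwa [Nat.cast_sub (by omega), Nat.cast_one] at this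
  · intro j _ h2 h3
    have := (ZMod.natCast_eq_natCast_iff' _ _ _).1 h3
    rw [Nat.mod_eq_of_lt (by omega), Nat.mod_eq_of_lt (by omega)] at this
    omega

/-- With a second state available, the target may carry the starting index again, and a full period
must elapse. The extra unit gives `D_aug ≥ 2`, which the final numerical estimate needs. -/
lemma period_le_augDiameter [Finite A] [Nonempty A] [Nontrivial S]
    (hD : M.augDiameter ≠ ⊤) : (N : ℝ) ≤ M.augDiameter.toReal := by
  obtain ⟨s, s', hs⟩ := exists_pair_ne S
  exact M.le_augDiameter hD s (s', 0) (by simp [hs.symm]) N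
    fun j h1 h2 => natCast_ne_zero_of_lt h1 h2

end PeriodicMDP

/-! ### The span of the iterates and the one-step optimism inequality -/

namespace PUCRL2

variable {S A : Type*} [Fintype S] [Fintype A] [DecidableEq S] [DecidableEq A]
  {N : ℕ} [NeZero N]

/-- Both vectors have total mass `1`, so `w` may be centred at `d / 2`. This halves the constant of
the plain Hölder bound. -/
lemma sum_mul_le_add_abs_sub {w q p : S → ℝ} {d : ℝ} (hw : ∀ y, w y ∈ Set.Icc 0 d)
    (hq : ∑ y, q y = 1) (hp : ∑ y, p y = 1) :
    ∑ y, w y * q y ≤ ∑ y, w y * p y + d / 2 * ∑ y, |q y - p y| := by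
  have h1 : ∑ y, w y * q y - ∑ y, w y * p y = ∑ y, (w y - d / 2) * (q y - p y) := by
    have : ∑ y, d / 2 * (q y - p y) = 0 := by
      rw [← Finset.mul_sum, Finset.sum_sub_distrib, hq, hp, sub_self, mul_zero]
    simp only [sub_mul, Finset.sum_sub_distrib, this, sub_zero]
    simp only [mul_sub, Finset.sum_sub_distrib]
  have h2 : ∑ y, (w y - d / 2) * (q y - p y) ≤ d / 2 * ∑ y, |q y - p y| := by
    rw [Finset.mul_sum]
    refine Finset.sum_le_sum fun y _ => ?_
    calc (w y - d / 2) * (q y - p y) ≤ |w y - d / 2| * |q y - p y| := by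
          rw [← abs_mul]; exact le_abs_self _
      _ ≤ d / 2 * |q y - p y| := by
          refine mul_le_mul_of_nonneg_right ?_ (abs_nonneg _)
          have := hw y
          rw [abs_le]
          constructor <;> linarith [this.1, this.2]
  linarith

namespace Plausible

variable {M : PeriodicMDP S A N} {R : S × ZMod N → A → Set ℝ}
  {P : S × ZMod N → A → Set (S → ℝ)} (h : Plausible M R P)

include h

/-- `D_aug` only controls starts with the first period index. From any other `x` an arbitrary action
is taken for the `j` steps until that index returns, each step costing at most `1`. The inner
induction on `i` is there for the lazy part of the backup, which stays at `x`. -/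
lemma evi_sub_le_augDiameter [Nonempty A] {τ : ℝ} (hτ : τ ∈ Set.Ioo (0 : ℝ) 1)
    (hD : M.augDiameter ≠ ⊤) (xstar z : S × ZMod N) (j i : ℕ) (x : S × ZMod N)
    (hx : x.2 + (j : ZMod N) = 0) :
    τ * (evi R P τ xstar i z - evi R P τ xstar i x) ≤ M.augDiameter.toReal + j := by
  induction j generalizing i x with
  | zero =>
    obtain ⟨s, n⟩ := x
    obtain rfl : n = 0 := by simpa using hx
    by_cases hz : z = (s, 0)
    · rw [hz]; simp
    obtain ⟨π, h1, h2⟩ := M.exists_hittingTime_le hD s z hz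
    have h3 := h.evi_sub_le_sum_survival hτ xstar π z i (s, 0)
    have h4 := M.aug.sum_survival_le π z (s, 0) h1 i
    simp only [Nat.cast_zero, add_zero]
    linarith
  | succ j ih =>
    have hτ0 := hτ.1
    induction i with
    | zero =>
      simp only [evi, sub_self, mul_zero]
      positivity
    | succ i ihi =>
      set u := evi R P τ xstar i with hu
      have e1 : evi R P τ xstar (i + 1) z - evi R P τ xstar (i + 1) x =
          (⨆ b, eviQ R P τ u z b) - ⨆ b, eviQ R P τ u x b := by
        simp only [evi]; ring
      have e2 : (⨆ b, eviQ R P τ u z b) ≤ u z + 1 := h.iSup_eviQ_evi_le hτ xstar i z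
      obtain ⟨b⟩ := ‹Nonempty A›
      have e3 := (h.le_eviQ hτ u x b).trans (eviQ_le_iSup R P τ u x b)
      have hr := (M.r_mem x.2 x.1 b).1
      have e5 : τ * u z - τ * ∑ s', M.p x.2 x.1 b s' * u (s', x.2 + 1) ≤
          M.augDiameter.toReal + j := by
        calc τ * u z - τ * ∑ s', M.p x.2 x.1 b s' * u (s', x.2 + 1)
            = ∑ s', M.p x.2 x.1 b s' * (τ * (u z - u (s', x.2 + 1))) := by
              have : u z = ∑ s', M.p x.2 x.1 b s' * u z := by
                rw [← Finset.sum_mul, M.p_sum, one_mul]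
              rw [this, ← mul_sub, ← Finset.sum_sub_distrib, Finset.mul_sum, ← this]
              exact Finset.sum_congr rfl fun _ _ => by ring
          _ ≤ ∑ s', M.p x.2 x.1 b s' * (M.augDiameter.toReal + j) :=
              Finset.sum_le_sum fun s' _ => mul_le_mul_of_nonneg_left
                (ih i (s', x.2 + 1) (by rw [← hx]; push_cast; ring)) (M.p_nonneg _ _ _ _)
          _ = _ := by rw [← Finset.sum_mul, M.p_sum, one_mul]
      have e8 := mul_le_mul_of_nonneg_left ihi (sub_nonneg.2 hτ.2.le)
      rw [e1]
      push_cast at e8 ⊢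
      nlinarith [mul_le_mul_of_nonneg_left e2 hτ0.le, mul_le_mul_of_nonneg_left e3 hτ0.le,
        mul_le_mul_of_nonneg_left e5 hτ0.le, mul_nonneg hτ0.le hr]

lemma evi_sub_le [Nonempty A] {τ : ℝ} (hτ : τ ∈ Set.Ioo (0 : ℝ) 1)
    (hD : M.augDiameter ≠ ⊤) (xstar z : S × ZMod N) (i : ℕ) (x : S × ZMod N) :
    τ * (evi R P τ xstar i z - evi R P τ xstar i x) ≤ M.augDiameter.toReal + (N - 1) := by
  have h1 := h.evi_sub_le_augDiameter hτ hD xstar z (-x.2).val i x (by simp)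
  have h2 : (-x.2).val + 1 ≤ N := ZMod.val_lt _
  have h3 : ((-x.2).val : ℝ) + 1 ≤ N := by exact_mod_cast h2
  linarith

lemma mul_evi_sub_iInf_mem [Nonempty S] [Nonempty A] {τ : ℝ} (hτ : τ ∈ Set.Ioo (0 : ℝ) 1)
    (hD : M.augDiameter ≠ ⊤) (xstar : S × ZMod N) (i : ℕ) (x : S × ZMod N) :
    τ * (evi R P τ xstar i x - ⨅ y, evi R P τ xstar i y) ∈
      Set.Icc 0 (M.augDiameter.toReal + (N - 1)) := by
  constructor
  · exact mul_nonneg hτ.1.le (sub_nonneg.2 (ciInf_le (Set.finite_range _).bddBelow x))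
  · obtain ⟨y, hy⟩ := exists_eq_ciInf_of_finite (f := fun y => evi R P τ xstar i y)
    rw [← hy]
    exact h.evi_sub_le hτ hD xstar x i y

/-- The maximal increment of `u` certifies an upper bound on the gain, and the stopping rule says
that the minimal increment is within `ε` of it. The normalizing constant `c` cancels. -/
lemma optGain_sub_le [Nonempty S] [Nonempty A] {τ : ℝ} (hτ : τ ∈ Set.Ioo (0 : ℝ) 1)
    {xstar : S × ZMod N} {ε : ℝ} {i : ℕ} (hi : EviStops R P τ xstar ε i) (x : S × ZMod N) :
    M.aug.optGain - ε ≤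
      (⨆ b, eviQ R P τ (evi R P τ xstar i) x b) - evi R P τ xstar i x := by
  set u := evi R P τ xstar i with hu
  set c := ⨆ b, eviQ R P τ u xstar b with hc
  have e (y) : evi R P τ xstar (i + 1) y - u y = (⨆ b, eviQ R P τ u y b) - u y - c := by
    simp only [evi, ← hu, ← hc]; ring
  simp only [EviStops, ← hu, e] at hi
  set d := fun y => (⨆ b, eviQ R P τ u y b) - u y - c with hd
  have h1 : M.aug.optGain ≤ (⨆ y, d y) + c := by
    refine M.aug.optGain_le u _ τ fun y b => ?_
    have h2 : d y ≤ ⨆ y, d y := le_ciSup (Set.finite_range d).bddAbove y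
    have h3 := (h.le_eviQ hτ u y b).trans (eviQ_le_iSup R P τ u y b)
    have h4 : ∑ z, M.aug.p y b z * u z = ∑ s', M.p y.2 y.1 b s' * u (s', y.2 + 1) := by
      rw [Fintype.sum_prod_type]
      refine Finset.sum_congr rfl fun s' _ => ?_
      rw [Finset.sum_eq_single (y.2 + 1)]
      · simp [PeriodicMDP.aug]
      · intro n _ hn
        simp [PeriodicMDP.aug, hn]
      · simp
    rw [h4]
    simp only [PeriodicMDP.aug]
    simp only [hd] at h2
    linarith
  have h5 : ⨅ y, d y ≤ d x := ciInf_le (Set.finite_range d).bddBelow x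
  simp only [hd] at h1 h5 hi
  linarith

/-- The form of optimism that is summed along the trajectory: the optimistic transition vector has
been exchanged for the true one, at the price of half the span times the `ℓ¹` error `B`. -/
lemma optGain_sub_le_of_greedy [Nonempty S] [Nonempty A] {τ : ℝ} (hτ : τ ∈ Set.Ioo (0 : ℝ) 1)
    (hD : M.augDiameter ≠ ⊤) {xstar : S × ZMod N} {ε : ℝ} {i : ℕ}
    (hi : EviStops R P τ xstar ε i) {π : S × ZMod N → A}
    (hπ : ∀ x b, eviQ R P τ (evi R P τ xstar i) x b ≤ eviQ R P τ (evi R P τ xstar i) x (π x))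
    {w : S × ZMod N → ℝ}
    (hw : ∀ x, w x = τ * (evi R P τ xstar i x - ⨅ y, evi R P τ xstar i y))
    (x : S × ZMod N) {B : ℝ}
    (hB : ∀ q ∈ P x (π x), ∑ y, |q y - M.p x.2 x.1 (π x) y| ≤ B) :
    M.aug.optGain - ε ≤ sSup (R x (π x)) + ∑ y, w (y, x.2 + 1) * M.p x.2 x.1 (π x) y +
      (M.augDiameter.toReal + (N - 1)) / 2 * B - w x := by
  have hwmem : ∀ x, w x ∈ Set.Icc 0 (M.augDiameter.toReal + (N - 1)) := fun x => by
    rw [hw]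
    exact h.mul_evi_sub_iInf_mem hτ hD xstar i x
  have h1 := h.optGain_sub_le hτ hi x
  set u := evi R P τ xstar i with hu
  have h2 : ⨆ b, eviQ R P τ u x b ≤ eviQ R P τ u x (π x) := ciSup_le (hπ x)
  have h3 : τ * sSup ((fun q : S → ℝ => ∑ s', u (s', x.2 + 1) * q s') '' P x (π x)) ≤
      ∑ y, w (y, x.2 + 1) * M.p x.2 x.1 (π x) y +
      (M.augDiameter.toReal + (N - 1)) / 2 * B + τ * ⨅ y, u y := by
    rw [← le_div_iff₀' hτ.1]
    refine csSup_le (Set.Nonempty.image _ ⟨_, h.p_mem x (π x)⟩) ?_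
    rintro _ ⟨q, hq, rfl⟩
    rw [le_div_iff₀' hτ.1]
    have h4 := sum_mul_le_add_abs_sub (fun y => hwmem (y, x.2 + 1)) (h.p_sum _ _ q hq)
      (M.p_sum x.2 x.1 (π x))
    have h5 := mul_le_mul_of_nonneg_left (hB q hq)
      (div_nonneg ((hwmem x).1.trans (hwmem x).2) zero_le_two)
    have h6 : ∑ y, w (y, x.2 + 1) * q y =
        τ * ∑ y, u (y, x.2 + 1) * q y - τ * ⨅ y, u y := by
      simp only [hw, mul_sub, sub_mul, Finset.sum_sub_distrib, Finset.mul_sum, mul_assoc]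
      rw [← Finset.mul_sum, ← Finset.mul_sum, ← Finset.mul_sum, h.p_sum _ _ q hq, mul_one]
    linarith
  have h7 := h1.trans (sub_le_sub_right h2 _)
  simp only [eviQ] at h7
  rw [hw x]
  linarith

end Plausible

end PUCRL2

/-! ### Counting visits and phases -/

namespace PUCRL2

variable {S A : Type*} [Fintype S] [Fintype A] [DecidableEq S] [DecidableEq A]
  {N : ℕ} [NeZero N]

lemma visits_succ (s : ℕ → S) (a : ℕ → A) {k t : ℕ} (hkt : k ≤ t) (x : S × ZMod N) (b : A) :
    visits s a k (t + 1) x b =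
      visits s a k t x b + if (s t, (t : ZMod N)) = x ∧ a t = b then 1 else 0 := by
  simp only [visits, Finset.card_filter]
  rw [Finset.sum_Ico_succ_top hkt]

lemma visits_self (s : ℕ → S) (a : ℕ → A) (k : ℕ) (x : S × ZMod N) (b : A) :
    visits s a k k x b = 0 := by simp [visits]

lemma visits_add_visits (s : ℕ → S) (a : ℕ → A) {k t : ℕ} (hkt : k ≤ t) (x : S × ZMod N)
    (b : A) : visits s a 0 k x b + visits s a k t x b = visits s a 0 t x b := by
  simp only [visits, Finset.card_filter]
  exact Finset.sum_Ico_consecutive _ (Nat.zero_le _) hkt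

lemma sum_visits (s : ℕ → S) (a : ℕ → A) (t : ℕ) :
    ∑ x : S × ZMod N, ∑ b, visits s a 0 t x b = t := by
  induction t with
  | zero => simp [visits]
  | succ t ih =>
    simp only [visits_succ s a (Nat.zero_le t), Finset.sum_add_distrib, ih]
    congr 1
    rw [Finset.sum_eq_single (s t, (t : ZMod N))]
    · simp
    · intro x _ hx
      simp [hx.symm]
    · simp

lemma visits_le (s : ℕ → S) (a : ℕ → A) (t : ℕ) (x : S × ZMod N) (b : A) :
    visits s a 0 t x b ≤ t := by
  refine (Finset.card_filter_le _ _).trans ?_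
  simp

lemma phaseStart_le (s : ℕ → S) (π : ℕ → S × ZMod N → A) (t : ℕ) : phaseStart s π t ≤ t := by
  induction t with
  | zero => exact le_rfl
  | succ t ih =>
    simp only [phaseStart]
    split_ifs
    · omega
    · exact le_rfl

lemma phaseStart_succ_eq_or (s : ℕ → S) (π : ℕ → S × ZMod N → A) (t : ℕ) :
    phaseStart s π (t + 1) = phaseStart s π t ∨ phaseStart s π (t + 1) = t + 1 := by
  simp only [phaseStart]
  split_ifs
  · exact Or.inl rfl
  · exact Or.inr rfl

lemma phaseStart_phaseStart (s : ℕ → S) (π : ℕ → S × ZMod N → A) (t : ℕ) :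
    phaseStart s π (phaseStart s π t) = phaseStart s π t := by
  induction t with
  | zero => rfl
  | succ t ih =>
    rcases phaseStart_succ_eq_or s π t with h | h
    · rw [h, ih]
    · rw [h, h]

section Run

variable {s : ℕ → S} {π : ℕ → S × ZMod N → A} {δ τ : ℝ} {xstar : S × ZMod N} {r : ℕ → ℝ}
  (h : IsRun δ τ xstar s π r)

include h

lemma IsRun.policy_phaseStart (t : ℕ) : π (phaseStart s π t) = π t := by
  induction t with
  | zero => rfl
  | succ t ih =>
    by_cases ht : phaseStart s π (t + 1) = t + 1
    · rw [ht]
    · rw [(phaseStart_succ_eq_or s π t).resolve_right ht, ih, h.keep t ht]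

/-- Within a phase, every pair is visited at most `n_k` times. -/
lemma IsRun.visits_phaseStart_le (t : ℕ) (x : S × ZMod N) (b : A) :
    visits s (action s π) (phaseStart s π t) (t + 1) x b ≤
      visitCount s (action s π) (phaseStart s π t) x b := by
  have hone (t : ℕ) : visits s (action s π) t (t + 1) x b ≤
      visitCount s (action s π) t x b := by
    rw [visits_succ _ _ le_rfl, visits_self]
    refine le_trans ?_ (le_max_left _ _)
    split_ifs <;> simp
  induction t with
  | zero => exact hone 0
  | succ t ih =>
    by_cases ht : phaseStart s π (t + 1) = t + 1
    · rw [ht]; exact hone (t + 1)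
    · have hk := (phaseStart_succ_eq_or s π t).resolve_right ht
      rw [hk]
      have hle := phaseStart_le s π t
      rw [visits_succ _ _ (by omega)]
      split_ifs with hx
      · obtain ⟨rfl, rfl⟩ := hx
        have hb : action s π (t + 1) = π t (s (t + 1), ((t + 1 : ℕ) : ZMod N)) := by
          rw [action, h.keep t ht]
        rw [hb]
        by_contra hcon
        refine ht ?_
        simp only [phaseStart]
        rw [if_neg]
        omega
      · simpa using ih

/-- The middle expression is an induction invariant: completed phases enter through `√n`, the
current phase through its exact contribution. The second inequality closes a phase, and is what the
induction uses when a new phase begins. -/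
lemma IsRun.sum_inv_sqrt_le_of_phase (T : ℕ) (x : S × ZMod N) (b : A) :
    ∑ t ∈ range (T + 1), (if (s t, (t : ZMod N)) = x ∧ action s π t = b then
        1 / √(visitCount s (action s π) (phaseStart s π t) x b : ℝ) else 0) ≤
      (√2 + 1) * √(visits s (action s π) 0 (phaseStart s π T) x b : ℝ) +
        visits s (action s π) (phaseStart s π T) (T + 1) x b /
          √(visitCount s (action s π) (phaseStart s π T) x b : ℝ) ∧
    (√2 + 1) * √(visits s (action s π) 0 (phaseStart s π T) x b : ℝ) +
        visits s (action s π) (phaseStart s π T) (T + 1) x b /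
          √(visitCount s (action s π) (phaseStart s π T) x b : ℝ) ≤
      (√2 + 1) * √(visits s (action s π) 0 (T + 1) x b : ℝ) := by
  have second (T : ℕ) : (√2 + 1) * √(visits s (action s π) 0 (phaseStart s π T) x b : ℝ) +
        visits s (action s π) (phaseStart s π T) (T + 1) x b /
          √(visitCount s (action s π) (phaseStart s π T) x b : ℝ) ≤
      (√2 + 1) * √(visits s (action s π) 0 (T + 1) x b : ℝ) := by
    have hle := h.visits_phaseStart_le T x b
    have hadd := visits_add_visits s (action s π)
      ((phaseStart_le s π T).trans (Nat.le_succ T)) x b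
    rw [Nat.succ_eq_add_one] at hadd
    rw [← hadd]
    have hmax : visitCount s (action s π) (phaseStart s π T) x b =
      max 1 (visits s (action s π) 0 (phaseStart s π T) x b) := rfl
    rw [hmax] at hle ⊢
    generalize visits s (action s π) 0 (phaseStart s π T) x b = n at *
    generalize visits s (action s π) (phaseStart s π T) (T + 1) x b = v at *
    have h2 : √2 * √2 = 2 := Real.mul_self_sqrt (by norm_num)
    have h20 := Real.sqrt_nonneg 2
    rcases Nat.eq_zero_or_pos n with rfl | hn
    · have : v ≤ 1 := by simpa using hle
      interval_cases v
      · simp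
      · simp [h20]
    · rw [max_eq_right hn] at hle ⊢
      have hn' : (0 : ℝ) < n := by exact_mod_cast hn
      have hv' : (v : ℝ) ≤ n := by exact_mod_cast hle
      have hv0 : (0 : ℝ) ≤ v := Nat.cast_nonneg v
      push_cast
      have ha : √(n : ℝ) * √(n : ℝ) = n := Real.mul_self_sqrt hn'.le
      have hb : √(n + v : ℝ) * √(n + v : ℝ) = n + v := Real.mul_self_sqrt (by positivity)
      have ha0 : 0 < √(n : ℝ) := Real.sqrt_pos.2 hn'
      have hb0 := Real.sqrt_nonneg (n + v : ℝ)
      have hab : √(n + v : ℝ) ≤ √2 * √(n : ℝ) := by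
        rw [← Real.sqrt_mul (by norm_num)]
        exact Real.sqrt_le_sqrt (by linarith)
      have hba : √(n : ℝ) ≤ √(n + v : ℝ) := Real.sqrt_le_sqrt (by linarith)
      -- Factor `v` as a difference of squares and use `√(n + v) ≤ √2 √n`, which holds because a
      -- phase at most doubles the count.
      have hdiv : (v : ℝ) / √(n : ℝ) ≤ (√2 + 1) * (√(n + v : ℝ) - √(n : ℝ)) := by
        rw [div_le_iff₀ ha0]
        have : (v : ℝ) = (√(n + v : ℝ) - √(n : ℝ)) * (√(n + v : ℝ) + √(n : ℝ)) := by
          nlinarith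
        refine this.le.trans ?_
        nlinarith [mul_le_mul_of_nonneg_left hab (sub_nonneg.2 hba)]
      linarith
  refine ⟨?_, second T⟩
  have hterm (T : ℕ) (n : ℕ) (y : ℝ) :
      ((n + if (s T, (T : ZMod N)) = x ∧ action s π T = b then 1 else 0 : ℕ) : ℝ) / y =
      n / y + if (s T, (T : ZMod N)) = x ∧ action s π T = b then 1 / y else 0 := by
    split_ifs <;> push_cast <;> ring
  induction T with
  | zero =>
    simp only [phaseStart, zero_add, Finset.sum_range_one]
    rw [visits_succ _ _ le_rfl, hterm, visits_self]
    simp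
  | succ T ih =>
    rw [Finset.sum_range_succ]
    by_cases ht : phaseStart s π (T + 1) = T + 1
    · rw [ht, visits_succ _ _ le_rfl, hterm, visits_self]
      have := ih.trans (second T)
      simp only [Nat.cast_zero, zero_div]
      push_cast at this ⊢
      linarith
    · have hk := (phaseStart_succ_eq_or s π T).resolve_right ht
      have hle := phaseStart_le s π T
      rw [hk, visits_succ _ _ (by omega : phaseStart s π T ≤ T + 1), hterm]
      push_cast at ih ⊢
      linarith

/-- Split the sum according to the visited pair, then apply Cauchy-Schwarz: the `S N A` visit counts
add up to `T`. -/
lemma IsRun.sum_inv_sqrt_visitCount_le (T : ℕ) :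
    ∑ t ∈ range T, 1 / √(visitCount s (action s π) (phaseStart s π t)
        (s t, (t : ZMod N)) (action s π t) : ℝ) ≤
      (√2 + 1) * √(Fintype.card S * N * Fintype.card A * T : ℝ) := by
  have h1 : ∑ t ∈ range T, 1 / √(visitCount s (action s π) (phaseStart s π t)
        (s t, (t : ZMod N)) (action s π t) : ℝ) =
      ∑ p : (S × ZMod N) × A, ∑ t ∈ range T,
        (if (s t, (t : ZMod N)) = p.1 ∧ action s π t = p.2 then
        1 / √(visitCount s (action s π) (phaseStart s π t) p.1 p.2 : ℝ) else 0) := by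
    rw [Finset.sum_comm]
    refine Finset.sum_congr rfl fun t _ => ?_
    rw [Finset.sum_eq_single ((s t, (t : ZMod N)), action s π t)]
    · simp
    · intro p _ hp
      rw [if_neg]
      rintro ⟨h1, h2⟩
      exact hp (Prod.ext h1.symm h2.symm)
    · simp
  rw [h1]
  have h2 : ∀ p : (S × ZMod N) × A, ∑ t ∈ range T,
        (if (s t, (t : ZMod N)) = p.1 ∧ action s π t = p.2 then
        1 / √(visitCount s (action s π) (phaseStart s π t) p.1 p.2 : ℝ) else 0) ≤
        (√2 + 1) * √(visits s (action s π) 0 T p.1 p.2 : ℝ) := fun p => by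
    cases T with
    | zero => simp; positivity
    | succ T =>
      exact (h.sum_inv_sqrt_le_of_phase T p.1 p.2).1.trans (h.sum_inv_sqrt_le_of_phase T p.1 p.2).2
  refine (Finset.sum_le_sum fun p _ => h2 p).trans ?_
  rw [← Finset.mul_sum]
  refine mul_le_mul_of_nonneg_left ?_ (by positivity)
  have h3 : ∑ p : (S × ZMod N) × A, (visits s (action s π) 0 T p.1 p.2 : ℝ) = T := by
    rw [Fintype.sum_prod_type]
    exact_mod_cast sum_visits s (action s π) T
  have h4 := Real.sum_sqrt_mul_sqrt_le (Finset.univ : Finset ((S × ZMod N) × A))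
    (f := fun p => (visits s (action s π) 0 T p.1 p.2 : ℝ)) (g := fun _ => 1)
    (fun _ => Nat.cast_nonneg _) (fun _ => zero_le_one)
  simp only [Real.sqrt_one, mul_one, h3] at h4
  refine h4.trans_eq ?_
  rw [← Real.sqrt_mul (Nat.cast_nonneg _)]
  congr 1
  simp [ZMod.card]
  ring

/-- The number of phases grows logarithmically. -/
lemma IsRun.card_phaseStart_le (T : ℕ) :
    #{t ∈ range T | phaseStart s π (t + 1) = t + 1} ≤
      Fintype.card S * N * Fintype.card A * Nat.size T := by
  -- Potential argument: the binary lengths of the visit counts never decrease. At each new phase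
  -- the pair that triggered it has doubled its count, or received its first visit, so its binary
  -- length grows by at least one.
  have key (T : ℕ) : #{t ∈ range T | phaseStart s π (t + 1) = t + 1} ≤
      ∑ p : (S × ZMod N) × A,
        Nat.size (visits s (action s π) 0 (phaseStart s π T) p.1 p.2) := by
    induction T with
    | zero => simp
    | succ T ih =>
      rw [Finset.range_add_one, Finset.filter_insert]
      split_ifs with ht
      · rw [Finset.card_insert_of_notMem (by simp)]
        refine (Nat.add_le_add_right ih 1).trans ?_
        rw [ht, Nat.add_one_le_iff]
        refine Finset.sum_lt_sum (fun p _ => ?_)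
          ⟨((s (T + 1), ((T + 1 : ℕ) : ZMod N)), π T (s (T + 1), ((T + 1 : ℕ) : ZMod N))),
            Finset.mem_univ _, ?_⟩
        · refine Nat.size_le_size ?_
          rw [← visits_add_visits s (action s π) ((phaseStart_le s π T).trans (Nat.le_succ T))]
          exact Nat.le_add_right _ _
        · have hle := phaseStart_le s π T
          have hnot : ¬ visits s (action s π) (phaseStart s π T) (T + 1)
              (s (T + 1), ((T + 1 : ℕ) : ZMod N)) (π T (s (T + 1), ((T + 1 : ℕ) : ZMod N))) <
              visitCount s (action s π) (phaseStart s π T)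
              (s (T + 1), ((T + 1 : ℕ) : ZMod N)) (π T (s (T + 1), ((T + 1 : ℕ) : ZMod N))) := by
            intro hlt
            simp only [phaseStart] at ht
            rw [if_pos hlt] at ht
            omega
          rw [visitCount, not_lt] at hnot
          rw [← visits_add_visits s (action s π) (hle.trans (Nat.le_succ T))]
          rw [Nat.succ_eq_add_one]
          dsimp only
          generalize visits s (action s π) 0 (phaseStart s π T) _ _ = n at *
          generalize visits s (action s π) (phaseStart s π T) (T + 1) _ _ = v at *
          rcases Nat.eq_zero_or_pos n with rfl | hn
          · have : 1 ≤ v := le_trans (le_max_left _ _) hnot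
            simp only [Nat.size_zero, zero_add]
            exact Nat.size_pos.2 this
          · have : n ≤ v := le_trans (le_max_right _ _) hnot
            rw [Nat.lt_size]
            have h5 : 2 ^ (Nat.size n - 1) ≤ n := by
              rw [← Nat.lt_size]
              have := Nat.size_pos.2 hn
              omega
            have h6 : 0 < Nat.size n := Nat.size_pos.2 hn
            have h7 : 2 ^ Nat.size n = 2 * 2 ^ (Nat.size n - 1) := by
              rw [← pow_succ']
              congr 1
              omega
            omega
      · rw [(phaseStart_succ_eq_or s π T).resolve_right ht]
        exact ih
  refine (key T).trans ?_
  refine (Finset.sum_le_card_nsmul _ _ (Nat.size T) fun p _ =>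
    Nat.size_le_size ((visits_le _ _ _ _ _).trans (phaseStart_le _ _ _))).trans_eq ?_
  simp [ZMod.card]

end Run

end PUCRL2

/-- Hoeffding's lemma for a Bernoulli variable. -/
lemma one_sub_add_mul_exp_le {m : ℝ} (hm : m ∈ Set.Icc (0 : ℝ) 1) (l : ℝ) :
    1 - m + m * Real.exp l ≤ Real.exp (l * m + l ^ 2 / 8) := by
  -- The Bernoulli law with mean `m`. The subgaussian bound for variables in `[0, 1]` is applied to
  -- the identity under `ν`.
  let ν : Measure ℝ := ENNReal.ofReal (1 - m) • Measure.dirac 0 + ENNReal.ofReal m • Measure.dirac 1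
  have hν : IsProbabilityMeasure ν := ⟨by
    simp only [ν, Measure.add_apply, Measure.smul_apply, measure_univ, smul_eq_mul, mul_one]
    rw [← ENNReal.ofReal_add (by linarith [hm.2]) hm.1]
    simp⟩
  have hint (f : ℝ → ℝ) : ∫ x, f x ∂ν = (1 - m) * f 0 + m * f 1 := by
    have hi (c : ENNReal) (hc : c ≠ ⊤) (a : ℝ) : Integrable f (c • Measure.dirac a) :=
      (integrable_dirac (by finiteness)).smul_measure hc
    rw [integral_add_measure (hi _ ENNReal.ofReal_ne_top _) (hi _ ENNReal.ofReal_ne_top _),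
      integral_smul_measure, integral_smul_measure, integral_dirac, integral_dirac,
      ENNReal.toReal_ofReal (by linarith [hm.2]), ENNReal.toReal_ofReal hm.1]
    simp
  have hmem : ∀ᵐ x ∂ν, id x ∈ Set.Icc (0 : ℝ) 1 := by
    simp only [ν]
    rw [ae_add_measure_iff]
    exact ⟨Measure.ae_smul_measure (by simp [ae_dirac_eq]) _,
      Measure.ae_smul_measure (by simp [ae_dirac_eq]) _⟩
  have h := (hasSubgaussianMGF_of_mem_Icc (μ := ν) (X := id) aemeasurable_id hmem).mgf_le l
  simp only [mgf, id] at h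
  rw [hint (fun x => x), hint] at h
  simp only [mul_zero, zero_add, mul_one, zero_sub] at h
  have h1 : (1 - m) * Real.exp (l * -m) + m * Real.exp (l * (1 - m)) =
      (1 - m + m * Real.exp l) * Real.exp (-(l * m)) := by
    rw [show l * -m = -(l * m) by ring, show l * (1 - m) = l + -(l * m) by ring, Real.exp_add]
    ring
  rw [h1] at h
  have h2 := mul_le_mul_of_nonneg_right h (Real.exp_nonneg (l * m))
  rw [mul_assoc, ← Real.exp_add, neg_add_cancel, Real.exp_zero, mul_one, ← Real.exp_add] at h2
  refine h2.trans_eq ?_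
  congr 1
  simp
  ring

/-- The chord bound for the convex exponential. It is affine in `z`, so conditional expectations can
be inserted, and it reduces variables in `[0, 1]` to Bernoulli ones. -/
lemma exp_mul_le_of_mem_Icc {z : ℝ} (hz : z ∈ Set.Icc (0 : ℝ) 1) (l : ℝ) :
    Real.exp (l * z) ≤ 1 + z * (Real.exp l - 1) := by
  have := convexOn_exp.2 (Set.mem_univ 0) (Set.mem_univ l) (sub_nonneg.2 hz.2) hz.1 (by ring)
  simp only [smul_eq_mul, mul_zero, zero_add, Real.exp_zero, mul_one] at this
  rw [mul_comm l z]
  linarith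

/-! ### Hoeffding's inequality for predictably selected steps -/

section Concentration

variable {Ω : Type*} [mΩ : MeasurableSpace Ω] {μ : Measure Ω} [IsProbabilityMeasure μ]
  {ℱ : Filtration ℕ mΩ}

lemma integral_mul_eq_of_condExp {m : MeasurableSpace Ω} (hm : m ≤ mΩ) {f Z p : Ω → ℝ} {C : ℝ}
    (hf : Measurable[m] f) (hC : ∀ ω, |f ω| ≤ C) (hZ : Integrable Z μ)
    (hp : μ[Z | m] =ᵐ[μ] p) : ∫ ω, f ω * Z ω ∂μ = ∫ ω, f ω * p ω ∂μ := by
  have h1 := condExp_stronglyMeasurable_mul_of_bound hm (μ := μ) hf.stronglyMeasurable hZ C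
    (Eventually.of_forall hC)
  rw [← integral_condExp hm (f := fun ω => f ω * Z ω)]
  refine integral_congr_ae ?_
  filter_upwards [h1, hp] with ω h1 h2
  have : μ[fun ω => f ω * Z ω | m] ω = f ω * (μ[Z | m]) ω := h1
  rw [this, h2]

/-- A predictable selection `J` of steps of a process `Z` with values in `[0, 1]` and
conditional means `p`. -/
structure Selection (μ : Measure Ω) (ℱ : Filtration ℕ mΩ) (J Z p : ℕ → Ω → ℝ) : Prop where
  measurable_J : ∀ t, Measurable[ℱ t] (J t)
  J_eq : ∀ t ω, J t ω = 0 ∨ J t ω = 1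
  measurable_Z : ∀ t, Measurable[ℱ (t + 1)] (Z t)
  Z_mem : ∀ t ω, Z t ω ∈ Set.Icc (0 : ℝ) 1
  measurable_p : ∀ t, Measurable[ℱ t] (p t)
  p_mem : ∀ t ω, p t ω ∈ Set.Icc (0 : ℝ) 1
  condExp_Z : ∀ t, μ[Z t | ℱ t] =ᵐ[μ] p t

namespace Selection

variable {J Z p : ℕ → Ω → ℝ} (h : Selection μ ℱ J Z p)

include h

lemma integrable_Z (t : ℕ) : Integrable (Z t) μ :=
  Integrable.of_mem_Icc 0 1 ((h.measurable_Z t).mono (ℱ.le _) le_rfl).aemeasurable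
    (Eventually.of_forall (h.Z_mem t))

/-- Reflection, which turns upper-tail bounds into lower-tail bounds. -/
lemma one_sub : Selection μ ℱ J (fun t ω => 1 - Z t ω) (fun t ω => 1 - p t ω) where
  measurable_J := h.measurable_J
  J_eq := h.J_eq
  measurable_Z t := (h.measurable_Z t).const_sub 1
  Z_mem t ω := ⟨sub_nonneg.2 (h.Z_mem t ω).2, sub_le_self _ (h.Z_mem t ω).1⟩
  measurable_p t := (h.measurable_p t).const_sub 1
  p_mem t ω := ⟨sub_nonneg.2 (h.p_mem t ω).2, sub_le_self _ (h.p_mem t ω).1⟩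
  condExp_Z t := by
    have h1 := condExp_sub (integrable_const (μ := μ) (1 : ℝ)) (h.integrable_Z t) (ℱ t)
    have h2 : μ[fun _ : Ω => (1 : ℝ) | ℱ t] = fun _ => 1 := condExp_const (ℱ.le t) 1
    filter_upwards [h1, h.condExp_Z t] with ω h1 h3
    have : (fun ω => 1 - Z t ω) = (fun _ : Ω => (1 : ℝ)) - Z t := rfl
    rw [this, h1, Pi.sub_apply, h2, h3]

/-- The exponent of the Hoeffding supermartingale. -/
lemma measurable_exponent (l : ℝ) (T : ℕ) : Measurable[ℱ T] fun ω =>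
    ∑ t ∈ range T, J t ω * (l * (Z t ω - p t ω) - l ^ 2 / 8) := by
  refine Finset.measurable_fun_sum _ fun t ht => ?_
  rw [Finset.mem_range] at ht
  have h1 : Measurable[ℱ T] (J t) := (h.measurable_J t).mono (ℱ.mono ht.le) le_rfl
  have h2 : Measurable[ℱ T] (p t) := (h.measurable_p t).mono (ℱ.mono ht.le) le_rfl
  have h3 : Measurable[ℱ T] (Z t) := (h.measurable_Z t).mono (ℱ.mono ht) le_rfl
  exact h1.mul (((h3.sub h2).const_mul l).sub_const _)

lemma exponent_le (l : ℝ) (T : ℕ) (ω : Ω) :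
    ∑ t ∈ range T, J t ω * (l * (Z t ω - p t ω) - l ^ 2 / 8) ≤ T * |l| := by
  rw [← nsmul_eq_mul]
  refine (Finset.sum_le_card_nsmul _ _ |l| fun t _ => ?_).trans_eq (by rw [Finset.card_range])
  rcases h.J_eq t ω with hJ | hJ <;> rw [hJ]
  · simp
  · have h1 := h.Z_mem t ω
    have h2 := h.p_mem t ω
    have h3 : |Z t ω - p t ω| ≤ 1 := by
      rw [abs_le]; constructor <;> linarith [h1.1, h1.2, h2.1, h2.2]
    have h4 : l * (Z t ω - p t ω) ≤ |l| * 1 := by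
      refine (le_abs_self _).trans ?_
      rw [abs_mul]
      exact mul_le_mul_of_nonneg_left h3 (abs_nonneg l)
    nlinarith [sq_nonneg l]

lemma integrable_exp (l : ℝ) (T : ℕ) : Integrable (fun ω => Real.exp
    (∑ t ∈ range T, J t ω * (l * (Z t ω - p t ω) - l ^ 2 / 8))) μ := by
  refine Integrable.of_mem_Icc 0 (Real.exp (T * |l|))
    ((Real.measurable_exp.comp (h.measurable_exponent l T)).mono (ℱ.le _) le_rfl).aemeasurable
    (Eventually.of_forall fun ω => ⟨Real.exp_nonneg _, Real.exp_le_exp.2 (h.exponent_le l T ω)⟩)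

/-- The exponential is a supermartingale. A step with `J = 0` contributes the factor `1`, and for a
step with `J = 1` Hoeffding's lemma bounds the conditional expectation of its factor by `1`. -/
lemma integral_exp_le (l : ℝ) (T : ℕ) :
    ∫ ω, Real.exp (∑ t ∈ range T, J t ω * (l * (Z t ω - p t ω) - l ^ 2 / 8)) ∂μ ≤ 1 := by
  induction T with
  | zero => simp
  | succ T ih =>
    refine le_trans ?_ ih
    set W : Ω → ℝ := fun ω => Real.exp
      (∑ t ∈ range T, J t ω * (l * (Z t ω - p t ω) - l ^ 2 / 8)) with hW
    have hWm : Measurable[ℱ T] W := Real.measurable_exp.comp (h.measurable_exponent l T)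
    have hW0 (ω) : 0 ≤ W ω := Real.exp_nonneg _
    have hWC (ω) : W ω ≤ Real.exp (T * |l|) := Real.exp_le_exp.2 (h.exponent_le l T ω)
    set e : Ω → ℝ := fun ω => Real.exp (-(l * p T ω + l ^ 2 / 8)) with he
    have hem : Measurable[ℱ T] e :=
      Real.measurable_exp.comp (((h.measurable_p T).const_mul l).add_const _).neg
    have he0 (ω) : 0 ≤ e ω := Real.exp_nonneg _
    have heC (ω) : e ω ≤ Real.exp |l| := by
      refine Real.exp_le_exp.2 ?_
      have h2 := h.p_mem T ω
      have h4 : -(l * p T ω) ≤ |l| * 1 := by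
        refine (neg_le_abs _).trans ?_
        rw [abs_mul, abs_of_nonneg h2.1]
        exact mul_le_mul_of_nonneg_left h2.2 (abs_nonneg l)
      nlinarith [sq_nonneg l]
    -- `f + g * Z T` is the chord bound for the integrand at `T + 1`. Its coefficients are `ℱ
    -- T`-measurable and bounded, so `Z T` may be replaced by `p T` under the integral.
    set f : Ω → ℝ := fun ω => W ω * (1 - J T ω + J T ω * e ω) with hf
    set g : Ω → ℝ := fun ω => W ω * (J T ω * e ω * (Real.exp l - 1)) with hg
    have hfm : Measurable[ℱ T] f :=
      hWm.mul (((h.measurable_J T).const_sub 1).add ((h.measurable_J T).mul hem))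
    have hgm : Measurable[ℱ T] g := hWm.mul (((h.measurable_J T).mul hem).mul_const _)
    have hfC (ω) : |f ω| ≤ Real.exp (T * |l|) * (1 + Real.exp |l|) := by
      rw [hf, abs_mul, abs_of_nonneg (hW0 ω)]
      refine mul_le_mul (hWC ω) ?_ (abs_nonneg _) (Real.exp_nonneg _)
      rcases h.J_eq T ω with hJ | hJ <;> rw [hJ]
      · simp [Real.exp_nonneg]
      · simp only [sub_self, zero_add, one_mul, abs_of_nonneg (he0 ω)]
        linarith [heC ω]
    have hgC (ω) : |g ω| ≤ Real.exp (T * |l|) * (Real.exp |l| * |Real.exp l - 1|) := by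
      rw [hg, abs_mul, abs_of_nonneg (hW0 ω)]
      refine mul_le_mul (hWC ω) ?_ (abs_nonneg _) (Real.exp_nonneg _)
      rw [abs_mul]
      refine mul_le_mul_of_nonneg_right ?_ (abs_nonneg _)
      rcases h.J_eq T ω with hJ | hJ <;> rw [hJ]
      · simp [Real.exp_nonneg]
      · simpa [abs_of_nonneg (he0 ω)] using heC ω
    have hfi : Integrable f μ := Integrable.of_mem_Icc _ _
      (hfm.mono (ℱ.le _) le_rfl).aemeasurable (Eventually.of_forall fun ω => abs_le.1 (hfC ω))
    have hgi : Integrable g μ := Integrable.of_mem_Icc _ _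
      (hgm.mono (ℱ.le _) le_rfl).aemeasurable (Eventually.of_forall fun ω => abs_le.1 (hgC ω))
    have hgb : ∀ᵐ ω ∂μ, ‖g ω‖ ≤ Real.exp (T * |l|) * (Real.exp |l| * |Real.exp l - 1|) :=
      Eventually.of_forall hgC
    have hpi : Integrable (p T) μ := Integrable.of_mem_Icc 0 1
      ((h.measurable_p T).mono (ℱ.le _) le_rfl).aemeasurable (Eventually.of_forall (h.p_mem T))
    have hgZi : Integrable (fun ω => g ω * Z T ω) μ :=
      (h.integrable_Z T).bdd_mul hgi.aestronglyMeasurable hgb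
    have hgpi : Integrable (fun ω => g ω * p T ω) μ :=
      hpi.bdd_mul hgi.aestronglyMeasurable hgb
    calc ∫ ω, Real.exp (∑ t ∈ range (T + 1), J t ω * (l * (Z t ω - p t ω) - l ^ 2 / 8)) ∂μ
        ≤ ∫ ω, f ω + g ω * Z T ω ∂μ := by
          refine integral_mono (h.integrable_exp l (T + 1)) (hfi.add hgZi) fun ω => ?_
          simp only [Finset.sum_range_succ, Real.exp_add]
          rw [show f ω + g ω * Z T ω = W ω * (1 - J T ω + J T ω * e ω +
            J T ω * e ω * (Real.exp l - 1) * Z T ω) by simp only [hf, hg]; ring]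
          refine mul_le_mul_of_nonneg_left ?_ (hW0 ω)
          rcases h.J_eq T ω with hJ | hJ <;> rw [hJ]
          · simp
          · have h1 := mul_le_mul_of_nonneg_left (exp_mul_le_of_mem_Icc (h.Z_mem T ω) l) (he0 ω)
            have h2 : Real.exp (1 * (l * (Z T ω - p T ω) - l ^ 2 / 8)) =
                e ω * Real.exp (l * Z T ω) := by
              simp only [he, ← Real.exp_add]
              congr 1
              ring
            rw [h2]
            linarith
      _ = ∫ ω, f ω + g ω * p T ω ∂μ := by
          rw [integral_add hfi hgZi, integral_add hfi hgpi,
            integral_mul_eq_of_condExp (ℱ.le T) hgm hgC (h.integrable_Z T) (h.condExp_Z T)]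
      _ ≤ ∫ ω, W ω ∂μ := by
          refine integral_mono (hfi.add hgpi) (h.integrable_exp l T) fun ω => ?_
          dsimp only
          rw [show f ω + g ω * p T ω = W ω * (1 - J T ω + J T ω * (e ω *
            (1 - p T ω + p T ω * Real.exp l))) by simp only [hf, hg]; ring]
          refine mul_le_of_le_one_right (hW0 ω) ?_
          rcases h.J_eq T ω with hJ | hJ <;> rw [hJ]
          · simp
          · have h1 := mul_le_mul_of_nonneg_left (one_sub_add_mul_exp_le (h.p_mem T ω) l) (he0 ω)
            have h2 : e ω * Real.exp (l * p T ω + l ^ 2 / 8) = 1 := by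
              simp only [he]
              rw [← Real.exp_add, neg_add_cancel, Real.exp_zero]
            rw [h2] at h1
            simpa using h1

/-- Hoeffding's inequality for the steps that are selected. -/
lemma measureReal_le (T n : ℕ) {ε : ℝ} (hε : 0 ≤ ε) :
    μ.real {ω | ∑ t ∈ range T, J t ω = n ∧
      n * ε ≤ ∑ t ∈ range T, J t ω * (Z t ω - p t ω)} ≤ Real.exp (-(2 * n * ε ^ 2)) := by
  -- Markov's inequality with `l = 4 ε`, which maximizes `l ε - l ^ 2 / 8`. Fixing the number `n` of
  -- selected steps makes the quadratic term deterministic.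
  have h1 := mul_meas_ge_le_integral_of_nonneg (μ := μ)
    (f := fun ω => Real.exp
      (∑ t ∈ range T, J t ω * (4 * ε * (Z t ω - p t ω) - (4 * ε) ^ 2 / 8)))
    (Eventually.of_forall fun ω => Real.exp_nonneg _) (h.integrable_exp (4 * ε) T)
    (Real.exp (2 * n * ε ^ 2))
  have h2 := h1.trans (h.integral_exp_le (4 * ε) T)
  have h3 : μ.real {ω | ∑ t ∈ range T, J t ω = n ∧
      n * ε ≤ ∑ t ∈ range T, J t ω * (Z t ω - p t ω)} ≤
      μ.real {ω | Real.exp (2 * n * ε ^ 2) ≤ Real.exp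
      (∑ t ∈ range T, J t ω * (4 * ε * (Z t ω - p t ω) - (4 * ε) ^ 2 / 8))} := by
    refine measureReal_mono ?_
    rintro ω ⟨hn, hs⟩
    refine Real.exp_le_exp.2 ?_
    have : ∑ t ∈ range T, J t ω * (4 * ε * (Z t ω - p t ω) - (4 * ε) ^ 2 / 8) =
        4 * ε * ∑ t ∈ range T, J t ω * (Z t ω - p t ω) - 2 * ε ^ 2 * ∑ t ∈ range T, J t ω := by
      rw [Finset.mul_sum, Finset.mul_sum, ← Finset.sum_sub_distrib]
      exact Finset.sum_congr rfl fun t _ => by ring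
    rw [this, hn]
    nlinarith [mul_le_mul_of_nonneg_left hs hε]
  rw [Real.exp_neg, ← one_div, le_div_iff₀' (Real.exp_pos _)]
  exact (mul_le_mul_of_nonneg_left h3 (Real.exp_nonneg _)).trans h2

end Selection

end Concentration

/-! ### Measurability of the statistics and of value iteration -/

section CountableLevels

variable {Ω γ γ' β : Type*} {m : MeasurableSpace Ω} [Countable γ] [MeasurableSpace β]

/-- States, actions and policies carry no σ-algebra, only measurable level sets. This permits
substituting such a discrete random quantity into a family of measurable functions. -/
lemma measurable_of_measurableSet_eq {g : Ω → γ} (hg : ∀ c, MeasurableSet {ω | g ω = c})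
    {F : γ → Ω → β} (hF : ∀ c, Measurable (F c)) : Measurable fun ω => F (g ω) ω := by
  let _ : MeasurableSpace γ := ⊤
  have h1 : Measurable g := measurable_to_countable' hg
  have h2 : Measurable (fun p : γ × Ω => F p.1 p.2) := measurable_from_prod_countable_right hF
  exact h2.comp (h1.prodMk measurable_id)

lemma measurableSet_eq_of_measurableSet_eq {g : Ω → γ}
    (hg : ∀ c, MeasurableSet {ω | g ω = c}) {F : γ → Ω → γ'}
    (hF : ∀ c d, MeasurableSet {ω | F c ω = d}) (d : γ') :
    MeasurableSet {ω | F (g ω) ω = d} := by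
  have : {ω | F (g ω) ω = d} = ⋃ c, {ω | g ω = c} ∩ {ω | F c ω = d} := by
    ext ω
    simp
  rw [this]
  exact MeasurableSet.iUnion fun c => (hg c).inter (hF c d)

lemma measurableSet_eq_prodMk {g : Ω → γ} {g' : Ω → γ'}
    (hg : ∀ c, MeasurableSet {ω | g ω = c}) (hg' : ∀ c, MeasurableSet {ω | g' ω = c})
    (c : γ × γ') : MeasurableSet {ω | (g ω, g' ω) = c} := by
  have : {ω | (g ω, g' ω) = c} = {ω | g ω = c.1} ∩ {ω | g' ω = c.2} := by
    ext ω
    simp [Prod.ext_iff]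
  rw [this]
  exact (hg _).inter (hg' _)

end CountableLevels

namespace PUCRL2

variable {S A : Type*} [Fintype S] [Fintype A] [DecidableEq S] [DecidableEq A]
  {N : ℕ} [NeZero N]

/-- The largest plausible reward, as a function of the empirical mean and of the width of the
confidence interval. -/
lemma sSup_confR (δ : ℝ) (s : ℕ → S) (a : ℕ → A) (r : ℕ → ℝ) (t : ℕ) (x : S × ZMod N) (b : A) :
    sSup (confR δ s a r t x b) =
      let y := rHat s a r t x b
      let c := √(7 * Real.log (2 * Fintype.card S * Fintype.card A * (t + 1) / δ) /
        (2 * visitCount s a t x b))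
      if max 0 (y - c) ≤ min 1 (y + c) then min 1 (y + c) else 0 := by
  extract_lets y c
  have : confR δ s a r t x b = Set.Icc (max 0 (y - c)) (min 1 (y + c)) := by
    ext v
    simp only [confR, Set.mem_ofPred_eq, Set.mem_Icc, abs_le, max_le_iff, le_min_iff]
    constructor
    · rintro ⟨⟨h1, h2⟩, h3, h4⟩
      exact ⟨⟨h1, by linarith⟩, h2, by linarith⟩
    · rintro ⟨⟨h1, h2⟩, h3, h4⟩
      exact ⟨⟨h1, h3⟩, by linarith, by linarith⟩
  rw [this]
  -- For arbitrary sequences the interval may be empty, and its supremum is then `0` by convention.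
  split_ifs with h
  · exact csSup_Icc h
  · rw [Set.Icc_eq_empty h, Real.sSup_empty]

lemma continuous_sSup_image_sum {P : Set (S → ℝ)} (h0 : ∀ q ∈ P, ∀ s', 0 ≤ q s')
    (h1 : ∀ q ∈ P, ∑ s', q s' = 1) :
    Continuous fun u : S → ℝ => sSup ((fun q : S → ℝ => ∑ s', u s' * q s') '' P) := by
  rcases P.eq_empty_or_nonempty with rfl | hP
  · simpa using continuous_const
  refine LipschitzWith.continuous (K := 1) (LipschitzWith.of_le_add fun u u' => ?_)
  refine sSup_image_sum_le_add h0 h1 hP fun x => ?_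
  have := dist_le_pi_dist u u' x
  rw [Real.dist_eq] at this
  linarith [le_abs_self (u x - u' x)]

section Measurability

variable {Ω : Type*} {m : MeasurableSpace Ω} {s : ℕ → Ω → S} {a : ℕ → Ω → A} {r : ℕ → Ω → ℝ}
  {t : ℕ}

lemma measurable_visits (hs : ∀ i ≤ t, ∀ y, MeasurableSet {ω | s i ω = y})
    (ha : ∀ i < t, ∀ b, MeasurableSet {ω | a i ω = b}) (k : ℕ) (x : S × ZMod N) (b : A) :
    Measurable fun ω => visits (fun i => s i ω) (fun i => a i ω) k t x b := by
  simp only [visits, Finset.card_filter, Prod.ext_iff]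
  refine Finset.measurable_fun_sum _ fun i hi => ?_
  rw [Finset.mem_Ico] at hi
  exact Measurable.ite (((hs i hi.2.le _).inter (MeasurableSet.const _)).inter (ha i hi.2 _))
    measurable_const measurable_const

lemma measurable_visitCount (hs : ∀ i ≤ t, ∀ y, MeasurableSet {ω | s i ω = y})
    (ha : ∀ i < t, ∀ b, MeasurableSet {ω | a i ω = b}) (x : S × ZMod N) (b : A) :
    Measurable fun ω => visitCount (fun i => s i ω) (fun i => a i ω) t x b :=
  measurable_const.max (measurable_visits hs ha 0 x b)

lemma measurable_transitions (hs : ∀ i ≤ t, ∀ y, MeasurableSet {ω | s i ω = y})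
    (ha : ∀ i < t, ∀ b, MeasurableSet {ω | a i ω = b}) (x : S × ZMod N) (b : A) (s' : S) :
    Measurable fun ω => transitions (fun i => s i ω) (fun i => a i ω) t x b s' := by
  simp only [transitions, Finset.card_filter, Prod.ext_iff]
  refine Finset.measurable_fun_sum _ fun i hi => ?_
  rw [Finset.mem_range] at hi
  exact Measurable.ite (((hs i hi.le _).inter (MeasurableSet.const _)).inter
    ((ha i hi _).inter (hs (i + 1) hi _))) measurable_const measurable_const

lemma measurable_rHat (hs : ∀ i ≤ t, ∀ y, MeasurableSet {ω | s i ω = y})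
    (ha : ∀ i < t, ∀ b, MeasurableSet {ω | a i ω = b}) (hr : ∀ i < t, Measurable (r i))
    (x : S × ZMod N) (b : A) :
    Measurable fun ω => rHat (fun i => s i ω) (fun i => a i ω) (fun i => r i ω) t x b := by
  simp only [rHat, Finset.sum_filter, Prod.ext_iff]
  refine Measurable.div (Finset.measurable_fun_sum _ fun i hi => ?_)
    (measurable_from_top.comp (measurable_visitCount hs ha x b))
  rw [Finset.mem_range] at hi
  exact Measurable.ite (((hs i hi.le _).inter (MeasurableSet.const _)).inter (ha i hi _))
    (hr i hi) measurable_const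

lemma measurable_sSup_confR (δ : ℝ) (hs : ∀ i ≤ t, ∀ y, MeasurableSet {ω | s i ω = y})
    (ha : ∀ i < t, ∀ b, MeasurableSet {ω | a i ω = b}) (hr : ∀ i < t, Measurable (r i))
    (x : S × ZMod N) (b : A) :
    Measurable fun ω =>
      sSup (confR δ (fun i => s i ω) (fun i => a i ω) (fun i => r i ω) t x b) := by
  simp only [sSup_confR]
  have h1 := measurable_rHat hs ha hr x b
  have h2 : Measurable fun ω =>
      √(7 * Real.log (2 * Fintype.card S * Fintype.card A * (t + 1) / δ) /
        (2 * (visitCount (fun i => s i ω) (fun i => a i ω) t x b : ℝ))) :=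
    (measurable_from_top (f := fun n : ℕ =>
      √(7 * Real.log (2 * Fintype.card S * Fintype.card A * (t + 1) / δ) /
        (2 * (n : ℝ))))).comp (measurable_visitCount hs ha x b)
  exact Measurable.ite (measurableSet_le (measurable_const.max (h1.sub h2))
    (measurable_const.min (h1.add h2))) (measurable_const.min (h1.add h2)) measurable_const

lemma measurable_sSup_confP (δ : ℝ) (hs : ∀ i ≤ t, ∀ y, MeasurableSet {ω | s i ω = y})
    (ha : ∀ i < t, ∀ b, MeasurableSet {ω | a i ω = b})
    (x : S × ZMod N) (b : A) {u : Ω → S → ℝ} (hu : ∀ y, Measurable fun ω => u ω y) :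
    Measurable fun ω => sSup ((fun q : S → ℝ => ∑ s', u ω s' * q s') ''
      confP δ (fun i => s i ω) (fun i => a i ω) t x b) := by
  -- The random set `confP` depends on `ω` only through integer counts, so it takes countably many
  -- values. For each fixed value the supremum is continuous in `u`.
  let Q (n : ℕ) (f : S → ℕ) : Set (S → ℝ) := {q | (∀ s', 0 ≤ q s') ∧ ∑ s', q s' = 1 ∧
    ∑ s', |q s' - f s' / n| ≤
      √(14 * Fintype.card S * N * Real.log (2 * Fintype.card A * (t + 1) / δ) / n)}
  have hQ (c : ℕ × (S → ℕ)) : Measurable fun ω =>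
      sSup ((fun q : S → ℝ => ∑ s', u ω s' * q s') '' Q c.1 c.2) :=
    (continuous_sSup_image_sum (P := Q c.1 c.2) (fun q hq => hq.1) (fun q hq => hq.2.1)).measurable.comp
      (measurable_pi_lambda _ hu)
  refine measurable_of_measurableSet_eq
    (g := fun ω => (visitCount (fun i => s i ω) (fun i => a i ω) t x b,
      fun s' => transitions (fun i => s i ω) (fun i => a i ω) t x b s'))
    (F := fun c ω => sSup ((fun q : S → ℝ => ∑ s', u ω s' * q s') '' Q c.1 c.2)) ?_ hQ
  refine measurableSet_eq_prodMk
    (fun c => measurable_visitCount hs ha x b (measurableSet_singleton c)) fun c => ?_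
  exact (measurable_pi_lambda _ fun s' => measurable_transitions hs ha x b s')
    (measurableSet_singleton c)

lemma measurable_evi (δ τ : ℝ) (xstar : S × ZMod N)
    (hs : ∀ i ≤ t, ∀ y, MeasurableSet {ω | s i ω = y})
    (ha : ∀ i < t, ∀ b, MeasurableSet {ω | a i ω = b}) (hr : ∀ i < t, Measurable (r i))
    (i : ℕ) (x : S × ZMod N) :
    Measurable fun ω => evi (confR δ (fun i => s i ω) (fun i => a i ω) (fun i => r i ω) t)
      (confP δ (fun i => s i ω) (fun i => a i ω) t) τ xstar i x := by
  induction i generalizing x with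
  | zero => exact measurable_const
  | succ i ih =>
    simp only [evi]
    have hsup (x : S × ZMod N) : Measurable fun ω => ⨆ b,
        eviQ (confR δ (fun i => s i ω) (fun i => a i ω) (fun i => r i ω) t)
          (confP δ (fun i => s i ω) (fun i => a i ω) t) τ
          (evi (confR δ (fun i => s i ω) (fun i => a i ω) (fun i => r i ω) t)
      (confP δ (fun i => s i ω) (fun i => a i ω) t) τ xstar i) x b := by
      refine Measurable.iSup fun b => ?_
      exact ((measurable_sSup_confR δ hs ha hr x b).add
        ((measurable_sSup_confP δ hs ha x b fun y => ih (y, x.2 + 1)).const_mul τ)).add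
        ((ih x).const_mul _)
    exact (hsup x).sub (hsup xstar)

end Measurability

/-- The relative value function, multiplied by `τ`, from which the policy of a phase that starts
at time `t` is computed, shifted and truncated to take its values in `[0, d]`. -/
noncomputable def bias (d δ τ : ℝ) (xstar : S × ZMod N) (s : ℕ → S) (a : ℕ → A) (r : ℕ → ℝ) (t : ℕ)
    (x : S × ZMod N) : ℝ :=
  let u := evi (confR δ s a r t) (confP δ s a t) τ xstar
    (sInf {i | EviStops (confR δ s a r t) (confP δ s a t) τ xstar (1 / √((t : ℝ) + 1)) i})
  max 0 (min d (τ * (u x - ⨅ y, u y)))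

lemma bias_mem {d : ℝ} (hd : 0 ≤ d) (δ τ : ℝ) (xstar : S × ZMod N) (s : ℕ → S) (a : ℕ → A)
    (r : ℕ → ℝ) (t : ℕ) (x : S × ZMod N) : bias d δ τ xstar s a r t x ∈ Set.Icc 0 d :=
  ⟨le_max_left _ _, max_le hd (min_le_left _ _)⟩

lemma measurableSet_sInf_eq {Ω : Type*} {m : MeasurableSpace Ω} {p : ℕ → Ω → Prop}
    (hp : ∀ i, MeasurableSet {ω | p i ω}) (n : ℕ) :
    MeasurableSet {ω | sInf {i | p i ω} = n} := by
  -- The second piece accounts for `sInf ∅ = 0`.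
  have : {ω | sInf {i | p i ω} = n} = ({ω | p n ω} ∩ ⋂ j ∈ Set.Iio n, {ω | p j ω}ᶜ) ∪
      ({_ω | n = 0} ∩ ⋂ j, {ω | p j ω}ᶜ) := by
    ext ω
    simp only [Set.mem_ofPred_eq, Set.mem_union, Set.mem_inter_iff, Set.mem_iInter, Set.mem_Iio,
      Set.mem_compl_iff]
    constructor
    · rintro rfl
      by_cases h : {i | p i ω}.Nonempty
      · exact Or.inl ⟨Nat.sInf_mem h, fun j hj => Nat.notMem_of_lt_sInf hj⟩
      · rw [Set.not_nonempty_iff_eq_empty] at h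
        refine Or.inr ⟨by rw [h, Nat.sInf_empty], fun j hj => ?_⟩
        exact (Set.eq_empty_iff_forall_notMem.1 h) j hj
    · rintro (⟨h1, h2⟩ | ⟨rfl, h⟩)
      · refine le_antisymm (Nat.sInf_le h1) ?_
        by_contra hlt
        have hmem : sInf {i | p i ω} ∈ {i | p i ω} := Nat.sInf_mem ⟨n, h1⟩
        exact h2 _ (not_le.1 hlt) hmem
      · rw [Nat.sInf_eq_zero]
        exact Or.inr (Set.eq_empty_iff_forall_notMem.2 h)
  rw [this]
  refine ((hp n).inter ?_).union ((MeasurableSet.const _).inter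
    (MeasurableSet.iInter fun j => (hp j).compl))
  exact MeasurableSet.biInter (Set.to_countable _) fun j _ => (hp j).compl

lemma measurable_bias {Ω : Type*} {m : MeasurableSpace Ω} {s : ℕ → Ω → S} {a : ℕ → Ω → A}
    {r : ℕ → Ω → ℝ} {t : ℕ} (d δ τ : ℝ) (xstar : S × ZMod N)
    (hs : ∀ i ≤ t, ∀ y, MeasurableSet {ω | s i ω = y})
    (ha : ∀ i < t, ∀ b, MeasurableSet {ω | a i ω = b}) (hr : ∀ i < t, Measurable (r i))
    (x : S × ZMod N) :
    Measurable fun ω => bias d δ τ xstar (fun i => s i ω) (fun i => a i ω) (fun i => r i ω) t x := by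
  have hu := measurable_evi δ τ xstar hs ha hr
  unfold bias
  refine measurable_of_measurableSet_eq
    (g := fun ω => sInf {i | EviStops (confR δ (fun i => s i ω) (fun i => a i ω)
      (fun i => r i ω) t) (confP δ (fun i => s i ω) (fun i => a i ω) t) τ xstar
      (1 / √((t : ℝ) + 1)) i})
    (F := fun i ω =>
      let u := evi (confR δ (fun i => s i ω) (fun i => a i ω) (fun i => r i ω) t)
        (confP δ (fun i => s i ω) (fun i => a i ω) t) τ xstar i
      max 0 (min d (τ * (u x - ⨅ y, u y)))) ?_ fun i => ?_
  · refine measurableSet_sInf_eq fun i => ?_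
    exact measurableSet_le ((Measurable.iSup fun x => (hu (i + 1) x).sub (hu i x)).sub
      (Measurable.iInf fun x => (hu (i + 1) x).sub (hu i x))) measurable_const
  · exact measurable_const.max (measurable_const.min
      (((hu i x).sub (Measurable.iInf fun y => hu i y)).const_mul τ))

end PUCRL2

/-! ### The predictable selections attached to the process -/

namespace PUCRL2

variable {S A : Type*} [Fintype S] [Fintype A] [DecidableEq S] [DecidableEq A]
  {N : ℕ} [NeZero N]

lemma sum_transition_mem (M : PeriodicMDP S A N) (B : Finset S) (n : ZMod N) (y : S) (b : A) :
    ∑ z ∈ B, M.p n y b z ∈ Set.Icc (0 : ℝ) 1 := by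
  refine ⟨Finset.sum_nonneg fun z _ => M.p_nonneg _ _ _ _, ?_⟩
  rw [← M.p_sum n y b]
  exact Finset.sum_le_sum_of_subset_of_nonneg (Finset.subset_univ B)
    fun z _ _ => M.p_nonneg _ _ _ _

namespace IsProcess

variable {M : PeriodicMDP S A N} {δ τ : ℝ} {xstar : S × ZMod N} {Ω : Type*}
  [mΩ : MeasurableSpace Ω] {μ : Measure Ω} [IsProbabilityMeasure μ] {ℱ : Filtration ℕ mΩ}
  {s : ℕ → Ω → S} {π : ℕ → Ω → S × ZMod N → A} {r : ℕ → Ω → ℝ}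
  (h : IsProcess M δ τ xstar μ ℱ s π r)

include h

lemma measurable_comp (t : ℕ) (F : S → (S × ZMod N → A) → ℝ) :
    Measurable[ℱ t] fun ω => F (s t ω) (π t ω) :=
  measurable_of_measurableSet_eq (m := ℱ t) (g := fun ω => (s t ω, π t ω))
    (F := fun c _ => F c.1 c.2)
    (measurableSet_eq_prodMk (h.measurable_s t) (h.measurable_π t)) fun _ => measurable_const

lemma measurableSet_s {i t : ℕ} (hit : i ≤ t) (y : S) : MeasurableSet[ℱ t] {ω | s i ω = y} :=
  ℱ.mono hit _ (h.measurable_s i y)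

lemma measurableSet_action {i t : ℕ} (hit : i ≤ t) (b : A) :
    MeasurableSet[ℱ t] {ω | action (fun i => s i ω) (fun i => π i ω) i = b} := by
  refine ℱ.mono hit _ ?_
  exact measurableSet_eq_of_measurableSet_eq (m := ℱ i) (g := fun ω => (s i ω, π i ω))
    (F := fun c _ => c.2 (c.1, (i : ZMod N)))
    (measurableSet_eq_prodMk (h.measurable_s i) (h.measurable_π i))
    (fun _ _ => MeasurableSet.const _) b

lemma measurable_reward {i t : ℕ} (hit : i < t) : Measurable[ℱ t] (r i) :=
  (h.measurable_r i).mono (ℱ.mono hit) le_rfl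

lemma measurable_mean_reward (t : ℕ) : Measurable[ℱ t] fun ω =>
    M.r (t : ZMod N) (s t ω) (action (fun i => s i ω) (fun i => π i ω) t) :=
  h.measurable_comp t fun y f => M.r (t : ZMod N) y (f (y, (t : ZMod N)))

lemma measurable_transition (t : ℕ) (y : S) : Measurable[ℱ t] fun ω =>
    M.p (t : ZMod N) (s t ω) (action (fun i => s i ω) (fun i => π i ω) t) y :=
  h.measurable_comp t fun z f => M.p (t : ZMod N) z (f (z, (t : ZMod N))) y

/-- The expectation of a function of the next state. -/
lemma condExp_next (t : ℕ) {f : Ω → S → ℝ} (hf : ∀ y, Measurable[ℱ t] fun ω => f ω y) {C : ℝ}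
    (hC : ∀ ω y, |f ω y| ≤ C) :
    μ[fun ω => f ω (s (t + 1) ω) | ℱ t] =ᵐ[μ] fun ω => ∑ y, f ω y *
      M.p (t : ZMod N) (s t ω) (action (fun i => s i ω) (fun i => π i ω) t) y := by
  have hms (y : S) : MeasurableSet {ω | s (t + 1) ω = y} :=
    ℱ.le _ _ (h.measurable_s (t + 1) y)
  have hind (y : S) : Integrable ({ω | s (t + 1) ω = y}.indicator fun _ => (1 : ℝ)) μ :=
    (integrable_const 1).indicator (hms y)
  have hfb (y : S) : ∀ᵐ ω ∂μ, ‖f ω y‖ ≤ C := Eventually.of_forall fun ω => hC ω y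
  have e1 : (fun ω => f ω (s (t + 1) ω)) = ∑ y, (fun ω => f ω y) *
      {ω | s (t + 1) ω = y}.indicator fun _ => (1 : ℝ) := by
    ext ω
    simp [Finset.sum_apply, Set.indicator_apply]
  rw [e1]
  have e2 := condExp_finsetSum (s := Finset.univ) (f := fun y : S => (fun ω => f ω y) *
      {ω | s (t + 1) ω = y}.indicator fun _ => (1 : ℝ))
    (fun y _ => (hind y).bdd_mul ((hf y).mono (ℱ.le t) le_rfl).aestronglyMeasurable (hfb y)) (ℱ t)
  have e3 (y : S) := condExp_stronglyMeasurable_mul_of_bound (ℱ.le t) (μ := μ)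
    (hf y).stronglyMeasurable (hind y) C (hfb y)
  filter_upwards [e2, ae_all_iff.2 e3, ae_all_iff.2 fun y => h.next_state t y] with ω e2 e3 e4
  rw [e2, Finset.sum_apply]
  refine Finset.sum_congr rfl fun y _ => ?_
  rw [e3 y, Pi.mul_apply, e4 y]

/-- Indicator of a visit to `(x, b)` at time `t`. -/
lemma measurable_visit (x : S × ZMod N) (b : A) (t : ℕ) : Measurable[ℱ t] fun ω =>
    if (s t ω, (t : ZMod N)) = x ∧ action (fun i => s i ω) (fun i => π i ω) t = b
      then (1 : ℝ) else 0 :=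
  h.measurable_comp t fun y f =>
    if (y, (t : ZMod N)) = x ∧ f (y, (t : ZMod N)) = b then (1 : ℝ) else 0

lemma selection_reward (x : S × ZMod N) (b : A) : Selection μ ℱ
    (fun t ω => if (s t ω, (t : ZMod N)) = x ∧
      action (fun i => s i ω) (fun i => π i ω) t = b then (1 : ℝ) else 0)
    r (fun t ω => M.r (t : ZMod N) (s t ω) (action (fun i => s i ω) (fun i => π i ω) t)) where
  measurable_J := h.measurable_visit x b
  J_eq t ω := by split_ifs <;> simp
  measurable_Z := h.measurable_r
  Z_mem := h.r_mem
  measurable_p := h.measurable_mean_reward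
  p_mem _ _ := M.r_mem _ _ _
  condExp_Z := h.mean_reward

lemma selection_transition (x : S × ZMod N) (b : A) (B : Finset S) : Selection μ ℱ
    (fun t ω => if (s t ω, (t : ZMod N)) = x ∧
      action (fun i => s i ω) (fun i => π i ω) t = b then (1 : ℝ) else 0)
    (fun t ω => if s (t + 1) ω ∈ B then 1 else 0)
    (fun t ω => ∑ y ∈ B,
      M.p (t : ZMod N) (s t ω) (action (fun i => s i ω) (fun i => π i ω) t) y) where
  measurable_J := h.measurable_visit x b
  J_eq t ω := by split_ifs <;> simp
  measurable_Z t := h.measurable_comp (t + 1) fun y _ => if y ∈ B then 1 else 0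
  Z_mem t ω := by split_ifs <;> simp
  measurable_p t := Finset.measurable_fun_sum _ fun y _ => h.measurable_transition t y
  p_mem t ω := sum_transition_mem M B _ _ _
  condExp_Z t := by
    have := h.condExp_next t (f := fun _ y => if y ∈ B then 1 else 0)
      (fun y => measurable_const) (C := 1) (fun ω y => by split_ifs <;> simp)
    refine this.trans (Eventually.of_forall fun ω => ?_)
    simp [Finset.sum_ite_mem]

lemma measurableSet_phaseStart (t k : ℕ) : MeasurableSet[ℱ t]
    {ω | phaseStart (fun i => s i ω) (fun i => π i ω) t = k} := by
  induction t generalizing k with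
  | zero => simp only [phaseStart]; exact MeasurableSet.const _
  | succ t ih =>
    have key := measurableSet_eq_of_measurableSet_eq (m := ℱ (t + 1))
      (g := fun ω => (phaseStart (fun i => s i ω) (fun i => π i ω) t, (s (t + 1) ω, π t ω)))
      -- The guard `c.1 ≤ t`, always true along the trajectory, keeps the family within the
      -- information available at time `t + 1` for every value of the index.
      (F := fun c ω => if c.1 ≤ t then
          (if visits (fun i => s i ω) (action (fun i => s i ω) (fun i => π i ω)) c.1 (t + 1)
              (c.2.1, ((t + 1 : ℕ) : ZMod N)) (c.2.2 (c.2.1, ((t + 1 : ℕ) : ZMod N))) <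
            visitCount (fun i => s i ω) (action (fun i => s i ω) (fun i => π i ω)) c.1
              (c.2.1, ((t + 1 : ℕ) : ZMod N)) (c.2.2 (c.2.1, ((t + 1 : ℕ) : ZMod N)))
          then c.1 else t + 1) else 0)
      (measurableSet_eq_prodMk (fun c => ℱ.mono (Nat.le_succ t) _ (ih c))
        (measurableSet_eq_prodMk (h.measurable_s (t + 1))
          fun c => ℱ.mono (Nat.le_succ t) _ (h.measurable_π t c))) ?_ k
    · convert key using 3 with ω
      rw [if_pos (phaseStart_le _ _ _)]
      rfl
    · rintro ⟨k', y, f⟩ d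
      dsimp only
      split_ifs with hk
      · have h1 := measurable_visits (m := ℱ (t + 1)) (t := t + 1) (s := s)
          (a := fun i ω => action (fun i => s i ω) (fun i => π i ω) i)
          (fun i hi => h.measurableSet_s hi) (fun i hi => h.measurableSet_action hi.le) k'
          (y, ((t + 1 : ℕ) : ZMod N)) (f (y, ((t + 1 : ℕ) : ZMod N)))
        have h2 := measurable_visitCount (m := ℱ (t + 1)) (t := k') (s := s)
          (a := fun i ω => action (fun i => s i ω) (fun i => π i ω) i)
          (fun i hi => h.measurableSet_s (by omega)) (fun i hi => h.measurableSet_action (by omega))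
          (y, ((t + 1 : ℕ) : ZMod N)) (f (y, ((t + 1 : ℕ) : ZMod N)))
        have h3 : Measurable[ℱ (t + 1)] fun ω =>
            if visits (fun i => s i ω) (action (fun i => s i ω) (fun i => π i ω)) k' (t + 1)
              (y, ((t + 1 : ℕ) : ZMod N)) (f (y, ((t + 1 : ℕ) : ZMod N))) <
            visitCount (fun i => s i ω) (action (fun i => s i ω) (fun i => π i ω)) k'
              (y, ((t + 1 : ℕ) : ZMod N)) (f (y, ((t + 1 : ℕ) : ZMod N)))
            then k' else t + 1 :=
          Measurable.ite (measurableSet_lt h1 h2) measurable_const measurable_const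
        exact h3 (measurableSet_singleton d)
      · exact MeasurableSet.const _

/-- The value function of the current phase is computed from data before the phase began, hence is
known before the next state is drawn. -/
lemma measurable_bias_phaseStart (d : ℝ) (t : ℕ) (x : S × ZMod N) : Measurable[ℱ t] fun ω =>
    bias d δ τ xstar (fun i => s i ω) (action (fun i => s i ω) (fun i => π i ω))
      (fun i => r i ω) (phaseStart (fun i => s i ω) (fun i => π i ω) t) x := by
  have key := measurable_of_measurableSet_eq (m := ℱ t)
    (g := fun ω => phaseStart (fun i => s i ω) (fun i => π i ω) t)
    (F := fun k ω => if k ≤ t then bias d δ τ xstar (fun i => s i ω)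
      (action (fun i => s i ω) (fun i => π i ω)) (fun i => r i ω) k x else 0)
    (h.measurableSet_phaseStart t) fun k => ?_
  · convert key using 2 with ω
    rw [if_pos (phaseStart_le _ _ _)]
  · split_ifs with hk
    · exact measurable_bias (m := ℱ t) (s := s)
        (a := fun i ω => action (fun i => s i ω) (fun i => π i ω) i) d δ τ xstar
        (fun i hi => h.measurableSet_s (hi.trans hk))
        (fun i hi => h.measurableSet_action (hi.le.trans hk))
        (fun i hi => h.measurable_reward (hi.trans_le hk)) x
    · exact measurable_const

/-- Reward noise and value noise are merged into one variable scaled to `[0, 1]`, so a single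
Hoeffding bound with range `1 + d` covers both. The signs make an upper deviation correspond to low
rewards and low next values, the direction that increases the regret. -/
lemma selection_bias {d : ℝ} (hd : 0 ≤ d) : Selection μ ℱ (fun _ _ => 1)
    (fun t ω => ((1 - r t ω) + (d - bias d δ τ xstar (fun i => s i ω)
      (action (fun i => s i ω) (fun i => π i ω)) (fun i => r i ω)
      (phaseStart (fun i => s i ω) (fun i => π i ω) t)
      (s (t + 1) ω, ((t + 1 : ℕ) : ZMod N)))) / (1 + d))
    (fun t ω => ((1 - M.r (t : ZMod N) (s t ω) (action (fun i => s i ω) (fun i => π i ω) t)) +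
      (d - ∑ y, bias d δ τ xstar (fun i => s i ω)
      (action (fun i => s i ω) (fun i => π i ω)) (fun i => r i ω)
      (phaseStart (fun i => s i ω) (fun i => π i ω) t) (y, ((t + 1 : ℕ) : ZMod N)) *
      M.p (t : ZMod N) (s t ω) (action (fun i => s i ω) (fun i => π i ω) t) y)) / (1 + d)) where
  measurable_J _ := measurable_const
  J_eq _ _ := Or.inr rfl
  measurable_Z t := by
    refine (((h.measurable_r t).const_sub 1).add (Measurable.const_sub ?_ d)).div_const _
    exact measurable_of_measurableSet_eq (m := ℱ (t + 1)) (g := s (t + 1))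
      (F := fun y ω => bias d δ τ xstar (fun i => s i ω)
      (action (fun i => s i ω) (fun i => π i ω)) (fun i => r i ω)
      (phaseStart (fun i => s i ω) (fun i => π i ω) t) (y, ((t + 1 : ℕ) : ZMod N)))
      (h.measurable_s (t + 1)) fun y =>
        (h.measurable_bias_phaseStart d t _).mono (ℱ.mono (Nat.le_succ t)) le_rfl
  Z_mem t ω := by
    have h1 := h.r_mem t ω
    have h2 := bias_mem hd δ τ xstar (fun i => s i ω)
      (action (fun i => s i ω) (fun i => π i ω)) (fun i => r i ω)
      (phaseStart (fun i => s i ω) (fun i => π i ω) t) (s (t + 1) ω, ((t + 1 : ℕ) : ZMod N))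
    refine ⟨div_nonneg ?_ (by linarith), div_le_one_of_le₀ ?_ (by linarith)⟩ <;>
    linarith [h1.1, h1.2, h2.1, h2.2]
  measurable_p t := by
    refine (((h.measurable_mean_reward t).const_sub 1).add (Measurable.const_sub ?_ d)).div_const _
    exact Finset.measurable_fun_sum _ fun y _ =>
      (h.measurable_bias_phaseStart d t _).mul (h.measurable_transition t y)
  p_mem t ω := by
    have h1 := M.r_mem (t : ZMod N) (s t ω) (action (fun i => s i ω) (fun i => π i ω) t)
    have h2 (y : S) := bias_mem hd δ τ xstar (fun i => s i ω)
      (action (fun i => s i ω) (fun i => π i ω)) (fun i => r i ω)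
      (phaseStart (fun i => s i ω) (fun i => π i ω) t) (y, ((t + 1 : ℕ) : ZMod N))
    have hp (y : S) := M.p_nonneg (t : ZMod N) (s t ω)
      (action (fun i => s i ω) (fun i => π i ω) t) y
    have h3 := Finset.sum_nonneg fun y (_ : y ∈ Finset.univ) => mul_nonneg (h2 y).1 (hp y)
    have h4 := Finset.sum_le_sum fun y (_ : y ∈ Finset.univ) =>
      mul_le_mul_of_nonneg_right (h2 y).2 (hp y)
    rw [← Finset.mul_sum, M.p_sum, mul_one] at h4
    refine ⟨div_nonneg ?_ (by linarith), div_le_one_of_le₀ ?_ (by linarith)⟩ <;>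
    linarith [h1.1, h1.2]
  condExp_Z t := by
    let w : Ω → S → ℝ := fun ω y => bias d δ τ xstar (fun i => s i ω)
      (action (fun i => s i ω) (fun i => π i ω)) (fun i => r i ω)
      (phaseStart (fun i => s i ω) (fun i => π i ω) t) (y, ((t + 1 : ℕ) : ZMod N))
    have hwm (y : S) : Measurable[ℱ t] fun ω => w ω y := h.measurable_bias_phaseStart d t _
    have hw (ω y) : w ω y ∈ Set.Icc 0 d := bias_mem hd _ _ _ _ _ _ _ _
    have hwm' : Measurable fun ω => w ω (s (t + 1) ω) :=
      measurable_of_measurableSet_eq (g := s (t + 1)) (F := fun y ω => w ω y)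
        (fun y => ℱ.le _ _ (h.measurable_s (t + 1) y)) fun y => (hwm y).mono (ℱ.le t) le_rfl
    have hri : Integrable (r t) μ := Integrable.of_mem_Icc 0 1
      ((h.measurable_r t).mono (ℱ.le _) le_rfl).aemeasurable (Eventually.of_forall (h.r_mem t))
    have hwi : Integrable (fun ω => w ω (s (t + 1) ω)) μ := Integrable.of_mem_Icc 0 d
      hwm'.aemeasurable (Eventually.of_forall fun ω => hw ω _)
    have e1 := h.condExp_next t hwm (C := d)
      (fun ω y => by rw [abs_of_nonneg (hw ω y).1]; exact (hw ω y).2)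
    have e2 := h.mean_reward t
    have e3 := condExp_add hri hwi (ℱ t)
    have e4 := condExp_sub (integrable_const (μ := μ) (1 + d : ℝ)) (hri.add hwi) (ℱ t)
    have e5 := condExp_smul (μ := μ) ((1 + d)⁻¹) ((fun _ => 1 + d) -
      (r t + fun ω => w ω (s (t + 1) ω))) (ℱ t)
    have e6 : μ[fun _ : Ω => (1 + d : ℝ) | ℱ t] = fun _ => 1 + d := condExp_const (ℱ.le t) _
    have e7 : (fun ω => ((1 - r t ω) + (d - w ω (s (t + 1) ω))) / (1 + d)) = (1 + d)⁻¹ •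
        ((fun _ => 1 + d) - (r t + fun ω => w ω (s (t + 1) ω))) := by
      ext ω
      simp only [Pi.smul_apply, Pi.sub_apply, Pi.add_apply, smul_eq_mul]
      ring
    change μ[fun ω => ((1 - r t ω) + (d - w ω (s (t + 1) ω))) / (1 + d) | ℱ t] =ᵐ[μ] _
    rw [e7]
    filter_upwards [e1, e2, e3, e4, e5] with ω e1 e2 e3 e4 e5
    rw [e5, Pi.smul_apply, e4, Pi.sub_apply, e6, e3, Pi.add_apply, e1, e2, smul_eq_mul]
    simp only [w]
    ring

end IsProcess

end PUCRL2

/-! ### Failure probabilities of the confidence sets -/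

namespace PUCRL2

variable {S A : Type*} [Fintype S] [Fintype A] [DecidableEq S] [DecidableEq A]
  {N : ℕ} [NeZero N]

section Path

variable (M : PeriodicMDP S A N) (s : ℕ → S) (a : ℕ → A) (r : ℕ → ℝ) (t : ℕ) (x : S × ZMod N)
  (b : A)

lemma sum_visit : ∑ i ∈ range t, (if (s i, (i : ZMod N)) = x ∧ a i = b then (1 : ℝ) else 0) =
    visits s a 0 t x b := by
  rw [visits, ← Finset.range_eq_Ico, Finset.card_filter]
  push_cast
  rfl

variable {t x b} in
lemma visitCount_of_pos (h : 1 ≤ visits s a 0 t x b) :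
    visitCount s a t x b = visits s a 0 t x b := max_eq_right h

lemma sum_reward_sub (h : 1 ≤ visits s a 0 t x b) :
    ∑ i ∈ range t, (if (s i, (i : ZMod N)) = x ∧ a i = b then (1 : ℝ) else 0) *
        (r i - M.r (i : ZMod N) (s i) (a i)) =
      visits s a 0 t x b * (rHat s a r t x b - M.r x.2 x.1 b) := by
  have hn : (visits s a 0 t x b : ℝ) ≠ 0 := by
    have : 0 < visits s a 0 t x b := h
    positivity
  rw [rHat, visitCount_of_pos s a h, mul_sub, mul_div_cancel₀ _ hn, ← sum_visit,
    Finset.sum_mul, Finset.sum_filter, ← Finset.sum_sub_distrib]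
  refine Finset.sum_congr rfl fun i _ => ?_
  split_ifs with hi
  · obtain ⟨rfl, rfl⟩ := hi
    simp
  · simp

lemma sum_transition_sub (h : 1 ≤ visits s a 0 t x b) (B : Finset S) :
    ∑ i ∈ range t, (if (s i, (i : ZMod N)) = x ∧ a i = b then (1 : ℝ) else 0) *
        ((if s (i + 1) ∈ B then 1 else 0) - ∑ y ∈ B, M.p (i : ZMod N) (s i) (a i) y) =
      visits s a 0 t x b * ∑ y ∈ B, (pHat s a t x b y - M.p x.2 x.1 b y) := by
  have hn : (visits s a 0 t x b : ℝ) ≠ 0 := by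
    have : 0 < visits s a 0 t x b := h
    positivity
  have htr (y : S) : (visits s a 0 t x b : ℝ) * pHat s a t x b y =
      ∑ i ∈ range t, (if (s i, (i : ZMod N)) = x ∧ a i = b then (1 : ℝ) else 0) *
        if s (i + 1) = y then 1 else 0 := by
    rw [pHat, visitCount_of_pos s a h, mul_div_cancel₀ _ hn, transitions, Finset.card_filter]
    push_cast
    refine Finset.sum_congr rfl fun i _ => ?_
    simp only [← ite_and, ite_mul, one_mul, zero_mul, and_assoc]
  rw [Finset.sum_sub_distrib, mul_sub, Finset.mul_sum, Finset.sum_congr rfl fun y _ => htr y,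
    Finset.sum_comm, ← sum_visit, Finset.sum_mul, ← Finset.sum_sub_distrib]
  refine Finset.sum_congr rfl fun i _ => ?_
  split_ifs with hi hB
  · obtain ⟨rfl, rfl⟩ := hi
    simp [hB]
  · obtain ⟨rfl, rfl⟩ := hi
    simp [hB]
  all_goals simp only [zero_mul, Finset.sum_const_zero, sub_self]

lemma sum_pHat (M : PeriodicMDP S A N) (h : 1 ≤ visits s a 0 t x b) : ∑ y, pHat s a t x b y = 1 := by
  have hn : (0 : ℝ) < visits s a 0 t x b := by
    have : 0 < visits s a 0 t x b := h
    positivity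
  have := sum_transition_sub M s a t x b h Finset.univ
  simp only [Finset.mem_univ, if_true, M.p_sum, sub_self, mul_zero, Finset.sum_const_zero,
    Finset.sum_sub_distrib] at this
  rcases mul_eq_zero.1 this.symm with h0 | h0
  · exact absurd h0 hn.ne'
  · linarith

variable {M s a r t x b}

/-- The logarithm is large enough to make the confidence radii of unvisited pairs at least `1`. -/
lemma log_two_le_log {c y δ : ℝ} (hδ : δ ∈ Set.Ioo (0 : ℝ) 1) (hc : 1 ≤ c) (hy : 1 ≤ y) :
    1 / 2 ≤ Real.log (2 * c * y / δ) := by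
  have h1 : (2 : ℝ) ≤ 2 * c * y / δ := by
    rw [le_div_iff₀ hδ.1]
    nlinarith [hδ.1, hδ.2, mul_le_mul hc hy zero_le_one (zero_le_one.trans hc)]
  have := Real.log_le_log two_pos h1
  linarith [Real.log_two_gt_d9]

lemma exists_deviation_of_notMem_confR [Nonempty S] [Nonempty A] {δ : ℝ}
    (hδ : δ ∈ Set.Ioo (0 : ℝ) 1) (h : M.r x.2 x.1 b ∉ confR δ s a r t x b) :
    1 ≤ visits s a 0 t x b ∧
      (visits s a 0 t x b * √(7 * Real.log (2 * Fintype.card S * Fintype.card A * (t + 1) / δ) /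
          (2 * visits s a 0 t x b)) ≤
        ∑ i ∈ range t, (if (s i, (i : ZMod N)) = x ∧ a i = b then (1 : ℝ) else 0) *
          (r i - M.r (i : ZMod N) (s i) (a i)) ∨
      visits s a 0 t x b * √(7 * Real.log (2 * Fintype.card S * Fintype.card A * (t + 1) / δ) /
          (2 * visits s a 0 t x b)) ≤
        ∑ i ∈ range t, (if (s i, (i : ZMod N)) = x ∧ a i = b then (1 : ℝ) else 0) *
          ((1 - r i) - (1 - M.r (i : ZMod N) (s i) (a i)))) := by
  have hr := M.r_mem x.2 x.1 b
  simp only [confR, Set.mem_ofPred_eq, not_and, not_le] at h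
  have h := h hr
  -- For an unvisited pair the empirical mean is `0` and the radius at least `1`, so the constraint
  -- cannot fail.
  have hpos : 1 ≤ visits s a 0 t x b := by
    by_contra hcon
    have h0 : visits s a 0 t x b = 0 := by omega
    have h1 : visitCount s a t x b = 1 := by rw [visitCount, h0]; rfl
    have h2 : rHat s a r t x b = 0 := by
      rw [rHat, Finset.sum_filter]
      rw [Finset.sum_eq_zero, zero_div]
      intro i hi
      rw [if_neg]
      intro hi'
      rw [visits, Finset.card_eq_zero, Finset.filter_eq_empty_iff] at h0
      exact h0 (by simpa using hi) hi'
    rw [h1, h2, sub_zero, abs_of_nonneg hr.1] at h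
    refine absurd h (not_lt.2 (hr.2.trans ?_))
    rw [Real.one_le_sqrt]
    have h3 : (1 : ℝ) ≤ Fintype.card S := by exact_mod_cast Fintype.card_pos
    have h4 : (1 : ℝ) ≤ Fintype.card A := by exact_mod_cast Fintype.card_pos
    have := log_two_le_log hδ (one_le_mul_of_one_le_of_one_le h3 h4)
      (by linarith [Nat.cast_nonneg (α := ℝ) t] : (1 : ℝ) ≤ t + 1)
    rw [← mul_assoc] at this
    push_cast
    linarith
  refine ⟨hpos, ?_⟩
  have e2 : ∑ i ∈ range t, (if (s i, (i : ZMod N)) = x ∧ a i = b then (1 : ℝ) else 0) *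
          ((1 - r i) - (1 - M.r (i : ZMod N) (s i) (a i))) =
      -∑ i ∈ range t, (if (s i, (i : ZMod N)) = x ∧ a i = b then (1 : ℝ) else 0) *
          (r i - M.r (i : ZMod N) (s i) (a i)) := by
    rw [← Finset.sum_neg_distrib]
    exact Finset.sum_congr rfl fun i _ => by ring
  rw [e2, sum_reward_sub M s a r t x b hpos, ← mul_neg]
  rw [visitCount_of_pos s a hpos, abs_sub_comm] at h
  have hn : (0 : ℝ) ≤ visits s a 0 t x b := Nat.cast_nonneg _
  rcases lt_abs.1 h with h | h
  · exact Or.inl (mul_le_mul_of_nonneg_left h.le hn)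
  · exact Or.inr (mul_le_mul_of_nonneg_left h.le hn)

lemma exists_deviation_of_notMem_confP [Nonempty S] [Nonempty A] {δ : ℝ}
    (hδ : δ ∈ Set.Ioo (0 : ℝ) 1) (h : M.p x.2 x.1 b ∉ confP δ s a t x b) :
    1 ≤ visits s a 0 t x b ∧ ∃ B : Finset S,
      visits s a 0 t x b * (√(14 * Fintype.card S * N *
          Real.log (2 * Fintype.card A * (t + 1) / δ) / visits s a 0 t x b) / 2) ≤
        ∑ i ∈ range t, (if (s i, (i : ZMod N)) = x ∧ a i = b then (1 : ℝ) else 0) *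
          ((if s (i + 1) ∈ B then 1 else 0) - ∑ y ∈ B, M.p (i : ZMod N) (s i) (a i) y) := by
  simp only [confP, Set.mem_ofPred_eq, not_and, not_le] at h
  have h := h (M.p_nonneg _ _ _) (M.p_sum _ _ _)
  have hpos : 1 ≤ visits s a 0 t x b := by
    by_contra hcon
    have h0 : visits s a 0 t x b = 0 := by omega
    have h1 : visitCount s a t x b = 1 := by rw [visitCount, h0]; rfl
    have h2 (y : S) : pHat s a t x b y = 0 := by
      rw [pHat, transitions]
      rw [Finset.filter_false_of_mem, Finset.card_empty, Nat.cast_zero, zero_div]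
      intro i hi hi'
      rw [visits, Finset.card_eq_zero, Finset.filter_eq_empty_iff] at h0
      exact h0 (by simpa using hi) ⟨hi'.1, hi'.2.1⟩
    simp only [h1, h2, sub_zero, abs_of_nonneg (M.p_nonneg _ _ _ _), M.p_sum] at h
    refine absurd h (not_lt.2 ?_)
    rw [Real.one_le_sqrt]
    have h3 : (1 : ℝ) ≤ Fintype.card S := by exact_mod_cast Fintype.card_pos
    have h4 : (1 : ℝ) ≤ Fintype.card A := by exact_mod_cast Fintype.card_pos
    have h5 : (1 : ℝ) ≤ N := by exact_mod_cast NeZero.one_le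
    have := log_two_le_log hδ h4
      (by linarith [Nat.cast_nonneg (α := ℝ) t] : (1 : ℝ) ≤ t + 1)
    have h6 := one_le_mul_of_one_le_of_one_le h3 h5
    push_cast
    rw [div_one, mul_assoc 14]
    nlinarith
  -- The `ℓ¹` distance of two probability vectors is twice the excess mass on the states where
  -- `pHat` is the larger one. This is the witness `B`, and the source of the `/ 2`.
  refine ⟨hpos, Finset.univ.filter fun y => 0 ≤ pHat s a t x b y - M.p x.2 x.1 b y, ?_⟩
  rw [sum_transition_sub M s a t x b hpos]
  refine mul_le_mul_of_nonneg_left ?_ (Nat.cast_nonneg _)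
  rw [visitCount_of_pos s a hpos] at h
  have e1 : ∑ y, |M.p x.2 x.1 b y - pHat s a t x b y| =
      2 * (∑ y with 0 ≤ pHat s a t x b y - M.p x.2 x.1 b y,
        (pHat s a t x b y - M.p x.2 x.1 b y)) := by
    have e2 : ∑ y, (pHat s a t x b y - M.p x.2 x.1 b y) = 0 := by
      rw [Finset.sum_sub_distrib, sum_pHat s a t x b M hpos, M.p_sum, sub_self]
    have e3 : ∑ y, |M.p x.2 x.1 b y - pHat s a t x b y| =
        ∑ y, (2 * (if 0 ≤ pHat s a t x b y - M.p x.2 x.1 b y then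
          pHat s a t x b y - M.p x.2 x.1 b y else 0) -
          (pHat s a t x b y - M.p x.2 x.1 b y)) := by
      refine Finset.sum_congr rfl fun y _ => ?_
      rw [abs_sub_comm]
      split_ifs with hy
      · rw [abs_of_nonneg hy]; ring
      · rw [abs_of_neg (not_le.1 hy)]; ring
    rw [e3, Finset.sum_sub_distrib, e2, sub_zero, ← Finset.mul_sum, Finset.sum_filter]
  rw [e1] at h
  linarith

end Path

namespace IsProcess

variable {M : PeriodicMDP S A N} {δ τ : ℝ} {xstar : S × ZMod N} {Ω : Type*}
  [mΩ : MeasurableSpace Ω] {μ : Measure Ω} [IsProbabilityMeasure μ] {ℱ : Filtration ℕ mΩ}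
  {s : ℕ → Ω → S} {π : ℕ → Ω → S × ZMod N → A} {r : ℕ → Ω → ℝ}
  (h : IsProcess M δ τ xstar μ ℱ s π r)

lemma exp_neg_mul_log {y : ℝ} (hy : 0 < y) (n : ℕ) :
    Real.exp (-(n * Real.log y)) = (y⁻¹) ^ n := by
  rw [Real.exp_neg, mul_comm, Real.exp_mul, Real.exp_log hy, Real.rpow_natCast, inv_pow]

include h

/-- Union bound over the number of visits and the two signs. A period index not yet seen contributes
nothing. This is essential later, since the logarithm in the reward radius has no factor `N`. -/
lemma measureReal_notMem_confR_le [Nonempty S] [Nonempty A] (hδ : δ ∈ Set.Ioo (0 : ℝ) 1) (t : ℕ)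
    (x : S × ZMod N) (b : A) :
    μ.real {ω | M.r x.2 x.1 b ∉ confR δ (fun i => s i ω)
      (action (fun i => s i ω) (fun i => π i ω)) (fun i => r i ω) t x b} ≤
      if x.2 ∈ (range t).image (fun i : ℕ => (i : ZMod N)) then
        2 * t * (δ / (2 * Fintype.card S * Fintype.card A * (t + 1))) ^ 7 else 0 := by
  split_ifs with hx
  · set Λ := Real.log (2 * Fintype.card S * Fintype.card A * (t + 1) / δ) with hΛ
    have h3 : (1 : ℝ) ≤ Fintype.card S := by exact_mod_cast Fintype.card_pos
    have h4 : (1 : ℝ) ≤ Fintype.card A := by exact_mod_cast Fintype.card_pos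
    have hΛ0 : 0 ≤ Λ := by
      have := log_two_le_log hδ (one_le_mul_of_one_le_of_one_le h3 h4)
        (by linarith [Nat.cast_nonneg (α := ℝ) t] : (1 : ℝ) ≤ t + 1)
      rw [← mul_assoc] at this
      linarith
    have sel := h.selection_reward x b
    have hsub : {ω | M.r x.2 x.1 b ∉ confR δ (fun i => s i ω)
      (action (fun i => s i ω) (fun i => π i ω)) (fun i => r i ω) t x b} ⊆
      ⋃ n ∈ Finset.Icc 1 t,
        ({ω | ∑ i ∈ range t, (if (s i ω, (i : ZMod N)) = x ∧
            action (fun i => s i ω) (fun i => π i ω) i = b then (1 : ℝ) else 0) = (n : ℕ) ∧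
          (n : ℕ) * √(7 * Λ / (2 * n)) ≤ ∑ i ∈ range t, (if (s i ω, (i : ZMod N)) = x ∧
            action (fun i => s i ω) (fun i => π i ω) i = b then (1 : ℝ) else 0) *
            (r i ω - M.r (i : ZMod N) (s i ω) (action (fun i => s i ω) (fun i => π i ω) i))} ∪
        {ω | ∑ i ∈ range t, (if (s i ω, (i : ZMod N)) = x ∧
            action (fun i => s i ω) (fun i => π i ω) i = b then (1 : ℝ) else 0) = (n : ℕ) ∧
          (n : ℕ) * √(7 * Λ / (2 * n)) ≤ ∑ i ∈ range t, (if (s i ω, (i : ZMod N)) = x ∧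
            action (fun i => s i ω) (fun i => π i ω) i = b then (1 : ℝ) else 0) *
            ((1 - r i ω) -
              (1 - M.r (i : ZMod N) (s i ω) (action (fun i => s i ω) (fun i => π i ω) i)))}) := by
      intro ω hω
      obtain ⟨h1, h2⟩ := exists_deviation_of_notMem_confR hδ hω
      refine Set.mem_biUnion (Finset.mem_coe.2 (Finset.mem_Icc.2 ⟨h1, visits_le _ _ _ _ _⟩)) ?_
      rcases h2 with h2 | h2
      · exact Or.inl ⟨sum_visit _ _ _ _ _, h2⟩
      · exact Or.inr ⟨sum_visit _ _ _ _ _, h2⟩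
    refine (measureReal_mono hsub (measure_ne_top _ _)).trans ((measureReal_biUnion_finset_le _ _).trans ?_)
    have hexp (n : ℕ) (hn : n ∈ Finset.Icc 1 t) :
        Real.exp (-(2 * n * √(7 * Λ / (2 * n)) ^ 2)) =
        (δ / (2 * Fintype.card S * Fintype.card A * (t + 1))) ^ 7 := by
      have hn0 : (0 : ℝ) < n := by
        have := (Finset.mem_Icc.1 hn).1
        positivity
      rw [Real.sq_sqrt (by positivity)]
      rw [show 2 * (n : ℝ) * (7 * Λ / (2 * n)) = (7 : ℕ) * Λ by field_simp; push_cast; ring]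
      rw [hΛ, exp_neg_mul_log (by have := hδ.1; positivity), inv_div]
    calc _ ≤ ∑ n ∈ Finset.Icc 1 t,
          2 * (δ / (2 * Fintype.card S * Fintype.card A * (t + 1))) ^ 7 := by
          refine Finset.sum_le_sum fun n hn => (measureReal_union_le _ _).trans ?_
          have h1 := sel.measureReal_le t n (Real.sqrt_nonneg (7 * Λ / (2 * n)))
          have h2 := sel.one_sub.measureReal_le t n (Real.sqrt_nonneg (7 * Λ / (2 * n)))
          rw [hexp n hn] at h1 h2
          exact (add_le_add h1 h2).trans_eq (two_mul _).symm
      _ = _ := by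
          rw [Finset.sum_const, Nat.card_Icc, nsmul_eq_mul, Nat.add_sub_cancel]
          ring
  · refine le_of_eq ?_
    convert measureReal_empty
    refine Set.eq_empty_iff_forall_notMem.2 fun ω hω => hx ?_
    obtain ⟨h1, -⟩ := exists_deviation_of_notMem_confR hδ hω
    rw [visits, Nat.one_le_iff_ne_zero, Finset.card_ne_zero] at h1
    obtain ⟨i, hi⟩ := h1
    rw [Finset.mem_filter, Finset.mem_Ico] at hi
    rw [Finset.mem_image]
    exact ⟨i, Finset.mem_range.2 hi.1.2, congrArg Prod.snd hi.2.1⟩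

/-- Union bound over the number of visits and the `2 ^ S` subsets of states. The halved radius gives
the exponent `2 n · 14 S N Λ / (4 n) = 7 S N Λ`. -/
lemma measureReal_notMem_confP_le [Nonempty S] [Nonempty A] (hδ : δ ∈ Set.Ioo (0 : ℝ) 1) (t : ℕ)
    (x : S × ZMod N) (b : A) :
    μ.real {ω | M.p x.2 x.1 b ∉ confP δ (fun i => s i ω)
      (action (fun i => s i ω) (fun i => π i ω)) t x b} ≤
      2 ^ Fintype.card S * t *
        (δ / (2 * Fintype.card A * (t + 1))) ^ (7 * Fintype.card S * N) := by
  set Λ := Real.log (2 * Fintype.card A * (t + 1) / δ) with hΛ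
  have h4 : (1 : ℝ) ≤ Fintype.card A := by exact_mod_cast Fintype.card_pos
  have hΛ0 : 0 ≤ Λ := by
    have := log_two_le_log hδ h4
      (by linarith [Nat.cast_nonneg (α := ℝ) t] : (1 : ℝ) ≤ t + 1)
    linarith
  have hsub : {ω | M.p x.2 x.1 b ∉ confP δ (fun i => s i ω)
      (action (fun i => s i ω) (fun i => π i ω)) t x b} ⊆
      ⋃ c ∈ (Finset.Icc 1 t) ×ˢ (Finset.univ : Finset (Finset S)),
        {ω | ∑ i ∈ range t, (if (s i ω, (i : ZMod N)) = x ∧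
            action (fun i => s i ω) (fun i => π i ω) i = b then (1 : ℝ) else 0) = (c.1 : ℕ) ∧
          (c.1 : ℕ) * (√(14 * Fintype.card S * N * Λ / c.1) / 2) ≤
            ∑ i ∈ range t, (if (s i ω, (i : ZMod N)) = x ∧
            action (fun i => s i ω) (fun i => π i ω) i = b then (1 : ℝ) else 0) *
            ((if s (i + 1) ω ∈ c.2 then 1 else 0) - ∑ y ∈ c.2,
              M.p (i : ZMod N) (s i ω) (action (fun i => s i ω) (fun i => π i ω) i) y)} := by
    intro ω hω
    obtain ⟨h1, B, h2⟩ := exists_deviation_of_notMem_confP hδ hω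
    exact Set.mem_biUnion (x := (_, B)) (Finset.mem_coe.2 (Finset.mem_product.2
      ⟨Finset.mem_Icc.2 ⟨h1, visits_le _ _ _ _ _⟩, Finset.mem_univ _⟩))
      ⟨sum_visit _ _ _ _ _, h2⟩
  refine (measureReal_mono hsub (measure_ne_top _ _)).trans ((measureReal_biUnion_finset_le _ _).trans ?_)
  calc _ ≤ ∑ c ∈ (Finset.Icc 1 t) ×ˢ (Finset.univ : Finset (Finset S)),
        (δ / (2 * Fintype.card A * (t + 1))) ^ (7 * Fintype.card S * N) := by
        refine Finset.sum_le_sum fun c hc => ?_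
        have h1 := (h.selection_transition x b c.2).measureReal_le t c.1
          (div_nonneg (Real.sqrt_nonneg (14 * Fintype.card S * N * Λ / c.1)) zero_le_two)
        have hn0 : (0 : ℝ) < c.1 := by
          have := (Finset.mem_Icc.1 (Finset.mem_product.1 hc).1).1
          positivity
        refine h1.trans_eq ?_
        rw [div_pow, Real.sq_sqrt (by positivity)]
        rw [show 2 * (c.1 : ℝ) * (14 * Fintype.card S * N * Λ / c.1 / 2 ^ 2) =
          (7 * Fintype.card S * N : ℕ) * Λ by push_cast; field_simp; ring]
        rw [hΛ, exp_neg_mul_log (by have := hδ.1; positivity), inv_div]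
    _ = _ := by
        rw [Finset.sum_const, Finset.card_product, Nat.card_Icc, nsmul_eq_mul, Nat.add_sub_cancel,
          Finset.card_univ, Fintype.card_finset]
        push_cast
        ring

lemma measureReal_exists_notMem_confR_le [Nonempty S] [Nonempty A]
    (hδ : δ ∈ Set.Ioo (0 : ℝ) 1) {t : ℕ} (ht : 1 ≤ t) :
    μ.real {ω | ∃ x b, M.r x.2 x.1 b ∉ confR δ (fun i => s i ω)
      (action (fun i => s i ω) (fun i => π i ω)) (fun i => r i ω) t x b} ≤
      δ / (8 * (t + 1) ^ 2) := by
  have hsub : {ω | ∃ x b, M.r x.2 x.1 b ∉ confR δ (fun i => s i ω)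
      (action (fun i => s i ω) (fun i => π i ω)) (fun i => r i ω) t x b} =
      ⋃ c ∈ (Finset.univ : Finset ((S × ZMod N) × A)), {ω | M.r c.1.2 c.1.1 c.2 ∉ confR δ
      (fun i => s i ω) (action (fun i => s i ω) (fun i => π i ω)) (fun i => r i ω) t c.1 c.2} := by
    ext ω
    simp
  rw [hsub]
  refine (measureReal_biUnion_finset_le _ _).trans ((Finset.sum_le_sum fun c _ =>
    h.measureReal_notMem_confR_le hδ t c.1 c.2).trans ?_)
  set y := δ / (2 * Fintype.card S * Fintype.card A * (t + 1)) with hy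
  have h1 : (1 : ℝ) ≤ Fintype.card S := by exact_mod_cast Fintype.card_pos
  have h2 : (1 : ℝ) ≤ Fintype.card A := by exact_mod_cast Fintype.card_pos
  have hy0 : 0 ≤ y := by have := hδ.1; positivity
  have ht0 : (0 : ℝ) < t + 1 := by positivity
  have hyT : y ≤ 1 / (2 * (t + 1)) := by
    refine div_le_div₀ zero_le_one hδ.2.le (by positivity) ?_
    have := one_le_mul_of_one_le_of_one_le h1 h2
    nlinarith
  -- At most `t` period indices have occurred, so the union over indices costs `t` instead of `N`,
  -- and powers of `y` absorb it.
  have hcard : #((range t).image fun i : ℕ => (i : ZMod N)) ≤ t :=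
    Finset.card_image_le.trans_eq (Finset.card_range t)
  have e1 : ∑ c : (S × ZMod N) × A, (if c.1.2 ∈ (range t).image (fun i : ℕ => (i : ZMod N)) then
        2 * (t : ℝ) * y ^ 7 else 0) = Fintype.card S * (#((range t).image
        fun i : ℕ => (i : ZMod N)) * (Fintype.card A * (2 * t * y ^ 7))) := by
    have e3 (n : ZMod N) : ∑ _b : A, (if n ∈ (range t).image (fun i : ℕ => (i : ZMod N)) then
        2 * (t : ℝ) * y ^ 7 else 0) = if n ∈ (range t).image (fun i : ℕ => (i : ZMod N)) then
        Fintype.card A * (2 * (t : ℝ) * y ^ 7) else 0 := by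
      split_ifs <;> simp
    rw [Fintype.sum_prod_type, Fintype.sum_prod_type]
    refine (Finset.sum_congr rfl fun x _ => Finset.sum_congr rfl fun n _ => e3 n).trans ?_
    rw [Finset.sum_const, Finset.card_univ, nsmul_eq_mul, Finset.sum_ite_mem, Finset.univ_inter,
      Finset.sum_const, nsmul_eq_mul]
  rw [e1]
  have e2 : Fintype.card S * (t * (Fintype.card A * (2 * t * y ^ 7))) =
      δ * (t ^ 2 / (t + 1)) * y ^ 6 := by
    have : 2 * Fintype.card S * Fintype.card A * (t + 1) * y = δ := by
      rw [hy]; field_simp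
    rw [← this]
    field_simp
  have ht1 : (1 : ℝ) ≤ t := by exact_mod_cast ht
  calc _ ≤ (Fintype.card S : ℝ) * (t * (Fintype.card A * (2 * t * y ^ 7))) := by
        gcongr
    _ = δ * (t ^ 2 / (t + 1)) * y ^ 6 := e2
    _ ≤ δ * (t + 1) * (1 / (2 * (t + 1))) ^ 6 := by
        have : (t : ℝ) ^ 2 / (t + 1) ≤ t + 1 := by
          rw [div_le_iff₀ ht0]; nlinarith
        have := hδ.1
        gcongr
    _ = δ / (64 * (t + 1) ^ 5) := by field_simp; norm_num
    _ ≤ δ / (8 * (t + 1) ^ 2) := by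
        refine div_le_div_of_nonneg_left hδ.1.le (by positivity) ?_
        have : ((t : ℝ) + 1) ^ 2 ≤ (t + 1) ^ 5 := pow_le_pow_right₀ (by linarith) (by norm_num)
        nlinarith [sq_nonneg ((t : ℝ) + 1)]

lemma measureReal_exists_notMem_confP_le [Nonempty S] [Nonempty A]
    (hδ : δ ∈ Set.Ioo (0 : ℝ) 1) {t : ℕ} (ht : 1 ≤ t) :
    μ.real {ω | ∃ x b, M.p x.2 x.1 b ∉ confP δ (fun i => s i ω)
      (action (fun i => s i ω) (fun i => π i ω)) t x b} ≤ δ / (8 * (t + 1) ^ 2) := by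
  have hsub : {ω | ∃ x b, M.p x.2 x.1 b ∉ confP δ (fun i => s i ω)
      (action (fun i => s i ω) (fun i => π i ω)) t x b} =
      ⋃ c ∈ (Finset.univ : Finset ((S × ZMod N) × A)), {ω | M.p c.1.2 c.1.1 c.2 ∉ confP δ
      (fun i => s i ω) (action (fun i => s i ω) (fun i => π i ω)) t c.1 c.2} := by
    ext ω
    simp
  rw [hsub]
  refine (measureReal_biUnion_finset_le _ _).trans ((Finset.sum_le_sum fun c _ =>
    h.measureReal_notMem_confP_le hδ t c.1 c.2).trans ?_)
  set y := δ / (2 * Fintype.card A * (t + 1)) with hy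
  have h2 : (1 : ℝ) ≤ Fintype.card A := by exact_mod_cast Fintype.card_pos
  have hy0 : 0 ≤ y := by have := hδ.1; positivity
  have ht0 : (0 : ℝ) < t + 1 := by positivity
  have hyT : y ≤ 1 / (2 * (t + 1)) := by
    refine div_le_div₀ zero_le_one hδ.2.le (by positivity) ?_
    nlinarith
  have ht1 : (1 : ℝ) ≤ t := by exact_mod_cast ht
  have hy2 : y ≤ 1 / 2 := by
    refine hyT.trans (div_le_div_of_nonneg_left zero_le_one two_pos (by linarith))
  rw [Finset.sum_const, Finset.card_univ, nsmul_eq_mul, Fintype.card_prod, Fintype.card_prod,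
    ZMod.card]
  -- Of the `7 (k + 1)` factors `y`, one cancels `A t` and two supply `1 / (t + 1) ^ 2`. The others
  -- are at most `1 / 2` each and outweigh `S N · 2 ^ S ≤ 4 ^ (k + 1)`.
  obtain ⟨k, hk⟩ : ∃ k, Fintype.card S * N = k + 1 :=
    Nat.exists_eq_succ_of_ne_zero (mul_ne_zero Fintype.card_ne_zero (NeZero.ne N))
  have hS : Fintype.card S ≤ k + 1 := by
    rw [← hk]; exact Nat.le_mul_of_pos_right _ (NeZero.pos N)
  have e0 : 7 * Fintype.card S * N = 7 * k + 4 + 2 + 1 := by rw [mul_assoc, hk]; ring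
  have e1 : (2 : ℝ) ^ Fintype.card S ≤ 2 ^ (k + 1) := pow_le_pow_right₀ one_le_two hS
  have e2 : ((k + 1 : ℕ) : ℝ) ≤ 2 ^ (k + 1) := by
    exact_mod_cast (Nat.lt_two_pow_self (n := k + 1)).le
  have e3 : 2 * Fintype.card A * t * y ≤ δ := by
    rw [hy, mul_div_assoc', div_le_iff₀ (by positivity)]
    have := hδ.1
    have : (Fintype.card A : ℝ) * δ * t ≤ Fintype.card A * δ * (t + 1) := by
      gcongr; linarith
    nlinarith
  rw [e0, hk, pow_succ, pow_add _ (7 * k + 4) 2]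
  calc ((k + 1 : ℕ) * Fintype.card A : ℕ) * ((2 : ℝ) ^ Fintype.card S * t *
        (y ^ (7 * k + 4) * y ^ 2 * y))
      = ((k + 1 : ℕ) : ℝ) * 2 ^ Fintype.card S * y ^ (7 * k + 4) *
          (2 * Fintype.card A * t * y) / 2 * y ^ 2 := by push_cast; ring
    _ ≤ (2 ^ (k + 1)) * 2 ^ (k + 1) * (1 / 2) ^ (7 * k + 4) * δ / 2 *
          (1 / (2 * (t + 1))) ^ 2 := by
        have := hδ.1
        gcongr
    _ = (2 ^ (k + 1) * 2 ^ (k + 1) * (1 / 2) ^ (2 * k + 2)) * (1 / 2) ^ (5 * k + 2) *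
          (δ / (8 * (t + 1) ^ 2)) := by
        rw [show 7 * k + 4 = (2 * k + 2) + (5 * k + 2) by ring, pow_add (1 / 2 : ℝ)]
        generalize (1 / 2 : ℝ) ^ (2 * k + 2) = p
        generalize (1 / 2 : ℝ) ^ (5 * k + 2) = q
        generalize (2 : ℝ) ^ (k + 1) = v
        field_simp
        norm_num
    _ = (1 / 2) ^ (5 * k + 2) * (δ / (8 * (t + 1) ^ 2)) := by
        rw [← pow_add, show k + 1 + (k + 1) = 2 * k + 2 by ring, ← mul_pow]
        norm_num
    _ ≤ δ / (8 * (t + 1) ^ 2) := by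
        refine mul_le_of_le_one_left (by have := hδ.1; positivity) ?_
        exact pow_le_one₀ (by norm_num) (by norm_num)

end IsProcess

end PUCRL2

/-! ### Regret on the event that all confidence sets are correct -/

namespace PUCRL2

variable {S A : Type*} [Fintype S] [Fintype A] [DecidableEq S] [DecidableEq A]
  {N : ℕ} [NeZero N]

/-- All the confidence sets contain the true reward and transition functions. -/
def AllPlausible (M : PeriodicMDP S A N) (δ : ℝ) (s : ℕ → S) (a : ℕ → A) (r : ℕ → ℝ) : Prop :=
  ∀ t, 1 ≤ t → (∀ x b, M.r x.2 x.1 b ∈ confR δ s a r t x b) ∧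
    ∀ x b, M.p x.2 x.1 b ∈ confP δ s a t x b

section Regret

variable {M : PeriodicMDP S A N} {s : ℕ → S} {π : ℕ → S × ZMod N → A} {δ τ : ℝ}
  {xstar : S × ZMod N} {r : ℕ → ℝ}

lemma AllPlausible.plausible [Nonempty S] [Nonempty A] (hδ : δ ∈ Set.Ioo (0 : ℝ) 1) {a : ℕ → A}
    (h : AllPlausible M δ s a r) (t : ℕ) : Plausible M (confR δ s a r t) (confP δ s a t) where
  r_subset _ _ _ hv := hv.1
  p_nonneg _ _ _ hq := hq.1
  p_sum _ _ _ hq := hq.2.1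
  r_mem x b := by
    rcases Nat.eq_zero_or_pos t with rfl | ht
    · by_contra hcon
      have := (exists_deviation_of_notMem_confR hδ hcon).1
      simp [visits] at this
    · exact (h t ht).1 x b
  p_mem x b := by
    rcases Nat.eq_zero_or_pos t with rfl | ht
    · by_contra hcon
      have := (exists_deviation_of_notMem_confP hδ hcon).1
      simp [visits] at this
    · exact (h t ht).2 x b

/-- Once `T` is at least `2 S A`, the logarithms in the radii cost only a factor `2` relative to
`log (T / δ)`, because `c t / δ ≤ (T / δ) ^ 2`. -/
lemma log_le_two_mul {c T t δ : ℝ} (hδ : δ ∈ Set.Ioo (0 : ℝ) 1) (hc : 0 < c) (hcT : c ≤ T)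
    (ht : 0 < t) (htT : t ≤ T) : Real.log (c * t / δ) ≤ 2 * Real.log (T / δ) := by
  have hδ0 := hδ.1
  have hT : 0 < T := hc.trans_le hcT
  have h2 : 2 * Real.log (T / δ) = Real.log ((T / δ) ^ 2) := by
    rw [Real.log_pow]; norm_num
  rw [h2]
  refine Real.log_le_log (by positivity) ?_
  rw [div_pow, div_le_div_iff₀ hδ0 (by positivity)]
  have h3 : c * t ≤ T * T := mul_le_mul hcT htT ht.le hT.le
  calc c * t * δ ^ 2 ≤ T * T * δ ^ 2 := mul_le_mul_of_nonneg_right h3 (by positivity)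
    _ = T ^ 2 * δ * δ := by ring
    _ ≤ T ^ 2 * δ * 1 := mul_le_mul_of_nonneg_left hδ.2.le (by positivity)
    _ = T ^ 2 * δ := mul_one _

lemma visitCount_le (s : ℕ → S) (a : ℕ → A) (t : ℕ) (x : S × ZMod N) (b : A) :
    visitCount s a t x b ≤ t + 1 :=
  max_le (by omega) ((visits_le s a t x b).trans (Nat.le_succ t))

lemma optGain_le_of_allPlausible [Nonempty S] [Nonempty A] (hδ : δ ∈ Set.Ioo (0 : ℝ) 1)
    (hτ : τ ∈ Set.Ioo (0 : ℝ) 1) (hD : M.augDiameter ≠ ⊤) (hrun : IsRun δ τ xstar s π r)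
    (hp : AllPlausible M δ s (action s π) r) {T t : ℕ} (htT : t < T)
    (hT : 2 * Fintype.card S * Fintype.card A ≤ T) {c : ℝ}
    (hc0 : 0 ≤ c) (hc : Nontrivial S → c = √(28 * (Fintype.card S * N) * Real.log (T / δ)))
    {d : ℝ} (hd : d = M.augDiameter.toReal + (N - 1)) :
    M.aug.optGain ≤ (1 + 2 * √(7 * Real.log (T / δ)) + c * d) *
        (1 / √(visitCount s (action s π) (phaseStart s π t)
          (s t, (t : ZMod N)) (action s π t) : ℝ)) +
      M.r (t : ZMod N) (s t) (action s π t) +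
      (∑ y, bias d δ τ xstar s (action s π) r (phaseStart s π t) (y, ((t + 1 : ℕ) : ZMod N)) *
        M.p (t : ZMod N) (s t) (action s π t) y) -
      bias d δ τ xstar s (action s π) r (phaseStart s π t) (s t, (t : ZMod N)) := by
  set k := phaseStart s π t with hk
  have hkt : k ≤ t := phaseStart_le s π t
  have pl := hp.plausible hδ k
  obtain ⟨i, hi, hmin, hgreedy⟩ := hrun.plan k (phaseStart_phaseStart s π t)
  rw [hrun.policy_phaseStart t] at hgreedy
  -- The iteration chosen in `bias` is the one at which the run stopped.
  have hinf : sInf {i | EviStops (confR δ s (action s π) r k) (confP δ s (action s π) k) τ xstar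
      (1 / √((k : ℝ) + 1)) i} = i := by
    refine le_antisymm (Nat.sInf_le hi) ?_
    by_contra hlt
    have hmem := Nat.sInf_mem (s := {i | EviStops (confR δ s (action s π) r k)
      (confP δ s (action s π) k) τ xstar (1 / √((k : ℝ) + 1)) i}) ⟨i, hi⟩
    exact hmin _ (not_le.1 hlt) hmem
  set u := evi (confR δ s (action s π) r k) (confP δ s (action s π) k) τ xstar i with hu
  -- On this event the span bound makes the truncation in `bias` inactive.
  have hw (x : S × ZMod N) : bias d δ τ xstar s (action s π) r k x = τ * (u x - ⨅ y, u y) := by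
    have h1 := pl.mul_evi_sub_iInf_mem hτ hD xstar i x
    rw [← hu, ← hd] at h1
    simp only [bias, hinf, ← hu]
    rw [min_eq_right h1.2, max_eq_right h1.1]
  have hd0 : 0 ≤ d := by
    have h1 := pl.mul_evi_sub_iInf_mem hτ hD xstar i xstar
    rw [hd]
    exact h1.1.trans h1.2
  set x : S × ZMod N := (s t, (t : ZMod N)) with hx
  set L := Real.log (T / δ) with hL
  set n : ℝ := ((visitCount s (action s π) k x (action s π t) : ℕ) : ℝ) with hn
  have hn1 : 1 ≤ n := by
    rw [hn]
    exact_mod_cast le_max_left _ _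
  have hn0 : 0 < n := zero_lt_one.trans_le hn1
  have hsn : 0 < √n := Real.sqrt_pos.2 hn0
  have hS1 : (1 : ℝ) ≤ Fintype.card S := by exact_mod_cast Fintype.card_pos
  have hA1 : (1 : ℝ) ≤ Fintype.card A := by exact_mod_cast Fintype.card_pos
  have hT' : 2 * Fintype.card S * Fintype.card A ≤ (T : ℝ) := by exact_mod_cast hT
  have hkT : (k : ℝ) + 1 ≤ T := by exact_mod_cast (by omega : k + 1 ≤ T)
  have hL1 : Real.log (2 * Fintype.card S * Fintype.card A * (k + 1) / δ) ≤ 2 * L :=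
    log_le_two_mul hδ (by positivity) hT' (by positivity) hkT
  have hL2 : Real.log (2 * Fintype.card A * (k + 1) / δ) ≤ 2 * L := by
    refine log_le_two_mul hδ (by positivity) (le_trans ?_ hT') (by positivity) hkT
    nlinarith
  have hL0 : 0 ≤ L := by
    have := log_two_le_log hδ (one_le_mul_of_one_le_of_one_le hS1 hA1)
        (by linarith [Nat.cast_nonneg (α := ℝ) k] : (1 : ℝ) ≤ k + 1)
    rw [← mul_assoc] at this
    linarith
  have hact : action s π t = π t x := rfl
  have hB : ∀ q ∈ confP δ s (action s π) k x (π t x),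
      ∑ y, |q y - M.p x.2 x.1 (π t x) y| ≤ 2 * (c * (1 / √n)) := by
    intro q hq
    -- With a single state there is only one probability vector, so any `c ≥ 0` works, in particular
    -- `c = 0`.
    rcases subsingleton_or_nontrivial S with hS | hS
    · have h1 (y : S) : q y - M.p x.2 x.1 (π t x) y = 0 := by
        have := hq.2.1
        rw [Fintype.sum_subsingleton _ y] at this
        have h2 := M.p_sum x.2 x.1 (π t x)
        rw [Fintype.sum_subsingleton _ y] at h2
        rw [this, h2, sub_self]
      simp only [h1, abs_zero, Finset.sum_const_zero]
      positivity
    · have h1 := hq.2.2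
      have h2 := (pl.p_mem x (π t x)).2.2
      rw [← hact] at h1 h2 ⊢
      have h3 : √(14 * Fintype.card S * N * Real.log (2 * Fintype.card A * (k + 1) / δ) / n) ≤
          c * (1 / √n) := by
        rw [hc hS, mul_one_div, ← Real.sqrt_div' _ hn0.le]
        refine Real.sqrt_le_sqrt (div_le_div_of_nonneg_right ?_ hn0.le)
        calc 14 * Fintype.card S * N * Real.log (2 * Fintype.card A * (k + 1) / δ)
            ≤ 14 * Fintype.card S * N * (2 * L) := mul_le_mul_of_nonneg_left hL2 (by positivity)
          _ = _ := by ring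
      have h4 : ∑ y, |q y - M.p x.2 x.1 (action s π t) y| ≤
          ∑ y, |q y - pHat s (action s π) k x (action s π t) y| +
          ∑ y, |M.p x.2 x.1 (action s π t) y - pHat s (action s π) k x (action s π t) y| := by
        rw [← Finset.sum_add_distrib]
        refine Finset.sum_le_sum fun y _ => ?_
        rw [abs_sub_comm (M.p x.2 x.1 (action s π t) y)]
        exact abs_sub_le _ _ _
      linarith
  have main := pl.optGain_sub_le_of_greedy hτ hD hi hgreedy hw x hB
  have hR : sSup (confR δ s (action s π) r k x (π t x)) ≤
      M.r x.2 x.1 (π t x) + 2 * √(7 * L) * (1 / √n) := by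
    refine csSup_le ⟨_, pl.r_mem x (π t x)⟩ fun v hv => ?_
    have h1 := hv.2
    have h2 := (pl.r_mem x (π t x)).2
    rw [← hact] at h1 h2 ⊢
    have h3 : √(7 * Real.log (2 * Fintype.card S * Fintype.card A * (k + 1) / δ) / (2 * n)) ≤
        √(7 * L) * (1 / √n) := by
      rw [mul_one_div, ← Real.sqrt_div' _ hn0.le]
      refine Real.sqrt_le_sqrt ?_
      rw [div_le_div_iff₀ (by positivity) hn0]
      nlinarith
    have h4 := abs_le.1 h1
    have h5 := abs_le.1 h2
    linarith [h4.2, h5.1]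
  -- A pair has at most `k + 1` counted visits, so the accuracy of value iteration is absorbed into
  -- the width term.
  have hε : 1 / √((k : ℝ) + 1) ≤ 1 / √n := by
    refine one_div_le_one_div_of_le hsn (Real.sqrt_le_sqrt ?_)
    rw [hn]
    exact_mod_cast visitCount_le s (action s π) k x (action s π t)
  rw [← hd] at main
  have hcast : x.2 + 1 = ((t + 1 : ℕ) : ZMod N) := by rw [hx]; push_cast; rfl
  rw [hcast] at main
  have hb : d / 2 * (2 * (c * (1 / √n))) = c * d * (1 / √n) := by ring
  rw [hb] at main
  rw [hact]
  change M.aug.optGain ≤ _ + M.r x.2 x.1 (π t x) + (∑ y, _ * M.p x.2 x.1 (π t x) y) - _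
  have hexp : (1 + 2 * √(7 * L) + c * d) * (1 / √n) =
      1 / √n + 2 * √(7 * L) * (1 / √n) + c * d * (1 / √n) := by ring
  rw [hexp]
  linarith

/-- Within a phase the value function is fixed and the sum telescopes. Every change of phase, and
the two endpoints together, cost at most `d`. -/
lemma sum_bias_sub_le (hrun : IsRun δ τ xstar s π r) {d : ℝ} (hd : 0 ≤ d) (T : ℕ) :
    ∑ t ∈ range T, (bias d δ τ xstar s (action s π) r (phaseStart s π t)
          (s (t + 1), ((t + 1 : ℕ) : ZMod N)) -
        bias d δ τ xstar s (action s π) r (phaseStart s π t) (s t, (t : ZMod N))) ≤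
      d * (1 + Fintype.card S * N * Fintype.card A * Nat.size T) := by
  set w : ℕ → S × ZMod N → ℝ := fun t => bias d δ τ xstar s (action s π) r (phaseStart s π t)
    with hw
  have hmem (t x) : w t x ∈ Set.Icc 0 d := bias_mem hd _ _ _ _ _ _ _ _
  have e1 (t : ℕ) : w t (s (t + 1), ((t + 1 : ℕ) : ZMod N)) - w t (s t, (t : ZMod N)) ≤
      (w (t + 1) (s (t + 1), ((t + 1 : ℕ) : ZMod N)) - w t (s t, (t : ZMod N))) +
        d * (if phaseStart s π (t + 1) = t + 1 then 1 else 0) := by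
    split_ifs with ht
    · have h1 := hmem t (s (t + 1), ((t + 1 : ℕ) : ZMod N))
      have h2 := hmem (t + 1) (s (t + 1), ((t + 1 : ℕ) : ZMod N))
      linarith [h1.2, h2.1]
    · have h3 : w (t + 1) = w t := by
        simp only [hw, (phaseStart_succ_eq_or s π t).resolve_right ht]
      rw [h3]
      simp
  refine (Finset.sum_le_sum fun t _ => e1 t).trans ?_
  rw [Finset.sum_add_distrib, Finset.sum_range_sub (fun t => w t (s t, (t : ZMod N))),
    ← Finset.mul_sum, ← Finset.sum_filter, Finset.sum_const, nsmul_eq_mul, mul_one]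
  have h1 := hmem T (s T, (T : ZMod N))
  have h2 := hmem 0 (s 0, ((0 : ℕ) : ZMod N))
  have h3 : (#{t ∈ range T | phaseStart s π (t + 1) = t + 1} : ℝ) ≤
      Fintype.card S * N * Fintype.card A * Nat.size T := by
    exact_mod_cast hrun.card_phaseStart_le T
  have h4 := mul_le_mul_of_nonneg_left h3 hd
  linarith [h1.2, h2.1]

lemma regret_le_of_allPlausible [Nonempty S] [Nonempty A] (hδ : δ ∈ Set.Ioo (0 : ℝ) 1)
    (hτ : τ ∈ Set.Ioo (0 : ℝ) 1) (hD : M.augDiameter ≠ ⊤) (hrun : IsRun δ τ xstar s π r)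
    (hp : AllPlausible M δ s (action s π) r) {T : ℕ}
    (hT : 2 * Fintype.card S * Fintype.card A ≤ T) {c : ℝ}
    (hc0 : 0 ≤ c) (hc : Nontrivial S → c = √(28 * (Fintype.card S * N) * Real.log (T / δ)))
    {d : ℝ} (hd0 : 0 ≤ d) (hd : d = M.augDiameter.toReal + (N - 1)) :
    regret M r T ≤ (1 + 2 * √(7 * Real.log (T / δ)) + c * d) *
        ((√2 + 1) * √(Fintype.card S * N * Fintype.card A * T : ℝ)) +
      (1 + d) * (∑ t ∈ range T, (((1 - r t) + (d - bias d δ τ xstar s (action s π) r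
        (phaseStart s π t) (s (t + 1), ((t + 1 : ℕ) : ZMod N)))) / (1 + d) -
        ((1 - M.r (t : ZMod N) (s t) (action s π t)) +
      (d - ∑ y, bias d δ τ xstar s (action s π) r
      (phaseStart s π t) (y, ((t + 1 : ℕ) : ZMod N)) *
      M.p (t : ZMod N) (s t) (action s π t) y)) / (1 + d))) +
      d * (1 + Fintype.card S * N * Fintype.card A * Nat.size T) := by
  have h1 := hrun.sum_inv_sqrt_visitCount_le T
  have h2 := sum_bias_sub_le hrun hd0 T
  have h3 : 0 ≤ 1 + 2 * √(7 * Real.log (T / δ)) + c * d := by positivity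
  have h4 := mul_le_mul_of_nonneg_left h1 h3
  refine le_trans ?_ (add_le_add (add_le_add h4 le_rfl) h2)
  rw [regret, Finset.mul_sum, Finset.mul_sum, ← Finset.sum_add_distrib, ← Finset.sum_add_distrib]
  refine Finset.sum_le_sum fun t ht => ?_
  have h5 := optGain_le_of_allPlausible hδ hτ hD hrun hp (Finset.mem_range.1 ht) hT hc0 hc hd
  have hd1 : 1 + d ≠ 0 := by positivity
  rw [← sub_div, mul_div_cancel₀ _ hd1]
  linarith

end Regret

end PUCRL2

/-! ### Numerical estimates for the constant `34` -/

section Numerics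

/-- The binary length is at most `1 + L / log 2`, and `L ≥ 7` absorbs the `1`. -/
lemma natSize_le {T : ℕ} {L : ℝ} (hT : 1 ≤ T) (hL : Real.log T ≤ L) (hL7 : 7 ≤ L) :
    (Nat.size T : ℝ) ≤ 1.6 * L := by
  have h0 : 0 < Nat.size T := Nat.size_pos.2 hT
  have h1 : 2 ^ (Nat.size T - 1) ≤ T := by
    rw [← Nat.lt_size]
    omega
  have h2 : ((2 : ℝ) ^ (Nat.size T - 1)) ≤ T := by exact_mod_cast h1
  have h3 := Real.log_le_log (by positivity) h2
  rw [Real.log_pow, Nat.cast_sub h0, Nat.cast_one] at h3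
  have h4 := Real.log_two_gt_d9
  have h5 : (0 : ℝ) ≤ (Nat.size T : ℝ) - 1 := by
    have : (1 : ℝ) ≤ Nat.size T := by exact_mod_cast h0
    linarith
  nlinarith

/-- The phase term is logarithmic in `T`. The lower bound on `T` makes `√(A T L)` exceed `A L` by
the factor `34 D X`. -/
lemma phase_term_le {X A T L D d m : ℝ} (hX : 2 ≤ X) (hA : 1 ≤ A) (hL : 7 ≤ L)
    (hD : 1 ≤ D) (hd0 : 0 ≤ d) (hd : d ≤ 2 * D) (hT : (34 * D * X) ^ 2 * (A * L) ≤ T)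
    (hm : m ≤ 1.6 * L) : d * (1 + X * A * m) ≤ 0.1 * (D * X * √(A * T * L)) := by
  set Q := √(A * T * L) with hQ
  have hQ0 : 0 ≤ Q := Real.sqrt_nonneg _
  have hXA : 1 ≤ X * A := one_le_mul_of_one_le_of_one_le (by linarith) hA
  have h1 : 34 * D * X * (A * L) ≤ Q := by
    refine Real.le_sqrt_of_sq_le ?_
    calc (34 * D * X * (A * L)) ^ 2 = (34 * D * X) ^ 2 * (A * L) * (A * L) := by ring
      _ ≤ T * (A * L) := mul_le_mul_of_nonneg_right hT (by positivity)
      _ = A * T * L := by ring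
  have h3 : 1 + X * A * m ≤ 1.75 * (X * A * L) := by
    have h5 := mul_le_mul_of_nonneg_left hm (by positivity : 0 ≤ X * A)
    have h6 : 1 * 7 ≤ X * A * L := mul_le_mul hXA hL (by norm_num) (by positivity)
    linarith
  have h5 : 2 ≤ D * X := by
    calc (2 : ℝ) ≤ 1 * X := by linarith
      _ ≤ D * X := mul_le_mul_of_nonneg_right hD (by linarith)
  have h6 : 2 * Q ≤ D * X * Q := mul_le_mul_of_nonneg_right h5 hQ0
  calc d * (1 + X * A * m) ≤ 2 * D * (1.75 * (X * A * L)) :=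
        (mul_le_mul_of_nonneg_left h3 hd0).trans (mul_le_mul_of_nonneg_right hd (by positivity))
    _ = 3.5 / 34 * (34 * D * X * (A * L)) := by ring
    _ ≤ 3.5 / 34 * Q := mul_le_mul_of_nonneg_left h1 (by norm_num)
    _ ≤ 0.1 * (2 * Q) := by linarith
    _ ≤ 0.1 * (D * X * Q) := mul_le_mul_of_nonneg_left h6 (by norm_num)

lemma martingale_term_le {A T L D d : ℝ} (hA : 1 ≤ A) (hL : 0 ≤ L) (hT : 0 ≤ T)
    (hD : 1 ≤ D) (hd : d ≤ 2 * D) :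
    (1 + d) * √(3 * L * T / 2) ≤ 3.675 * (D * √(A * T * L)) := by
  have h1 : √(3 * L * T / 2) ≤ 1.225 * √(A * T * L) := by
    rw [Real.sqrt_le_left (by positivity), mul_pow, Real.sq_sqrt (by positivity)]
    have h2 := mul_le_mul_of_nonneg_right hA (by positivity : 0 ≤ T * L)
    have h3 : 0 ≤ T * L := by positivity
    calc 3 * L * T / 2 = 1.5 * (T * L) := by ring
      _ ≤ 1.225 ^ 2 * (T * L) := mul_le_mul_of_nonneg_right (by norm_num) h3
      _ ≤ 1.225 ^ 2 * (A * T * L) := mul_le_mul_of_nonneg_left (by linarith) (by norm_num)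
  calc (1 + d) * √(3 * L * T / 2) ≤ 3 * D * (1.225 * √(A * T * L)) :=
        mul_le_mul (by linarith) h1 (Real.sqrt_nonneg _) (by positivity)
    _ = _ := by ring

lemma sqrt_two_add_one_le : √2 + 1 ≤ 2.4143 := by
  have : √2 ≤ 1.4143 := Real.sqrt_le_iff.2 ⟨by norm_num, by norm_num⟩
  linarith

lemma sqrt_mul_sqrt_eq {X A T L : ℝ} (hX : 0 ≤ X) (hA : 0 ≤ A) (hT : 0 ≤ T) :
    √(X * A * T) * √L = √X * √(A * T * L) := by
  rw [← Real.sqrt_mul (by positivity), ← Real.sqrt_mul (by positivity)]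
  congr 1
  ring

lemma reward_term_le {X A T L : ℝ} (hX : 0 ≤ X) (hA : 0 ≤ A) (hT : 0 ≤ T) (hL : 7 ≤ L) :
    (1 + 2 * √(7 * L)) * ((√2 + 1) * √(X * A * T)) ≤ 13.71 * (√X * √(A * T * L)) := by
  have hl2 : 2.6 ≤ √L := Real.le_sqrt_of_sq_le (by norm_num; linarith)
  have h7 : √(7 * L) ≤ 2.6458 * √L := by
    rw [Real.sqrt_mul (by norm_num)]
    exact mul_le_mul_of_nonneg_right (Real.sqrt_le_iff.2 ⟨by norm_num, by norm_num⟩)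
      (Real.sqrt_nonneg _)
  have h1 : 1 + 2 * √(7 * L) ≤ 5.677 * √L := by linarith
  calc (1 + 2 * √(7 * L)) * ((√2 + 1) * √(X * A * T))
      ≤ 5.677 * √L * (2.4143 * √(X * A * T)) :=
        mul_le_mul h1 (mul_le_mul_of_nonneg_right sqrt_two_add_one_le (Real.sqrt_nonneg _))
          (by positivity) (by positivity)
    _ = 5.677 * 2.4143 * (√(X * A * T) * √L) := by ring
    _ = 5.677 * 2.4143 * (√X * √(A * T * L)) := by rw [sqrt_mul_sqrt_eq hX hA hT]
    _ ≤ _ := mul_le_mul_of_nonneg_right (by norm_num) (by positivity)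

lemma transition_term_le {X A T L D d : ℝ} (hX : 0 ≤ X) (hA : 0 ≤ A) (hT : 0 ≤ T)
    (hD : 0 ≤ D) (hd0 : 0 ≤ d) (hd : d ≤ 2 * D) :
    √(28 * X * L) * d * ((√2 + 1) * √(X * A * T)) ≤ 25.56 * (D * X * √(A * T * L)) := by
  have h28 : √(28 * X * L) ≤ 5.2916 * (√X * √L) := by
    rw [Real.sqrt_mul (by positivity), Real.sqrt_mul (by norm_num), mul_assoc]
    exact mul_le_mul_of_nonneg_right (Real.sqrt_le_iff.2 ⟨by norm_num, by norm_num⟩)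
      (by positivity)
  calc √(28 * X * L) * d * ((√2 + 1) * √(X * A * T))
      ≤ 5.2916 * (√X * √L) * (2 * D) * (2.4143 * √(X * A * T)) :=
        mul_le_mul (mul_le_mul h28 hd hd0 (by positivity))
          (mul_le_mul_of_nonneg_right sqrt_two_add_one_le (Real.sqrt_nonneg _)) (by positivity)
          (by positivity)
    _ = 5.2916 * 2 * 2.4143 * (D * √X * (√(X * A * T) * √L)) := by ring
    _ = 5.2916 * 2 * 2.4143 * (D * (√X * √X) * √(A * T * L)) := by
        rw [sqrt_mul_sqrt_eq hX hA hT]; ring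
    _ = 5.2916 * 2 * 2.4143 * (D * X * √(A * T * L)) := by rw [Real.mul_self_sqrt hX]
    _ ≤ _ := mul_le_mul_of_nonneg_right (by norm_num) (by positivity)

/-- The sum of all the error terms, when `T` is not too small. -/
lemma regret_bound_numeric {X A T L D d c m : ℝ} (hX : 2 ≤ X) (hA : 1 ≤ A) (hL : 7 ≤ L)
    (hD : 1 ≤ D) (hd0 : 0 ≤ d) (hd : d ≤ 2 * D)
    (hT : (34 * D * X) ^ 2 * (A * L) ≤ T)
    (hm : m ≤ 1.6 * L)
    (hc : c = 0 ∨ (c = √(28 * X * L) ∧ 4 ≤ X ∧ 2 ≤ D)) :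
    (1 + 2 * √(7 * L) + c * d) * ((√2 + 1) * √(X * A * T)) +
      (1 + d) * √(3 * L * T / 2) + d * (1 + X * A * m) ≤ 34 * D * X * √(A * T * L) := by
  have hT0 : 0 ≤ T := le_trans (by positivity) hT
  have hphase := phase_term_le hX hA hL hD hd0 hd hT hm
  have hmart := martingale_term_le (L := L) hA (by linarith) hT0 hD hd
  have hreward := reward_term_le (X := X) (A := A) (by linarith) (by linarith) hT0 hL
  have htrans := transition_term_le (X := X) (A := A) (L := L) (by linarith) (by linarith) hT0
    (by linarith) hd0 hd
  rw [add_mul]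
  generalize (√2 + 1) * √(X * A * T) = y at *
  generalize hQ : √(A * T * L) = Q at *
  have hQ0 : 0 ≤ Q := hQ ▸ Real.sqrt_nonneg _
  have hqq : √X * √X = X := Real.mul_self_sqrt (by linarith)
  have h4 : 0 ≤ D * X * Q := by positivity
  have h3 : D * Q * 2 ≤ D * Q * X := mul_le_mul_of_nonneg_left hX (by positivity)
  -- When `c = 0` the dominant transition term is absent, and `X ≥ 2`, `D ≥ 1` suffice. When it is
  -- present, `X ≥ 4` and `D ≥ 2` are needed to make the reward term, of order `√X`, small enough.
  rcases hc with rfl | ⟨rfl, hX4, hD2⟩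
  · have hq1 : 1.414 ≤ √X := Real.le_sqrt_of_sq_le (by norm_num; linarith)
    have h1 : √X ≤ 0.71 * (D * X) := by
      have h5 : √X * 1.414 ≤ X :=
        (mul_le_mul_of_nonneg_left hq1 (Real.sqrt_nonneg X)).trans_eq hqq
      have h6 : 1 * X ≤ D * X := mul_le_mul_of_nonneg_right hD (by linarith)
      linarith [Real.sqrt_nonneg X]
    have h2 := mul_le_mul_of_nonneg_right h1 hQ0
    linarith
  · have hq1 : 2 ≤ √X := Real.le_sqrt_of_sq_le (by norm_num; linarith)
    have h1 : √X ≤ 0.25 * (D * X) := by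
      have h5 : √X * 2 ≤ X :=
        (mul_le_mul_of_nonneg_left hq1 (Real.sqrt_nonneg X)).trans_eq hqq
      have h6 : 2 * X ≤ D * X := mul_le_mul_of_nonneg_right hD2 (by linarith)
      linarith
    have h2 := mul_le_mul_of_nonneg_right h1 hQ0
    linarith

lemma seven_le_log {x : ℝ} (hx : 1100 ≤ x) : 7 ≤ Real.log x := by
  rw [Real.le_log_iff_exp_le (by linarith)]
  have h1 := Real.exp_one_lt_d9
  have h2 : Real.exp 7 = Real.exp 1 ^ 7 := by rw [← Real.exp_nat_mul]; norm_num
  rw [h2]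
  calc Real.exp 1 ^ 7 ≤ 2.7182818286 ^ 7 := pow_le_pow_left₀ (Real.exp_nonneg _) h1.le 7
    _ ≤ x := by norm_num; linarith

end Numerics

/-! ### Exceptional events and conclusion -/

namespace PUCRL2

variable {S A : Type*} [Fintype S] [Fintype A] [DecidableEq S] [DecidableEq A]
  {N : ℕ} [NeZero N]

namespace IsProcess

variable {M : PeriodicMDP S A N} {δ τ : ℝ} {xstar : S × ZMod N} {Ω : Type*}
  [mΩ : MeasurableSpace Ω] {μ : Measure Ω} [IsProbabilityMeasure μ] {ℱ : Filtration ℕ mΩ}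
  {s : ℕ → Ω → S} {π : ℕ → Ω → S × ZMod N → A} {r : ℕ → Ω → ℝ}
  (h : IsProcess M δ τ xstar μ ℱ s π r)

include h

/-- Off an event of small probability, the fluctuations are small. -/
lemma exists_exceptional_set [Nonempty S] [Nonempty A] (hδ : δ ∈ Set.Ioo (0 : ℝ) 1) {d : ℝ}
    (hd : 0 ≤ d) (t : ℕ) (ht : 1 ≤ t) : ∃ E : Set Ω,
    μ E ≤ ENNReal.ofReal (δ * (1 / t - 1 / (t + 1))) ∧ ∀ ω ∉ E,
      ((∀ x b, M.r x.2 x.1 b ∈ confR δ (fun i => s i ω)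
        (action (fun i => s i ω) (fun i => π i ω)) (fun i => r i ω) t x b) ∧
      (∀ x b, M.p x.2 x.1 b ∈ confP δ (fun i => s i ω)
        (action (fun i => s i ω) (fun i => π i ω)) t x b)) ∧
      ∑ i ∈ range (t + 1), (((1 - r i ω) + (d - bias d δ τ xstar (fun i => s i ω)
        (action (fun i => s i ω) (fun i => π i ω)) (fun i => r i ω)
        (phaseStart (fun i => s i ω) (fun i => π i ω) i)
        (s (i + 1) ω, ((i + 1 : ℕ) : ZMod N)))) / (1 + d) -
      ((1 - M.r (i : ZMod N) (s i ω) (action (fun i => s i ω) (fun i => π i ω) i)) +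
      (d - ∑ y, bias d δ τ xstar (fun i => s i ω)
      (action (fun i => s i ω) (fun i => π i ω)) (fun i => r i ω)
      (phaseStart (fun i => s i ω) (fun i => π i ω) i) (y, ((i + 1 : ℕ) : ZMod N)) *
      M.p (i : ZMod N) (s i ω) (action (fun i => s i ω) (fun i => π i ω) i) y)) / (1 + d)) ≤
        √(3 * Real.log ((t + 1 : ℕ) / δ) * (t + 1 : ℕ) / 2) := by
  have hδ0 := hδ.1
  set L := Real.log ((t + 1 : ℕ) / δ) with hL
  have hT0 : (0 : ℝ) < (t + 1 : ℕ) := by positivity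
  have hT2 : (2 : ℝ) ≤ (t + 1 : ℕ) := by exact_mod_cast (by omega : 2 ≤ t + 1)
  have hL0 : 0 ≤ L := Real.log_nonneg (by rw [le_div_iff₀ hδ0]; linarith [hδ.2])
  set ε := √(3 * L / (2 * (t + 1 : ℕ))) with hε
  have hε0 : 0 ≤ ε := Real.sqrt_nonneg _
  have sel := (h.selection_bias hd).measureReal_le (t + 1) (t + 1) hε0
  have hexp : Real.exp (-(2 * (t + 1 : ℕ) * ε ^ 2)) = (δ / (t + 1 : ℕ)) ^ 3 := by
    rw [hε, Real.sq_sqrt (by positivity)]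
    rw [show 2 * ((t + 1 : ℕ) : ℝ) * (3 * L / (2 * (t + 1 : ℕ))) = (3 : ℕ) * L by
      push_cast; field_simp]
    rw [hL, exp_neg_mul_log (by positivity), inv_div]
  rw [hexp] at sel
  have hTε : (t + 1 : ℕ) * ε = √(3 * L * (t + 1 : ℕ) / 2) := by
    rw [hε]
    nth_rewrite 1 [← Real.sqrt_sq hT0.le]
    rw [← Real.sqrt_mul (by positivity)]
    congr 1
    field_simp
  refine ⟨{ω | ∃ x b, M.r x.2 x.1 b ∉ confR δ (fun i => s i ω)
      (action (fun i => s i ω) (fun i => π i ω)) (fun i => r i ω) t x b} ∪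
    {ω | ∃ x b, M.p x.2 x.1 b ∉ confP δ (fun i => s i ω)
      (action (fun i => s i ω) (fun i => π i ω)) t x b} ∪
    {ω | ∑ i ∈ range (t + 1), (1 : ℝ) = (t + 1 : ℕ) ∧ (t + 1 : ℕ) * ε ≤
      ∑ i ∈ range (t + 1), 1 * (((1 - r i ω) + (d - bias d δ τ xstar (fun i => s i ω)
        (action (fun i => s i ω) (fun i => π i ω)) (fun i => r i ω)
        (phaseStart (fun i => s i ω) (fun i => π i ω) i)
        (s (i + 1) ω, ((i + 1 : ℕ) : ZMod N)))) / (1 + d) -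
      ((1 - M.r (i : ZMod N) (s i ω) (action (fun i => s i ω) (fun i => π i ω) i)) +
      (d - ∑ y, bias d δ τ xstar (fun i => s i ω)
      (action (fun i => s i ω) (fun i => π i ω)) (fun i => r i ω)
      (phaseStart (fun i => s i ω) (fun i => π i ω) i) (y, ((i + 1 : ℕ) : ZMod N)) *
      M.p (i : ZMod N) (s i ω) (action (fun i => s i ω) (fun i => π i ω) i) y)) / (1 + d))},
    ?_, fun ω hω => ⟨⟨fun x b => ?_, fun x b => ?_⟩, ?_⟩⟩
  · rw [← ofReal_measureReal]
    refine ENNReal.ofReal_le_ofReal ?_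
    refine (measureReal_union_le _ _).trans ((add_le_add (measureReal_union_le _ _) le_rfl).trans
      ((add_le_add (add_le_add (h.measureReal_exists_notMem_confR_le hδ ht)
        (h.measureReal_exists_notMem_confP_le hδ ht)) sel).trans ?_))
    push_cast at hT0 hT2 ⊢
    have ht0 : (0 : ℝ) < t := by exact_mod_cast ht
    have h1 : (δ / ((t : ℝ) + 1)) ^ 3 ≤ δ / (2 * (t + 1) ^ 2) := by
      rw [div_pow, div_le_div_iff₀ (by positivity) (by positivity)]
      have h3 : δ ^ 3 ≤ δ := by
        have := pow_le_pow_of_le_one hδ0.le hδ.2.le (by norm_num : 1 ≤ 3)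
        simpa using this
      calc δ ^ 3 * (2 * ((t : ℝ) + 1) ^ 2) ≤ δ * (((t : ℝ) + 1) * ((t : ℝ) + 1) ^ 2) := by
            gcongr
        _ = _ := by ring
    have h2 : δ / (8 * ((t : ℝ) + 1) ^ 2) + δ / (8 * ((t : ℝ) + 1) ^ 2) +
        δ / (2 * ((t : ℝ) + 1) ^ 2) = δ * (3 / 4 / ((t : ℝ) + 1) ^ 2) := by
      field_simp
      norm_num
    -- The three failure probabilities contribute `1/8 + 1/8 + 1/2 = 3/4`, and `1 / (t + 1) ^ 2` is
    -- below the telescoping `1 / (t (t + 1))`.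
    have h3 : 3 / 4 / ((t : ℝ) + 1) ^ 2 ≤ 1 / t - 1 / (t + 1) := by
      rw [div_sub_div _ _ ht0.ne' hT0.ne', div_le_div_iff₀ (by positivity) (by positivity)]
      nlinarith
    have h4 := mul_le_mul_of_nonneg_left h3 hδ0.le
    linarith
  · by_contra hcon
    exact hω (Or.inl (Or.inl ⟨x, b, hcon⟩))
  · by_contra hcon
    exact hω (Or.inl (Or.inr ⟨x, b, hcon⟩))
  · by_contra hcon
    refine hω (Or.inr ⟨by simp, ?_⟩)
    simp only [one_mul]
    rw [hTε]
    exact (not_le.1 hcon).le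

end IsProcess

end PUCRL2

lemma MeasureTheory.ofReal_one_sub_le_measure_of_exceptional {Ω : Type*} [MeasurableSpace Ω]
    {μ : Measure Ω} [IsProbabilityMeasure μ] {δ : ℝ} (hδ : 0 ≤ δ) {E : ℕ → Set Ω} {G : Set Ω}
    (hE : ∀ t, μ (E t) ≤ ENNReal.ofReal (δ * (1 / ((t : ℝ) + 1) - 1 / ((t : ℝ) + 2))))
    (hG : ∀ ω, (∀ t, ω ∉ E t) → ω ∈ G) : ENNReal.ofReal (1 - δ) ≤ μ G := by
  have h1 : μ (⋃ t, E t) ≤ ENNReal.ofReal δ := by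
    refine (measure_iUnion_le _).trans (ENNReal.tsum_le_of_sum_range_le fun n => ?_)
    refine (Finset.sum_le_sum fun t _ => hE t).trans ?_
    rw [← ENNReal.ofReal_sum_of_nonneg]
    · refine ENNReal.ofReal_le_ofReal ?_
      rw [← Finset.mul_sum]
      refine mul_le_of_le_one_right hδ ?_
      have e : ∀ t : ℕ, 1 / ((t : ℝ) + 1) - 1 / ((t : ℝ) + 2) =
          (fun t : ℕ => 1 / ((t : ℝ) + 1)) t - (fun t : ℕ => 1 / ((t : ℝ) + 1)) (t + 1) := by
        intro t
        push_cast
        ring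
      rw [Finset.sum_congr rfl fun t _ => e t, Finset.sum_range_sub']
      simp only [Nat.cast_zero, zero_add, div_one]
      have : (0 : ℝ) ≤ 1 / ((n : ℝ) + 1) := by positivity
      linarith
    · intro t _
      refine mul_nonneg hδ (sub_nonneg.2 (one_div_le_one_div_of_le (by positivity) (by linarith)))
  have h2 : (Set.univ : Set Ω) ⊆ (⋃ t, E t) ∪ G := fun ω _ => by
    by_cases hω : ∃ t, ω ∈ E t
    · exact Or.inl (Set.mem_iUnion.2 hω)
    · exact Or.inr (hG ω (not_exists.1 hω))
  have h3 : 1 ≤ ENNReal.ofReal δ + μ G := by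
    rw [← measure_univ (μ := μ)]
    exact (measure_mono h2).trans ((measure_union_le _ _).trans (add_le_add h1 le_rfl))
  rw [ENNReal.ofReal_sub _ hδ, ENNReal.ofReal_one, tsub_le_iff_left]
  exact h3

namespace PeriodicMDP

lemma regret_le_natCast {S A : Type*} [Fintype S] {N : ℕ} [NeZero N] (M : PeriodicMDP S A N)
    {r : ℕ → ℝ} (hr : ∀ t, 0 ≤ r t) (T : ℕ) : regret M r T ≤ T := by
  calc regret M r T ≤ ∑ _t ∈ range T, (1 : ℝ) :=
        Finset.sum_le_sum fun t _ => by linarith [M.aug.optGain_le_one, hr t]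
    _ = T := by simp

end PeriodicMDP

theorem theorem1 {S A : Type*} [Fintype S] [Fintype A] [DecidableEq S] [DecidableEq A]
    (N : ℕ) [NeZero N] (hN : 2 ≤ N) (M : PeriodicMDP S A N) (hD : M.augDiameter ≠ ⊤)
    (δ τ : ℝ) (hδ : δ ∈ Set.Ioo (0 : ℝ) 1) (hτ : τ ∈ Set.Ioo (0 : ℝ) 1) (xstar : S × ZMod N)
    {Ω : Type*} [mΩ : MeasurableSpace Ω] (μ : Measure Ω) [IsProbabilityMeasure μ]
    (ℱ : Filtration ℕ mΩ) (s : ℕ → Ω → S) (π : ℕ → Ω → S × ZMod N → A) (r : ℕ → Ω → ℝ)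
    (h : PUCRL2.IsProcess M δ τ xstar μ ℱ s π r) :
    ENNReal.ofReal (1 - δ) ≤
      μ {ω | ∀ T : ℕ, 2 ≤ T →
        regret M (fun t => r t ω) T ≤
          34 * M.augDiameter.toReal * Fintype.card S * N *
            √(Fintype.card A * T * Real.log (T / δ))} := by
  obtain ⟨ω₀⟩ := nonempty_of_isProbabilityMeasure μ
  have hS : Nonempty S := ⟨s 0 ω₀⟩
  have hA : Nonempty A := ⟨π 0 ω₀ xstar⟩
  have hδ0 := hδ.1
  set D := M.augDiameter.toReal with hDdef
  have hN2 : (2 : ℝ) ≤ N := by exact_mod_cast hN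
  have hDN : (N : ℝ) - 1 ≤ D := M.sub_one_le_augDiameter hN hD
  have hD1 : 1 ≤ D := by linarith
  set d := D + ((N : ℝ) - 1) with hd
  have hd0 : 0 ≤ d := by linarith
  have hd2 : d ≤ 2 * D := by linarith
  -- `E t` serves the confidence sets at time `t + 1` and the deviations up to horizon `t + 2`, so
  -- horizon `T` uses `E (T - 2)`.
  choose E hE hgood using fun t : ℕ => h.exists_exceptional_set hδ hd0 (t + 1) (by omega)
  refine ofReal_one_sub_le_measure_of_exceptional (E := E) hδ0.le (fun t => ?_)
    fun ω hω T hT => ?_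
  · refine (hE t).trans_eq ?_
    push_cast
    ring_nf
  have hS1 : (1 : ℝ) ≤ Fintype.card S := by exact_mod_cast Fintype.card_pos
  have hA1 : (1 : ℝ) ≤ Fintype.card A := by exact_mod_cast Fintype.card_pos
  have hT2 : (2 : ℝ) ≤ T := by exact_mod_cast hT
  set L := Real.log (T / δ) with hL
  have hLT : Real.log T ≤ L := by
    refine Real.log_le_log (by linarith) ?_
    rw [le_div_iff₀ hδ0]
    nlinarith [hδ.2]
  have hLlow : 0.69 ≤ L := by
    have := Real.log_le_log two_pos hT2
    linarith [Real.log_two_gt_d9]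
  have hX2 : 2 ≤ (Fintype.card S : ℝ) * N := by nlinarith
  have hreg : regret M (fun t => r t ω) T ≤ T :=
    M.regret_le_natCast (fun t => (h.r_mem t ω).1) T
  have hrhs : 34 * D * Fintype.card S * N * √(Fintype.card A * T * L) =
      34 * D * (Fintype.card S * N) * √(Fintype.card A * T * L) := by ring
  rw [hrhs]
  set X := (Fintype.card S : ℝ) * N with hX
  by_cases hbig : (34 * D * X) ^ 2 * (Fintype.card A * L) ≤ T
  · have hDX : 4 ≤ (D * X) ^ 2 := by
      have : 2 ≤ D * X := by nlinarith
      nlinarith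
    have hAL : 0.69 ≤ Fintype.card A * L := by nlinarith
    have hbig' : 1156 * (D * X) ^ 2 * (Fintype.card A * L) ≤ T := by
      refine le_trans (le_of_eq ?_) hbig
      ring
    have hTlarge : (1100 : ℝ) ≤ T := by nlinarith
    have hL7 : 7 ≤ L := (seven_le_log hTlarge).trans hLT
    have hSX : Fintype.card S ≤ X := by nlinarith
    have hSA : 2 * (Fintype.card S : ℝ) * Fintype.card A ≤ T := by
      have h1 : X ≤ (D * X) ^ 2 := by
        have : X ≤ D * X := by nlinarith
        nlinarith
      have h2 : (Fintype.card A : ℝ) ≤ Fintype.card A * L := by nlinarith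
      have h3 : Fintype.card S * Fintype.card A ≤ (D * X) ^ 2 * (Fintype.card A * L) :=
        mul_le_mul (hSX.trans h1) h2 (by positivity) (by positivity)
      have h4 : 0 ≤ (D * X) ^ 2 * (Fintype.card A * L) := by positivity
      nlinarith
    have hSA' : 2 * Fintype.card S * Fintype.card A ≤ T := by exact_mod_cast hSA
    have hplaus : PUCRL2.AllPlausible M δ (fun i => s i ω)
        (PUCRL2.action (fun i => s i ω) (fun i => π i ω)) (fun i => r i ω) := fun t ht => by
      obtain ⟨t, rfl⟩ := Nat.exists_eq_succ_of_ne_zero (by omega : t ≠ 0)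
      exact (hgood t ω (hω t)).1
    obtain ⟨c, hc0, hc, hc'⟩ : ∃ c : ℝ, 0 ≤ c ∧
        (Nontrivial S → c = √(28 * (Fintype.card S * N) * L)) ∧
        (c = 0 ∨ (c = √(28 * X * L) ∧ 4 ≤ X ∧ 2 ≤ D)) := by
      -- For one state only `D_aug ≥ N - 1` is available, and the bounds `X ≥ 2`, `D ≥ 1` would be
      -- too weak for `34` if the transition term were kept.
      rcases subsingleton_or_nontrivial S with hs | hs
      · exact ⟨0, le_rfl, fun hn => absurd hs (not_subsingleton_iff_nontrivial.2 hn), Or.inl rfl⟩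
      · have h1 : (2 : ℝ) ≤ Fintype.card S := by exact_mod_cast Fintype.one_lt_card
        exact ⟨_, Real.sqrt_nonneg _, fun _ => rfl, Or.inr ⟨rfl, by nlinarith,
          hN2.trans (M.period_le_augDiameter hD)⟩⟩
    have main := PUCRL2.regret_le_of_allPlausible hδ hτ hD (h.run ω) hplaus hSA' hc0 hc hd0 hd
    have hdev := (hgood (T - 2) ω (hω (T - 2))).2
    rw [show T - 2 + 1 + 1 = T by omega] at hdev
    have hdev' := mul_le_mul_of_nonneg_left hdev (by linarith : 0 ≤ 1 + d)
    refine main.trans (le_trans ?_ (regret_bound_numeric hX2 hA1 hL7 hD1 hd0 hd2 hbig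
      (natSize_le (by omega) hLT hL7) hc'))
    exact add_le_add (add_le_add le_rfl hdev') le_rfl
  -- Here `T ^ 2 ≤ (34 D X) ^ 2 A L T`, so the trivial bound `T` on the regret is enough.
  · refine hreg.trans ?_
    rw [not_le] at hbig
    have h1 : (0 : ℝ) ≤ 34 * D * X := by positivity
    rw [← Real.sqrt_sq h1, ← Real.sqrt_mul (sq_nonneg _)]
    refine Real.le_sqrt_of_sq_le ?_
    calc (T : ℝ) ^ 2 = T * T := sq _
      _ ≤ (34 * D * X) ^ 2 * (Fintype.card A * L) * T :=
          mul_le_mul_of_nonneg_right hbig.le (by linarith)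
      _ = _ := by ring
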